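/- Let $M\in\mathbb N$ and let $\mathcal A\subset\{0,1,\dots,M-1\}$ satisfy $1<|\mathcal A|<M$; put $\delta=\log|\mathcal A|/\log M\in(0,1)$. For $\chi\in C_c^\infty((0,1);[0,1])$ and $N=M^k$, $k\ge1$, let $\mathcal F_N$ be the unitary discrete Fourier transform on $\ell^2_N=\mathbb C^{\{0,\dots,N-1\}}$, $(\mathcal F_Nu)(j)=N^{-1/2}\sum_{l=0}^{N-1}e^{-2\pi i jl/N}u(l)$. The quantum open baker's map is $$B_N=\mathcal F_N^*\,\operatorname{diag}\bigl(\chi_{N/M}\mathcal F_{N/M}\chi_{N/M},\dots,\chi_{N/M}\mathcal F_{N/M}\chi_{N/M}\bigr)\,I_{\mathcal A,M},$$ with $M$ diagonal blocks, where $\chi_{N/M}$ is multiplication by $\chi(Mj/N)$, $0\le j<N/M$, and $I_{\mathcal A,M}$ is the diagonal matrix whose $j$th entry is $1$ if $\lfloor Mj/N\rfloor\in\mathcal A$ and $0$ otherwise. Let $$\mathcal N_k(\nu)=\#\{\lambda\in\operatorname{Sp}(B_N):|\lambda|\ge M^{-\nu}\},$$ eigenvalues being counted with algebraic multiplicity.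 Let $C_k=\{\sum_{j=0}^{k-1}a_jM^j: a_0,\dots,a_{k-1}\in\mathcal A\}\subset\mathbb Z/N\mathbb Z$, let $E(C_k)=\#\{(a,b,c,d)\in C_k^4: a+b\equiv c+d \pmod N\}$ be its additive energy, and let $\gamma_{\mathcal A}$ be the supremum of all real $\gamma$ such that for every $\varepsilon>0$ there is $C_\varepsilon>0$ with $E(C_k)\le C_\varepsilon N^{3\delta-\gamma+\varepsilon}$ for all $k$. Put $$\beta_E=\tfrac34\bigl(\tfrac12-\delta\bigr)+\tfrac{\gamma_{\mathcal A}}8 .$$ Then $\gamma_{\mathcal A}>0$, and there is $\beta>\tfrac12-\delta$, depending only on $M$ and $\mathcal A$, such that for every $\chi\in C_c^\infty((0,1);[0,1])$, every $\nu>0$ and every $\varepsilon>0$ there is a constant $C>0$ with $$\mathcal N_k(\nu)\le C\,N^{m(\nu,\delta)+\varepsilon}\qquad\text{for all }k\ge1,\ N=M^k,$$ where $$m(\nu,\delta)=\min\Bigl(4(\nu-\beta),\;4(\nu-\beta_E),\;2\bigl(\nu-(\tfrac12-\delta)\bigr),\;\delta\Bigr).$$ -/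

import Mathlib

noncomputable section

namespace OpenBaker

/-- Entry `(j, l)` of the unitary discrete Fourier transform `F_N` on `ℓ²_N`. -/
def fourierEntry (N j l : ℕ) : ℂ :=
  Complex.exp (-(2 * (Real.pi : ℂ) * Complex.I * (j : ℂ) * (l : ℂ) / (N : ℂ))) / (Real.sqrt N : ℂ)

/-- The unitary discrete Fourier transform `F_N`, indices running over `{0, …, N - 1}`. -/
def fourierMatrix (N : ℕ) : Matrix (Fin N) (Fin N) ℂ :=
  Matrix.of fun j l => fourierEntry N j l

/-- The matrix `χ_n F_n χ_n` (entry `(j, l)`), where `χ_n` is multiplication by `χ(j / n)`. -/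
def cutoffFourierEntry (χ : ℝ → ℝ) (n j l : ℕ) : ℂ :=
  (χ ((j : ℝ) / n) : ℂ) * fourierEntry n j l * (χ ((l : ℝ) / n) : ℂ)

/-- The `N × N` block-diagonal matrix with `M` diagonal blocks, all equal to
`χ_{N/M} F_{N/M} χ_{N/M}` (used when `M` divides `N`). The index `j` lies in block number
`j / (N / M)`, at position `j % (N / M)`. -/
def blockMatrix (M : ℕ) (χ : ℝ → ℝ) (N : ℕ) : Matrix (Fin N) (Fin N) ℂ :=
  Matrix.of fun j l =>
    if (j : ℕ) / (N / M) = (l : ℕ) / (N / M) then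
      cutoffFourierEntry χ (N / M) ((j : ℕ) % (N / M)) ((l : ℕ) % (N / M))
    else 0

/-- The diagonal matrix `I_{A,M}`, with `j`-th entry `1` if `⌊M j / N⌋ ∈ A` and `0` otherwise. -/
def alphabetProjection (M : ℕ) (A : Finset (Fin M)) (N : ℕ) : Matrix (Fin N) (Fin N) ℂ :=
  Matrix.diagonal fun j => if ∃ a ∈ A, (a : ℕ) = M * (j : ℕ) / N then 1 else 0

/-- The quantum open baker's map `B_N` determined by `(M, A, χ)`. -/
def bakerMap (M : ℕ) (A : Finset (Fin M)) (χ : ℝ → ℝ) (N : ℕ) : Matrix (Fin N) (Fin N) ℂ :=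
  (fourierMatrix N).conjTranspose * blockMatrix M χ N * alphabetProjection M A N

open Classical in
/-- The number of eigenvalues `z` of `B_N`, `N = M ^ k`, with `|z| ≥ M ^ (-ν)`, counted with
algebraic multiplicity. -/
def eigenvalueCount (M : ℕ) (A : Finset (Fin M)) (χ : ℝ → ℝ) (k : ℕ) (ν : ℝ) : ℕ :=
  Multiset.card
    ((bakerMap M A χ (M ^ k)).charpoly.roots.filter fun z : ℂ => (M : ℝ) ^ (-ν) ≤ ‖z‖)

/-- The dimension `δ = log |A| / log M` of the limiting Cantor set. -/
def dim (M : ℕ) (A : Finset (Fin M)) : ℝ :=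
  Real.log A.card / Real.log M

/-- The discrete Cantor set `C_k ⊆ ℤ / M ^ k` of the numbers all of whose `k` base-`M` digits
lie in `A`. -/
def cantorSet (M : ℕ) (A : Finset (Fin M)) (k : ℕ) : Finset (ZMod (M ^ k)) :=
  (Fintype.piFinset fun _ : Fin k => A).image fun a =>
    ((∑ i : Fin k, (a i : ℕ) * M ^ (i : ℕ) : ℕ) : ZMod (M ^ k))

/-- The additive-energy exponent `γ_A`: the best `γ` such that for every `ε > 0` the additive
energy of `C_k` in `ℤ / N`, `N = M ^ k`, is at most `C_ε N ^ (3 δ - γ + ε)` for all `k`.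
Here `Finset.addEnergy s s` is the number of `(a, b, c, d) ∈ s ^ 4` with `a + b = c + d`. -/
def gammaA (M : ℕ) (A : Finset (Fin M)) : ℝ :=
  sSup {γ : ℝ | ∀ ε : ℝ, 0 < ε → ∃ C : ℝ, 0 < C ∧ ∀ k : ℕ,
    ((cantorSet M A k).addEnergy (cantorSet M A k) : ℝ) ≤
      C * ((M : ℝ) ^ k) ^ (3 * dim M A - γ + ε)}

/-- The additive-energy gap `β_E = (3/4) (1/2 - δ) + γ_A / 8`. -/
def betaE (M : ℕ) (A : Finset (Fin M)) : ℝ :=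
  3 / 4 * (1 / 2 - dim M A) + gammaA M A / 8

/-- The exponent
`m = min (4 (ν - β), 4 (ν - β_E), 2 (ν - (1/2 - δ)), δ)`. -/
def weylExponent (M : ℕ) (A : Finset (Fin M)) (β ν : ℝ) : ℝ :=
  min (min (4 * (ν - β)) (4 * (ν - betaE M A)))
    (min (2 * (ν - (1 / 2 - dim M A))) (dim M A))

end OpenBaker

end

/-! Write `B` for the baker's map at `N = M ^ k`. The kernel of `B` is concentrated on the graph of
the expanding map `l ↦ M l mod N`, restricted to the `l` whose leading digit lies in `A`: a smooth
cutoff makes the off-graph exponential sums decay faster than any power of `N`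
(`exists_offGraph_bound`). After `k` steps all digits have been tested, so `B ^ k ≈ B ^ k P`, where
`P` projects onto an `N ^ ε`-neighbourhood `X` of the Cantor set (`exists_localization`).
Conjugation by the Fourier transform turns `B` into its transpose (`fourier_conj_bakerMap`), hence
also `B ^ k ≈ Q B ^ k`, where `Q` is the Fourier conjugate of `P` (`hs_sub_freqProj_mul_le`).

An eigenvalue `|λ| ≥ M ^ (-ν)` of `B` gives an eigenvalue of size at least `N ^ (-ν)` of `B ^ k`, so
each moment of the spectrum of `B ^ k` bounds the count. By Schur's inequality and the two
localizations, the second moment is controlled by the squared Hilbert-Schmidt norm of `P Q`, about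
`#X ^ 2 / N`, which yields the exponent `2 (ν - (1/2 - δ))`. The fourth moment is controlled by that
of `P Q (P Q)*`, which is `crossSum / N ^ 2` and yields `4 (ν - β)` as soon as `crossSum` on the
Cantor set is `O(N ^ (2 - 4 β))`. The exponent `δ` comes from Jensen's formula: `B ^ k` has only
about `N ^ δ` non-negligible columns (`card_mul_log_le_of_small_columns`).

There remain two bounds on `crossSum`. The digit structure makes it submultiplicative in `k`
(`crossSum_cantor_add`), and it is strictly below the trivial bound at `k = 2`
(`crossSum_cantor_two_lt`); this gives some `β > 1/2 - δ`. Cauchy-Schwarz bounds it by `N ^ (1/2)`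
times the additive energy (`crossSum_sq_le_energy`), which gives `β_E`. The energy is
submultiplicative too and strictly below the trivial bound at `k = 2`, whence `γ_A > 0`. -/

namespace OpenBaker

open Polynomial Matrix
open scoped Matrix.Norms.L2Operator

/-! ### Hilbert-Schmidt norms. -/

section HilbertSchmidt

variable {m n p : Type*} [Fintype m] [Fintype n] [Fintype p]

/-- The squared Hilbert-Schmidt norm of a matrix. -/
noncomputable def hs (A : Matrix m n ℂ) : ℝ := ∑ i, ∑ j, ‖A i j‖ ^ 2

theorem hs_nonneg (A : Matrix m n ℂ) : 0 ≤ hs A := by unfold hs; positivity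

theorem hs_transpose (A : Matrix m n ℂ) : hs Aᵀ = hs A := by
  unfold hs; rw [Finset.sum_comm]; rfl

theorem hs_conjTranspose (A : Matrix m n ℂ) : hs Aᴴ = hs A := by
  unfold hs; rw [Finset.sum_comm]; simp [conjTranspose_apply]

theorem hs_add_le (A B : Matrix m n ℂ) : hs (A + B) ≤ 2 * hs A + 2 * hs B := by
  unfold hs
  simp only [Finset.mul_sum, ← Finset.sum_add_distrib]
  refine Finset.sum_le_sum fun i _ => Finset.sum_le_sum fun j _ => ?_
  have h := norm_add_le (A i j) (B i j)
  have h0 := norm_nonneg (A i j + B i j)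
  rw [Matrix.add_apply]
  nlinarith [sq_nonneg (‖A i j‖ - ‖B i j‖)]

theorem hs_smul (c : ℂ) (A : Matrix m n ℂ) : hs (c • A) = ‖c‖ ^ 2 * hs A := by
  unfold hs
  simp only [Finset.mul_sum, Matrix.smul_apply, smul_eq_mul, norm_mul, mul_pow]

theorem norm_entry_sq_le_hs (A : Matrix m n ℂ) (i : m) (j : n) : ‖A i j‖ ^ 2 ≤ hs A := by
  unfold hs
  refine le_trans ?_ (Finset.single_le_sum (f := fun i => ∑ j, ‖A i j‖ ^ 2)
    (fun i _ => by positivity) (Finset.mem_univ i))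
  exact Finset.single_le_sum (f := fun j => ‖A i j‖ ^ 2) (fun j _ => by positivity)
    (Finset.mem_univ j)

/-- `hs` is the sum of the squared Euclidean norms of the columns, and left multiplication acts
column by column. -/
theorem hs_mul_le_left [DecidableEq n] (B : Matrix m n ℂ) (A : Matrix n p ℂ) :
    hs (B * A) ≤ ‖B‖ ^ 2 * hs A := by
  unfold hs
  rw [Finset.sum_comm, Finset.sum_comm (s := (Finset.univ : Finset n)), Finset.mul_sum]
  refine Finset.sum_le_sum fun j _ => ?_
  have h := l2_opNorm_mulVec B (WithLp.toLp 2 fun i => A i j)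
  have h2 := pow_le_pow_left₀ (norm_nonneg _) h 2
  rw [mul_pow, EuclideanSpace.norm_sq_eq, EuclideanSpace.norm_sq_eq] at h2
  simpa [Matrix.mulVec, dotProduct, Matrix.mul_apply] using h2

theorem hs_mul_le_of_norm_le_one_left [DecidableEq n] {B : Matrix m n ℂ} (hB : ‖B‖ ≤ 1)
    (A : Matrix n p ℂ) : hs (B * A) ≤ hs A :=
  (hs_mul_le_left B A).trans
    (mul_le_of_le_one_left (hs_nonneg A) (pow_le_one₀ (norm_nonneg B) hB))

theorem hs_mul_le_of_norm_le_one_right [DecidableEq n] [DecidableEq p] {B : Matrix n p ℂ}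
    (hB : ‖B‖ ≤ 1) (A : Matrix m n ℂ) : hs (A * B) ≤ hs A := by
  rw [← hs_conjTranspose, conjTranspose_mul, ← hs_conjTranspose A]
  exact hs_mul_le_of_norm_le_one_left (by rwa [l2_opNorm_conjTranspose]) _

theorem hs_eq_trace (A : Matrix m n ℂ) : (hs A : ℂ) = trace (A * Aᴴ) := by
  simp [hs, trace, Matrix.mul_apply, Complex.mul_conj, Complex.normSq_eq_norm_sq]

theorem norm_trace_mul_sq_le (A : Matrix m n ℂ) (B : Matrix n m ℂ) :
    ‖trace (A * B)‖ ^ 2 ≤ hs A * hs B := by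
  have h1 : ‖trace (A * B)‖ ≤ ∑ x : m × n, ‖A x.1 x.2‖ * ‖B x.2 x.1‖ := by
    rw [Fintype.sum_prod_type]
    simp only [trace, diag_apply, Matrix.mul_apply]
    refine (norm_sum_le _ _).trans (Finset.sum_le_sum fun i _ => ?_)
    refine (norm_sum_le _ _).trans (Finset.sum_le_sum fun j _ => ?_)
    rw [norm_mul]
  refine (pow_le_pow_left₀ (norm_nonneg _) h1 2).trans ?_
  refine (Finset.sum_mul_sq_le_sq_mul_sq _ _ _).trans (le_of_eq ?_)
  rw [← hs_transpose B]
  simp only [hs, Fintype.sum_prod_type, transpose_apply]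

/-- By cyclicity the left side is the trace of `Yᴴ Y` times `T (Y Yᴴ) Tᴴ`. Cauchy-Schwarz applies,
and both factors have Hilbert-Schmidt norm at most that of `Y Yᴴ`. This removes the middle factor in
the fourth moment. -/
theorem hs_mul_mul_le [DecidableEq m] {T : Matrix m m ℂ} (hT : ‖T‖ ≤ 1) (Y : Matrix m m ℂ) :
    hs (Y * T * Y) ≤ hs (Y * Yᴴ) := by
  have h1 : (hs (Y * T * Y) : ℂ) = trace ((Yᴴ * Y) * (T * (Y * Yᴴ) * Tᴴ)) := by
    rw [hs_eq_trace, trace_mul_comm (Yᴴ * Y), Matrix.mul_assoc Y T Y, Matrix.mul_assoc Y,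
      trace_mul_comm Y]
    simp only [conjTranspose_mul, Matrix.mul_assoc]
  have h2 : hs (Yᴴ * Y) = hs (Y * Yᴴ) := by
    have : (hs (Yᴴ * Y) : ℂ) = hs (Y * Yᴴ) := by
      rw [hs_eq_trace, hs_eq_trace]
      simp only [conjTranspose_mul, conjTranspose_conjTranspose]
      rw [Matrix.mul_assoc, trace_mul_comm]
      simp only [Matrix.mul_assoc]
    exact_mod_cast this
  have h3 := norm_trace_mul_sq_le (Yᴴ * Y) (T * (Y * Yᴴ) * Tᴴ)
  rw [← h1, Complex.norm_real, Real.norm_eq_abs, sq_abs, h2] at h3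
  have h4 : hs (T * (Y * Yᴴ) * Tᴴ) ≤ hs (Y * Yᴴ) :=
    (hs_mul_le_of_norm_le_one_right (by rwa [l2_opNorm_conjTranspose]) _).trans
      (hs_mul_le_of_norm_le_one_left hT _)
  have h5 := mul_le_mul_of_nonneg_left h4 (hs_nonneg (Y * Yᴴ))
  exact le_of_sq_le_sq (by nlinarith) (hs_nonneg _)

theorem hs_fromBlocks {m' n' : Type*} [Fintype m'] [Fintype n'] (A : Matrix m n ℂ)
    (B : Matrix m n' ℂ) (C : Matrix m' n ℂ) (D : Matrix m' n' ℂ) :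
    hs (fromBlocks A B C D) = hs A + hs B + (hs C + hs D) := by
  simp only [hs, Fintype.sum_sum_type, Finset.sum_add_distrib, fromBlocks_apply₁₁,
    fromBlocks_apply₁₂, fromBlocks_apply₂₁, fromBlocks_apply₂₂]
  ring

theorem hs_reindex {m' n' : Type*} [Fintype m'] [Fintype n'] (e : m ≃ m') (f : n ≃ n')
    (A : Matrix m n ℂ) : hs (reindex e f A) = hs A := by
  unfold hs
  rw [← e.sum_comp]
  refine Finset.sum_congr rfl fun i _ => ?_
  rw [← f.sum_comp]
  simp

end HilbertSchmidt

/-! ### Schur triangularization and eigenvalues of powers. -/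

section Schur

theorem norm_le_one_of_conjTranspose_mul_self {m n : Type*} [Fintype m] [Fintype n]
    [DecidableEq m] [DecidableEq n] {U : Matrix m n ℂ} (hU : Uᴴ * U = 1) : ‖U‖ ≤ 1 := by
  have h := l2_opNorm_conjTranspose_mul_self U
  rw [hU, ← diagonal_one, l2_opNorm_diagonal] at h
  have h1 : ‖(1 : n → ℂ)‖ ≤ 1 := by
    rw [pi_norm_le_iff_of_nonneg zero_le_one]; simp
  have h2 : ‖(fun _ : n => (1 : ℂ))‖ ≤ 1 := h1
  nlinarith [norm_nonneg U]

/-- `IsSpectrum A l`: the family `l` lists the eigenvalues of `A`, with the expected behaviour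
under powers and the Schur bound. -/
def IsSpectrum {ι : Type*} [Fintype ι] [DecidableEq ι] (A : Matrix ι ι ℂ) (l : ι → ℂ) : Prop :=
  ∀ k : ℕ, (A ^ k).charpoly = ∏ i, (X - C (l i ^ k)) ∧ ∑ i, ‖l i ^ k‖ ^ 2 ≤ hs (A ^ k)

theorem IsSpectrum.of_reindex {ι κ : Type*} [Fintype ι] [DecidableEq ι] [Fintype κ]
    [DecidableEq κ] (e : ι ≃ κ) {A : Matrix ι ι ℂ} {l : κ → ℂ}
    (h : IsSpectrum (reindex e e A) l) : IsSpectrum A (l ∘ e) := by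
  intro k
  obtain ⟨h1, h2⟩ := h k
  have hp : (reindex e e A) ^ k = reindex e e (A ^ k) :=
    (map_pow (reindexAlgEquiv ℂ ℂ e) A k).symm
  rw [hp] at h1 h2
  rw [charpoly_reindex] at h1
  rw [hs_reindex] at h2
  refine ⟨?_, ?_⟩
  · rw [h1, ← e.prod_comp]; rfl
  · refine le_trans (le_of_eq ?_) h2
    rw [← e.sum_comp]; rfl

theorem IsSpectrum.of_conj {ι : Type*} [Fintype ι] [DecidableEq ι] {A U : Matrix ι ι ℂ}
    (hU : Uᴴ * U = 1) {l : ι → ℂ} (h : IsSpectrum (Uᴴ * A * U) l) : IsSpectrum A l := by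
  have hU' : U * Uᴴ = 1 := mul_eq_one_comm.mp hU
  intro k
  obtain ⟨h1, h2⟩ := h k
  have hp : (Uᴴ * A * U) ^ k = Uᴴ * A ^ k * U := by
    clear h1 h2
    induction k with
    | zero => simp [hU]
    | succ k ih =>
      rw [pow_succ, ih, pow_succ]
      calc Uᴴ * A ^ k * U * (Uᴴ * A * U) = Uᴴ * A ^ k * (U * Uᴴ) * A * U := by
            simp only [Matrix.mul_assoc]
        _ = _ := by rw [hU']; simp only [Matrix.mul_assoc, Matrix.mul_one]
  rw [hp] at h1 h2
  have hn := norm_le_one_of_conjTranspose_mul_self hU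
  refine ⟨?_, h2.trans ?_⟩
  · rw [← h1, charpoly_mul_comm, ← Matrix.mul_assoc, hU', Matrix.one_mul]
  · exact (hs_mul_le_of_norm_le_one_right hn _).trans
      (hs_mul_le_of_norm_le_one_left (by rwa [l2_opNorm_conjTranspose]) _)

theorem IsSpectrum.fromBlocks {ι : Type*} [Fintype ι] [DecidableEq ι]
    (a : Matrix Unit Unit ℂ) (w : Matrix Unit ι ℂ) {A : Matrix ι ι ℂ} {l : ι → ℂ}
    (h : IsSpectrum A l) :
    IsSpectrum (Matrix.fromBlocks a w 0 A) (Sum.elim (fun _ => a () ()) l) := by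
  intro k
  obtain ⟨h1, h2⟩ := h k
  have hp : ∃ w', (Matrix.fromBlocks a w 0 A) ^ k = Matrix.fromBlocks (a ^ k) w' 0 (A ^ k) := by
    clear h1 h2
    induction k with
    | zero => exact ⟨0, by simp [fromBlocks_one]⟩
    | succ k ih =>
      obtain ⟨w', hw⟩ := ih
      exact ⟨a ^ k * w + w' * A, by rw [pow_succ, hw, fromBlocks_multiply]; simp [pow_succ]⟩
  obtain ⟨w', hw⟩ := hp
  have ha : (a ^ k) () () = a () () ^ k := by
    clear h1 h2 hw
    induction k with
    | zero => simp
    | succ k ih => simp [pow_succ, Matrix.mul_apply, ih]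
  rw [hw]
  refine ⟨?_, ?_⟩
  · rw [charpoly_fromBlocks_zero₂₁, h1, Fintype.prod_sum_type]
    congr 1
    simp [charpoly, charmatrix, ha]
  · rw [hs_fromBlocks, Fintype.sum_sum_type]
    have : hs (a ^ k) = ‖a () () ^ k‖ ^ 2 := by simp [hs, ha]
    have h0 := hs_nonneg w'
    have h00 := hs_nonneg (0 : Matrix ι Unit ℂ)
    simp only [Sum.elim_inl, Sum.elim_inr, Finset.univ_unique, Finset.sum_const,
      Finset.card_singleton, one_smul]
    linarith

/-- A matrix on `Unit ⊕ ι` is unitarily similar to one whose first column is supported at the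
first entry. -/
theorem exists_conj_eq_fromBlocks {ι : Type*} [Fintype ι] [DecidableEq ι]
    (A : Matrix (Unit ⊕ ι) (Unit ⊕ ι) ℂ) :
    ∃ U : Matrix (Unit ⊕ ι) (Unit ⊕ ι) ℂ, Uᴴ * U = 1 ∧ ∃ a w D,
      Uᴴ * A * U = Matrix.fromBlocks a w 0 D := by
  obtain ⟨μ, hμ⟩ := Module.End.exists_eigenvalue (Matrix.toEuclideanLin A)
  obtain ⟨v₀, hv₀⟩ := hμ.exists_hasEigenvector
  have hne : ‖v₀‖ ≠ 0 := norm_ne_zero_iff.mpr hv₀.2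
  set v : EuclideanSpace ℂ (Unit ⊕ ι) := (‖v₀‖⁻¹ : ℂ) • v₀ with hv
  have hv1 : ‖v‖ = 1 := by rw [hv, norm_smul]; simp [hne]
  have hAv : Matrix.toEuclideanLin A v = μ • v := by
    rw [hv, map_smul, hv₀.apply_eq_smul, smul_comm]
  -- The family is constantly `v`, but orthonormality is only required on the single index `inl ()`;
  -- the other basis vectors are free.
  obtain ⟨b, hb⟩ := Orthonormal.exists_orthonormalBasis_extension_of_card_eq (𝕜 := ℂ)
    (E := EuclideanSpace ℂ (Unit ⊕ ι)) (ι := Unit ⊕ ι) (by simp) (v := fun _ => v)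
    (s := {Sum.inl ()}) (by
      rw [orthonormal_iff_ite]
      rintro ⟨i, rfl⟩ ⟨j, rfl⟩
      simp [Set.domRestrict, hv1])
  have hb1 : b (Sum.inl ()) = v := hb _ rfl
  let U : Matrix (Unit ⊕ ι) (Unit ⊕ ι) ℂ := Matrix.of fun i j => b j i
  have hU : Uᴴ * U = 1 := by
    ext i j
    have := orthonormal_iff_ite.mp b.orthonormal i j
    rw [PiLp.inner_apply] at this
    simpa [U, Matrix.mul_apply, conjTranspose_apply, Matrix.one_apply, mul_comm] using this
  refine ⟨U, hU, (Uᴴ * A * U).toBlocks₁₁, (Uᴴ * A * U).toBlocks₁₂, (Uᴴ * A * U).toBlocks₂₂, ?_⟩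
  have h21 : (Uᴴ * A * U).toBlocks₂₁ = 0 := by
    ext i j
    have hAU : ∀ x, (A * U) x (Sum.inl ()) = μ * U x (Sum.inl ()) := by
      intro x
      have := congrArg (fun w : EuclideanSpace ℂ (Unit ⊕ ι) => w x) hAv
      simpa [U, hb1, Matrix.mul_apply, Matrix.toEuclideanLin, Matrix.mulVec, dotProduct] using this
    have := congrFun (congrFun hU (Sum.inr i)) (Sum.inl ())
    rw [Matrix.mul_apply] at this
    simp only [toBlocks₂₁, Matrix.of_apply, Matrix.mul_assoc]
    rw [Matrix.mul_apply]
    simp only [hAU]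
    calc _ = μ * ∑ x, Uᴴ (Sum.inr i) x * U x (Sum.inl ()) := by
          rw [Finset.mul_sum]; exact Finset.sum_congr rfl fun x _ => by ring
      _ = 0 := by rw [this]; simp
  rw [← h21, fromBlocks_toBlocks]

theorem exists_isSpectrum_fin (n : ℕ) : ∀ A : Matrix (Fin n) (Fin n) ℂ, ∃ l, IsSpectrum A l := by
  induction n with
  | zero =>
    intro A
    exact ⟨0, fun k => ⟨by simp [charpoly], by simp [hs_nonneg]⟩⟩
  | succ n ih =>
    intro A
    let e : Fin (n + 1) ≃ Unit ⊕ Fin n := Fintype.equivOfCardEq (by simp [add_comm])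
    obtain ⟨U, hU, a, w, D, h⟩ := exists_conj_eq_fromBlocks (reindex e e A)
    obtain ⟨l, hl⟩ := ih D
    refine ⟨_, IsSpectrum.of_reindex e (IsSpectrum.of_conj hU
      (l := Sum.elim (fun _ => a () ()) l) ?_)⟩
    rw [h]
    exact IsSpectrum.fromBlocks a w hl

theorem exists_isSpectrum {ι : Type*} [Fintype ι] [DecidableEq ι] (A : Matrix ι ι ℂ) :
    ∃ l, IsSpectrum A l := by
  obtain ⟨l, hl⟩ := exists_isSpectrum_fin _ (reindex (Fintype.equivFin ι) (Fintype.equivFin ι) A)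
  exact ⟨_, IsSpectrum.of_reindex _ hl⟩

end Schur

/-! ### Eigenvalue bounds: Schur's inequality with an approximate projection, and Jensen's formula.
-/

section Counting

variable {ι : Type*} [Fintype ι]

theorem roots_prod_X_sub_C_eq (l : ι → ℂ) :
    (∏ i, (X - C (l i))).roots = Finset.univ.val.map l := by
  have := Polynomial.roots_multiset_prod_X_sub_C ((Finset.univ : Finset ι).val.map l)
  rw [Multiset.map_map] at this
  exact this

variable [DecidableEq ι]

theorem sum_roots_charpoly_le_hs (A : Matrix ι ι ℂ) :
    (A.charpoly.roots.map fun z => ‖z‖ ^ 2).sum ≤ hs A := by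
  obtain ⟨l, hl⟩ := exists_isSpectrum A
  obtain ⟨h1, h2⟩ := hl 1
  simp only [pow_one] at h1 h2
  rw [h1, roots_prod_X_sub_C_eq, Multiset.map_map]
  exact h2

/-- If `S` is close to `Q * S`, then the eigenvalues of `S` are controlled by `S * Q`. -/
theorem sum_sq_le_of_approx {S Q : Matrix ι ι ℂ} (hQ : ‖Q‖ ≤ 1) {l : ι → ℂ}
    (hl : S.charpoly = ∏ i, (X - C (l i))) {t : ℝ} (ht : 0 < t) :
    ∑ i, ‖l i‖ ^ 2 ≤ hs (S * Q) + t ^ 2 * hs S + (t⁻¹ ^ 2 + 1) * hs (S - Q * S) := by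
  set R := S - Q * S with hR
  have ht' : (t : ℂ) ≠ 0 := by exact_mod_cast ht.ne'
  -- `S = Q S + R` factors as the row `[Q, t]` times the column `[S; t⁻¹ R]`. The product in the
  -- reverse order has the same nonzero eigenvalues, and its blocks are `S Q`, `t S`, `t⁻¹ R Q` and
  -- `R`; Schur's bound therefore sees `S Q` up to small errors.
  have hUW : fromCols Q ((t : ℂ) • (1 : Matrix ι ι ℂ)) * fromRows S ((t : ℂ)⁻¹ • R) = S := by
    rw [fromCols_mul_fromRows, smul_mul_smul_comm, mul_inv_cancel₀ ht', one_smul, Matrix.one_mul,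
      hR]
    abel
  have hWU : fromRows S ((t : ℂ)⁻¹ • R) * fromCols Q ((t : ℂ) • (1 : Matrix ι ι ℂ)) =
      Matrix.fromBlocks (S * Q) ((t : ℂ) • S) ((t : ℂ)⁻¹ • (R * Q)) R := by
    rw [fromRows_mul_fromCols]
    congr 1
    · simp
    · simp
    · rw [smul_mul_smul_comm, inv_mul_cancel₀ ht', one_smul, Matrix.mul_one]
  have hc := charpoly_mul_comm_of_le (fromRows S ((t : ℂ)⁻¹ • R))
    (fromCols Q ((t : ℂ) • (1 : Matrix ι ι ℂ))) (by simp)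
  rw [hUW, hWU] at hc
  have hS := sum_roots_charpoly_le_hs
    (Matrix.fromBlocks (S * Q) ((t : ℂ) • S) ((t : ℂ)⁻¹ • (R * Q)) R)
  rw [hc, roots_mul (mul_ne_zero (pow_ne_zero _ X_ne_zero) (charpoly_monic S).ne_zero),
    Multiset.map_add, Multiset.sum_add, hl, roots_prod_X_sub_C_eq, Multiset.map_map] at hS
  have h0 : 0 ≤ (((X : ℂ[X]) ^ (Fintype.card (ι ⊕ ι) - Fintype.card ι)).roots.map
      fun z => ‖z‖ ^ 2).sum := by
    refine Multiset.sum_nonneg ?_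
    simp only [Multiset.mem_map]
    rintro _ ⟨z, -, rfl⟩
    positivity
  have h1 : ∑ i, ‖l i‖ ^ 2 ≤
      hs (Matrix.fromBlocks (S * Q) ((t : ℂ) • S) ((t : ℂ)⁻¹ • (R * Q)) R) := by
    refine le_trans ?_ hS
    refine le_trans (le_of_eq ?_) (le_add_of_nonneg_left h0)
    rfl
  rw [hs_fromBlocks, hs_smul, hs_smul] at h1
  have h2 := hs_mul_le_of_norm_le_one_right hQ R
  have h3 : ‖(t : ℂ)‖ = t := by simp [abs_of_pos ht]
  rw [norm_inv, h3] at h1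
  nlinarith [sq_nonneg t⁻¹]

/-- Expanding the product of column sums gives one term for every map `ι → ι`; the permutations are
among them. -/
theorem norm_det_le_prod_sum_norm (A : Matrix ι ι ℂ) : ‖A.det‖ ≤ ∏ j, ∑ i, ‖A i j‖ := by
  rw [Finset.prod_univ_sum, det_apply']
  refine (norm_sum_le _ _).trans ?_
  have h1 : ∀ σ : Equiv.Perm ι, ‖((Equiv.Perm.sign σ : ℤ) : ℂ) * ∏ i, A (σ i) i‖ =
      ∏ i, ‖A (σ i) i‖ := by
    intro σ
    rw [norm_mul, norm_prod]
    rcases Int.units_eq_one_or (Equiv.Perm.sign σ) with h | h <;> simp [h]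
  simp only [h1, Fintype.piFinset_univ]
  have := Finset.sum_image (s := (Finset.univ : Finset (Equiv.Perm ι)))
    (g := fun σ : Equiv.Perm ι => (σ : ι → ι)) (f := fun x : ι → ι => ∏ i, ‖A (x i) i‖)
    (DFunLike.coe_injective.injOn)
  rw [← this]
  exact Finset.sum_le_sum_of_subset_of_nonneg (Finset.subset_univ _) fun _ _ _ => by positivity

theorem mahlerMeasure_le_of_norm_eval_le {p : ℂ[X]} {K : ℝ} (hK : 1 ≤ K)
    (h : ∀ z : ℂ, ‖z‖ = 1 → ‖p.eval z‖ ≤ K) : p.mahlerMeasure ≤ K := by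
  by_cases hp : p = 0
  · simp [hp]; linarith
  rw [mahlerMeasure_def_of_ne_zero hp, ← Real.le_log_iff_exp_le (by linarith)]
  have h1 : ∫ x in (0 : ℝ)..(2 * Real.pi), Real.log ‖eval (circleMap 0 1 x) p‖ ≤
      ∫ _ in (0 : ℝ)..(2 * Real.pi), Real.log K := by
    refine intervalIntegral.integral_mono_on (by positivity) p.intervalIntegrable_mahlerMeasure
      (by simp) fun x _ => ?_
    rcases (norm_nonneg (eval (circleMap 0 1 x) p)).eq_or_lt with h0 | h0
    -- At a zero on the circle the real logarithm takes the default value `0`, so the comparison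
    -- needs `log K ≥ 0`.
    · rw [← h0, Real.log_zero]; exact Real.log_nonneg hK
    · exact Real.log_le_log h0 (h _ (by simp))
  rw [intervalIntegral.integral_const, smul_eq_mul, sub_zero] at h1
  calc _ ≤ (2 * Real.pi)⁻¹ * (2 * Real.pi * Real.log K) := by gcongr
    _ = Real.log K := by field_simp

/-- By Jensen's formula the left side is the Mahler measure of the monic polynomial with roots `l i
/ s`. On the unit circle this polynomial is `s ^ (-n) det (s z - T)`, `n` being the size of `T`,
which the column sums bound. -/
theorem prod_max_one_le_prod_col_sum {T : Matrix ι ι ℂ} {l : ι → ℂ}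
    (hl : T.charpoly = ∏ i, (X - C (l i))) {s : ℝ} (hs0 : 0 < s) :
    ∏ i, max 1 (‖l i‖ / s) ≤ ∏ j, (1 + (∑ i, ‖T i j‖) / s) := by
  set p : ℂ[X] := ∏ i, (X - C (l i / s)) with hp
  have hsC : (s : ℂ) ≠ 0 := by exact_mod_cast hs0.ne'
  have h1 : p.mahlerMeasure = ∏ i, max 1 (‖l i‖ / s) := by
    rw [mahlerMeasure_eq_leadingCoeff_mul_prod_roots, hp,
      (monic_prod_of_monic _ _ fun i _ => monic_X_sub_C _).leadingCoeff,
      roots_prod_X_sub_C_eq, Multiset.map_map]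
    rw [norm_one, one_mul]
    refine Finset.prod_congr rfl fun i _ => ?_
    simp [abs_of_pos hs0]
  rw [← h1]
  refine mahlerMeasure_le_of_norm_eval_le ?_ fun z hz => ?_
  · refine Finset.one_le_prod fun j _ => ?_
    have : 0 ≤ (∑ i, ‖T i j‖) / s := by positivity
    linarith
  · have h2 : p.eval z = (s : ℂ)⁻¹ ^ Fintype.card ι * (Matrix.scalar ι ((s : ℂ) * z) - T).det := by
      rw [← Matrix.eval_charpoly, hl, hp, eval_prod, eval_prod]
      rw [← Finset.card_univ, ← Finset.prod_const, ← Finset.prod_mul_distrib]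
      refine Finset.prod_congr rfl fun i _ => ?_
      simp only [eval_sub, eval_X, eval_C]
      field_simp
    rw [h2, norm_mul, norm_pow, norm_inv, Complex.norm_real, Real.norm_eq_abs, abs_of_pos hs0]
    calc _ ≤ s⁻¹ ^ Fintype.card ι * ∏ j, ∑ i, ‖(Matrix.scalar ι ((s : ℂ) * z) - T) i j‖ := by
          gcongr
          exact norm_det_le_prod_sum_norm _
      _ = ∏ j, s⁻¹ * ∑ i, ‖(Matrix.scalar ι ((s : ℂ) * z) - T) i j‖ := by
          rw [Finset.prod_mul_distrib, Finset.prod_const, Finset.card_univ]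
      _ ≤ _ := by
          refine Finset.prod_le_prod (fun j _ => by positivity) fun j _ => ?_
          have : ∑ i, ‖(Matrix.scalar ι ((s : ℂ) * z) - T) i j‖ ≤ s + ∑ i, ‖T i j‖ := by
            calc _ ≤ ∑ i, ((if i = j then s else 0) + ‖T i j‖) := by
                  refine Finset.sum_le_sum fun i _ => (norm_sub_le _ _).trans ?_
                  gcongr
                  by_cases hij : i = j <;> simp [hij, hz, abs_of_pos hs0]
              _ = _ := by rw [Finset.sum_add_distrib]; simp
          calc _ ≤ s⁻¹ * (s + ∑ i, ‖T i j‖) := by gcongr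
            _ = _ := by field_simp

end Counting

end OpenBaker

namespace OpenBaker

open Finset

/-! ### Exponential sums over finite sets of integers and additive energy. -/

section ExponentialSums

/-- The character `x ↦ exp (2 π i x)` of `ℝ / ℤ`. -/
noncomputable def ex (x : ℝ) : ℂ := Complex.exp (2 * Real.pi * Complex.I * x)

theorem ex_add (x y : ℝ) : ex (x + y) = ex x * ex y := by
  unfold ex; rw [← Complex.exp_add]; push_cast; ring_nf

theorem ex_eq (x : ℝ) : ex x = Complex.exp ((2 * Real.pi * x : ℝ) * Complex.I) := by
  unfold ex; push_cast; ring_nf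

@[simp] theorem norm_ex (x : ℝ) : ‖ex x‖ = 1 := by
  rw [ex_eq, Complex.norm_exp_ofReal_mul_I]

@[simp] theorem ex_zero : ex 0 = 1 := by simp [ex]

theorem ex_int (n : ℤ) : ex n = 1 := by
  unfold ex
  rw [Complex.exp_eq_one_iff]
  exact ⟨n, by push_cast; ring⟩

theorem ex_add_int (x : ℝ) (n : ℤ) : ex (x + n) = ex x := by rw [ex_add, ex_int, mul_one]

theorem conj_ex (x : ℝ) : (starRingEnd ℂ) (ex x) = ex (-x) := by
  unfold ex
  rw [← Complex.exp_conj]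
  congr 1
  simp [Complex.conj_ofNat]

theorem ex_nat_mul (n : ℕ) (x : ℝ) : ex (n * x) = ex x ^ n := by
  unfold ex; rw [← Complex.exp_nat_mul]; push_cast; ring_nf

theorem ex_eq_one_iff (x : ℝ) : ex x = 1 ↔ ∃ n : ℤ, x = n := by
  unfold ex
  rw [Complex.exp_eq_one_iff]
  have h2 : (2 * Real.pi * Complex.I : ℂ) ≠ 0 := Complex.two_pi_I_ne_zero
  constructor
  · rintro ⟨n, hn⟩
    refine ⟨n, ?_⟩
    have : (x : ℂ) = n := by
      apply mul_left_cancel₀ h2; rw [hn]; ring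
    exact_mod_cast this
  · rintro ⟨n, hn⟩
    exact ⟨n, by rw [hn]; push_cast; ring⟩

theorem re_ex_le_one (x : ℝ) : (ex x).re ≤ 1 := by
  have := Complex.re_le_norm (ex x); rwa [norm_ex] at this

theorem re_ex_lt_one {x : ℝ} (h : ∀ n : ℤ, x ≠ n) : (ex x).re < 1 := by
  refine lt_of_le_of_ne (re_ex_le_one x) fun h1 => ?_
  have h2 : ex x = 1 := by
    have hn := Complex.sq_norm (ex x)
    rw [norm_ex, Complex.normSq_apply, h1] at hn
    apply Complex.ext
    · simpa using h1
    · have : (ex x).im * (ex x).im = 0 := by linarith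
      simpa using this
  obtain ⟨n, hn⟩ := (ex_eq_one_iff x).mp h2
  exact h n hn

theorem norm_sum_ex_sq (T : Finset ℤ) (u : ℝ) :
    ((‖∑ y ∈ T, ex (y * u)‖ ^ 2 : ℝ) : ℂ) = ∑ y ∈ T, ∑ y' ∈ T, ex (((y : ℝ) - y') * u) := by
  rw [Complex.ofReal_pow, ← Complex.mul_conj', map_sum, Finset.sum_mul_sum]
  refine sum_congr rfl fun y _ => sum_congr rfl fun y' _ => ?_
  rw [conj_ex, ← ex_add]
  ring_nf

theorem sum_range_ex {N : ℕ} (hN : 0 < N) (m : ℤ) :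
    ∑ j ∈ range N, ex (j * ((m : ℝ) / N)) = if (N : ℤ) ∣ m then (N : ℂ) else 0 := by
  have hN' : (N : ℝ) ≠ 0 := by positivity
  simp only [ex_nat_mul]
  have hiff : ex ((m : ℝ) / N) = 1 ↔ (N : ℤ) ∣ m := by
    rw [ex_eq_one_iff]
    constructor
    · rintro ⟨n, hn⟩
      rw [div_eq_iff hN'] at hn
      exact ⟨n, by rw [mul_comm]; exact_mod_cast hn⟩
    · rintro ⟨n, rfl⟩
      exact ⟨n, by push_cast; field_simp⟩
  split_ifs with h
  · simp [hiff.mpr h]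
  · have h1 : ex ((m : ℝ) / N) ≠ 1 := fun h' => h (hiff.mp h')
    rw [geom_sum_eq h1, ← ex_nat_mul, mul_div_cancel₀ _ hN', ex_int]
    simp

/-- The sum over pairs of the squared moduli of the exponential sums of `T` at the shifted
differences of `S`. -/
noncomputable def crossSum (N : ℝ) (S T : Finset ℤ) (t : ℝ) : ℝ :=
  ∑ x ∈ S, ∑ x' ∈ S, ‖∑ y ∈ T, ex (y * (((x : ℝ) - x' + t) / N))‖ ^ 2

theorem crossSum_nonneg (N : ℝ) (S T : Finset ℤ) (t : ℝ) : 0 ≤ crossSum N S T t := by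
  unfold crossSum; positivity

/-- Expanding the squares and summing over `S` before `T` exchanges the two sets; the shift `t`
survives only as unimodular phases in front of nonnegative terms. -/
theorem crossSum_eq (N : ℝ) (S T : Finset ℤ) (t : ℝ) :
    (crossSum N S T t : ℂ) = ∑ y ∈ T, ∑ y' ∈ T, ex (((y : ℝ) - y') * (t / N)) *
      ((‖∑ x ∈ S, ex (x * (((y : ℝ) - y') / N))‖ ^ 2 : ℝ) : ℂ) := by
  unfold crossSum
  simp only [Complex.ofReal_sum, norm_sum_ex_sq, Finset.mul_sum]
  calc _ = ∑ x ∈ S, ∑ y ∈ T, ∑ x' ∈ S, ∑ y' ∈ T, ex (((y : ℝ) - y') * (((x : ℝ) - x' + t) / N)) :=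
        sum_congr rfl fun x _ => sum_comm
    _ = ∑ y ∈ T, ∑ x ∈ S, ∑ x' ∈ S, ∑ y' ∈ T, ex (((y : ℝ) - y') * (((x : ℝ) - x' + t) / N)) :=
        sum_comm
    _ = ∑ y ∈ T, ∑ x ∈ S, ∑ y' ∈ T, ∑ x' ∈ S, ex (((y : ℝ) - y') * (((x : ℝ) - x' + t) / N)) :=
        sum_congr rfl fun x _ => sum_congr rfl fun _ _ => sum_comm
    _ = ∑ y ∈ T, ∑ y' ∈ T, ∑ x ∈ S, ∑ x' ∈ S, ex (((y : ℝ) - y') * (((x : ℝ) - x' + t) / N)) :=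
        sum_congr rfl fun x _ => sum_comm
    _ = _ := by
        refine sum_congr rfl fun y _ => sum_congr rfl fun y' _ => sum_congr rfl fun x _ =>
          sum_congr rfl fun x' _ => ?_
        rw [← ex_add]
        congr 1
        ring

theorem crossSum_comm (N : ℝ) (S T : Finset ℤ) : crossSum N S T 0 = crossSum N T S 0 := by
  have h := crossSum_eq N S T 0
  simp only [zero_div, mul_zero, ex_zero, one_mul] at h
  rw [crossSum] at h
  rw [crossSum, crossSum]
  simp only [add_zero] at h ⊢
  exact_mod_cast h

/-- The exchanged form is a sum of phases times nonnegative numbers, so it is largest when all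
phases are `1`. -/
theorem crossSum_le (N : ℝ) (S T : Finset ℤ) (t : ℝ) : crossSum N S T t ≤ crossSum N S T 0 := by
  have h := congrArg norm (crossSum_eq N S T t)
  rw [Complex.norm_real, Real.norm_of_nonneg (crossSum_nonneg _ _ _ _)] at h
  rw [h, crossSum_comm, crossSum]
  refine (norm_sum_le _ _).trans (sum_le_sum fun y _ => ?_)
  refine (norm_sum_le _ _).trans (sum_le_sum fun y' _ => ?_)
  rw [norm_mul, norm_ex, one_mul, Complex.norm_real, Real.norm_of_nonneg (by positivity), add_zero]

/-- Covering the first set by `#J` translates of `S` costs a factor `#J ^ 2`. -/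
theorem crossSum_le_of_cover (N : ℝ) {S S' J : Finset ℤ} (T : Finset ℤ)
    (h : ∀ x ∈ S', ∃ s ∈ S, ∃ j ∈ J, x = s + j) :
    crossSum N S' T 0 ≤ (#J : ℝ) ^ 2 * crossSum N S T 0 := by
  classical
  have key : ∀ g : ℤ → ℝ, (∀ x, 0 ≤ g x) → ∑ x ∈ S', g x ≤ ∑ j ∈ J, ∑ s ∈ S, g (s + j) := by
    intro g hg
    rw [← sum_product' J S (fun j s => g (s + j))]
    have hsub : S' ⊆ (J ×ˢ S).image fun p => p.2 + p.1 := by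
      intro x hx
      obtain ⟨s, hs, j, hj, rfl⟩ := h x hx
      exact mem_image.mpr ⟨(j, s), mem_product.mpr ⟨hj, hs⟩, rfl⟩
    refine (sum_le_sum_of_subset_of_nonneg hsub fun _ _ _ => hg _).trans ?_
    exact sum_image_le_of_nonneg fun _ _ => hg _
  calc crossSum N S' T 0
      ≤ ∑ j ∈ J, ∑ s ∈ S, ∑ j' ∈ J, ∑ s' ∈ S,
          ‖∑ y ∈ T, ex (y * ((((s + j : ℤ) : ℝ) - ((s' + j' : ℤ) : ℝ) + 0) / N))‖ ^ 2 := by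
        unfold crossSum
        refine (key (fun x => ∑ x' ∈ S', ‖∑ y ∈ T, ex (y * (((x : ℝ) - x' + 0) / N))‖ ^ 2)
          fun x => by positivity).trans ?_
        refine sum_le_sum fun j _ => sum_le_sum fun s _ => ?_
        exact key (fun x' => ‖∑ y ∈ T, ex (y * ((((s + j : ℤ) : ℝ) - x' + 0) / N))‖ ^ 2)
          fun x => by positivity
    -- Two translates `S + j` and `S + j'` interact through the differences of `S` shifted by `j -
    -- j'`.
    _ = ∑ j ∈ J, ∑ j' ∈ J, crossSum N S T ((j : ℝ) - j') := by
        refine sum_congr rfl fun j _ => ?_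
        rw [sum_comm]
        refine sum_congr rfl fun j' _ => ?_
        unfold crossSum
        refine sum_congr rfl fun s _ => sum_congr rfl fun s' _ => ?_
        congr 2
        refine sum_congr rfl fun y _ => ?_
        congr 1
        push_cast
        ring
    _ ≤ ∑ j ∈ J, ∑ j' ∈ J, crossSum N S T 0 :=
        sum_le_sum fun j _ => sum_le_sum fun j' _ => crossSum_le _ _ _ _
    _ = _ := by simp only [sum_const, nsmul_eq_mul]; ring

/-- The number of quadruples of `S` with `a + b ≡ c + d` modulo `N`. -/
def energy (N : ℕ) (S : Finset ℤ) : ℕ :=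
  ∑ a ∈ S, ∑ b ∈ S, ∑ c ∈ S, ∑ d ∈ S, if (N : ℤ) ∣ a + b - c - d then 1 else 0

theorem norm_sum_ex_pow_four (S : Finset ℤ) (u : ℝ) :
    ((‖∑ y ∈ S, ex (y * u)‖ ^ 4 : ℝ) : ℂ) =
      ∑ a ∈ S, ∑ b ∈ S, ∑ c ∈ S, ∑ d ∈ S, ex (((a : ℝ) + b - c - d) * u) := by
  have h : ((‖∑ y ∈ S, ex (y * u)‖ ^ 4 : ℝ) : ℂ) =
      ((‖∑ y ∈ S, ex (y * u)‖ ^ 2 : ℝ) : ℂ) * ((‖∑ y ∈ S, ex (y * u)‖ ^ 2 : ℝ) : ℂ) := by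
    push_cast; ring
  rw [h, norm_sum_ex_sq, sum_mul_sum]
  refine sum_congr rfl fun a _ => sum_congr rfl fun b _ => ?_
  rw [sum_mul_sum]
  refine sum_congr rfl fun c _ => sum_congr rfl fun d _ => ?_
  rw [← ex_add]
  ring_nf

theorem sum_range_norm_pow_four {N : ℕ} (hN : 0 < N) (S : Finset ℤ) (t : ℝ) :
    ((∑ j ∈ range N, ‖∑ y ∈ S, ex (y * ((j + t) / N))‖ ^ 4 : ℝ) : ℂ) =
      N * ∑ a ∈ S, ∑ b ∈ S, ∑ c ∈ S, ∑ d ∈ S,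
        if (N : ℤ) ∣ a + b - c - d then ex (((a : ℝ) + b - c - d) * (t / N)) else 0 := by
  simp only [Complex.ofReal_sum, norm_sum_ex_pow_four, mul_sum]
  rw [sum_comm]
  refine sum_congr rfl fun a _ => ?_
  rw [sum_comm]
  refine sum_congr rfl fun b _ => ?_
  rw [sum_comm]
  refine sum_congr rfl fun c _ => ?_
  rw [sum_comm]
  refine sum_congr rfl fun d _ => ?_
  have h := sum_range_ex hN (a + b - c - d)
  calc _ = (∑ j ∈ range N, ex (j * (((a + b - c - d : ℤ) : ℝ) / N))) *
        ex (((a : ℝ) + b - c - d) * (t / N)) := by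
        rw [sum_mul]
        refine sum_congr rfl fun j _ => ?_
        rw [← ex_add]
        congr 1
        push_cast
        ring
    _ = _ := by rw [h]; split_ifs <;> simp

theorem sum_range_norm_pow_four_zero {N : ℕ} (hN : 0 < N) (S : Finset ℤ) :
    ∑ j ∈ range N, ‖∑ y ∈ S, ex (y * ((j : ℝ) / N))‖ ^ 4 = N * energy N S := by
  have h := sum_range_norm_pow_four hN S 0
  simp only [add_zero, zero_div, mul_zero, ex_zero] at h
  have h2 : (N : ℂ) * ∑ a ∈ S, ∑ b ∈ S, ∑ c ∈ S, ∑ d ∈ S,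
      (if (N : ℤ) ∣ a + b - c - d then (1 : ℂ) else 0) = ((N * energy N S : ℝ) : ℂ) := by
    simp [energy]
  rw [h2] at h
  exact_mod_cast h

/-- Orthogonality leaves the same quadruples as for `t = 0`; the shift only attaches a phase to
each. -/
theorem sum_range_norm_pow_four_le {N : ℕ} (hN : 0 < N) (S : Finset ℤ) (t : ℝ) :
    ∑ j ∈ range N, ‖∑ y ∈ S, ex (y * ((j + t) / N))‖ ^ 4 ≤ N * energy N S := by
  have h := congrArg norm (sum_range_norm_pow_four hN S t)
  rw [Complex.norm_real, Real.norm_of_nonneg (by positivity)] at h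
  rw [h, norm_mul, Complex.norm_natCast]
  gcongr
  unfold energy
  push_cast
  refine (norm_sum_le _ _).trans (sum_le_sum fun a _ => ?_)
  refine (norm_sum_le _ _).trans (sum_le_sum fun b _ => ?_)
  refine (norm_sum_le _ _).trans (sum_le_sum fun c _ => ?_)
  refine (norm_sum_le _ _).trans (sum_le_sum fun d _ => ?_)
  split_ifs <;> simp

theorem sum_ite_dvd_sub {N : ℕ} (hN : 0 < N) (m : ℤ) {R : Type*} [AddCommMonoid R] (g : ℤ → R)
    (hg : ∀ i j : ℤ, (N : ℤ) ∣ i - j → g i = g j) :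
    ∑ j ∈ range N, (if (N : ℤ) ∣ m - j then g j else 0) = g m := by
  have hN' : (0 : ℤ) < N := by exact_mod_cast hN
  rw [sum_eq_single (m % N).toNat]
  · have h1 : (((m % N).toNat : ℕ) : ℤ) = m % N := Int.toNat_of_nonneg (Int.emod_nonneg _ hN'.ne')
    have h2 : (N : ℤ) ∣ m - (m % N) := Int.dvd_self_sub_emod
    rw [h1, if_pos h2]
    exact (hg _ _ h2).symm
  · intro b hb hne
    rw [if_neg]
    intro hd
    apply hne
    have : m % N = b % N := Int.emod_eq_emod_iff_emod_sub_eq_zero.mpr (Int.emod_eq_zero_of_dvd hd)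
    rw [this, Int.emod_eq_of_lt (by positivity) (by exact_mod_cast mem_range.mp hb)]
    simp
  · intro h
    exfalso
    apply h
    rw [mem_range]
    have := Int.emod_lt_of_pos m hN'
    have := Int.emod_nonneg m hN'.ne'
    omega

/-- The fourth Schatten moment is controlled by the additive energy. -/
theorem crossSum_sq_le_energy {N : ℕ} (hN : 0 < N) (S : Finset ℤ) :
    crossSum N S S 0 ^ 2 ≤ N * (energy N S : ℝ) ^ 2 := by
  have hN' : (N : ℝ) ≠ 0 := by positivity
  set f : ℤ → ℝ := fun j => ‖∑ y ∈ S, ex (y * ((j : ℝ) / N))‖ ^ 2 with hf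
  -- `r j` counts the representations of `j` as a difference in `S`. Then `crossSum` is `∑ r f`,
  -- with `∑ r ^ 2` equal to the energy and `∑ f ^ 2` to `N` times the energy, and Cauchy-Schwarz
  -- concludes.
  set r : ℤ → ℝ := fun j => ∑ x ∈ S, ∑ x' ∈ S, if (N : ℤ) ∣ x - x' - j then 1 else 0 with hr
  have hper : ∀ i j : ℤ, (N : ℤ) ∣ i - j → f i = f j := by
    rintro i j ⟨c, hc⟩
    simp only [hf]
    congr 2
    refine sum_congr rfl fun y _ => ?_
    have : (i : ℝ) = j + N * c := by
      have : i = j + N * c := by linarith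
      rw [this]; push_cast; ring
    rw [this, show (y : ℝ) * ((j + N * c) / N) = y * (j / N) + ((y * c : ℤ) : ℝ) by
      push_cast; field_simp, ex_add_int]
  have h1 : crossSum N S S 0 = ∑ j ∈ range N, r j * f j := by
    simp only [hr, sum_mul, ite_mul, one_mul, zero_mul]
    rw [sum_comm]
    unfold crossSum
    refine sum_congr rfl fun x _ => ?_
    rw [sum_comm]
    refine sum_congr rfl fun x' _ => ?_
    rw [sum_ite_dvd_sub hN (x - x') f hper]
    simp [hf]
  have h2 : ∑ j ∈ range N, r j ^ 2 = energy N S := by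
    have h4 : ∀ x x' z z' : ℤ, ∑ j ∈ range N, ((if (N : ℤ) ∣ x - x' - j then (1 : ℝ) else 0) *
        if (N : ℤ) ∣ z - z' - j then 1 else 0) =
        if (N : ℤ) ∣ x + z' - x' - z then 1 else 0 := by
      intro x x' z z'
      simp only [ite_mul, one_mul, zero_mul]
      rw [sum_ite_dvd_sub hN (x - x') (fun j => if (N : ℤ) ∣ z - z' - j then (1 : ℝ) else 0)]
      · refine if_congr ?_ rfl rfl
        rw [← dvd_neg]
        ring_nf
      · intro i j hij
        refine if_congr ?_ rfl rfl
        rw [← dvd_add_left hij]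
        ring_nf
    simp only [hr, sq, sum_mul_sum]
    calc _ = ∑ x ∈ S, ∑ z ∈ S, ∑ x' ∈ S, ∑ z' ∈ S, ∑ j ∈ range N,
          ((if (N : ℤ) ∣ x - x' - j then (1 : ℝ) else 0) *
            if (N : ℤ) ∣ z - z' - j then 1 else 0) := by
          rw [sum_comm]
          refine sum_congr rfl fun x _ => ?_
          rw [sum_comm]
          refine sum_congr rfl fun z _ => ?_
          rw [sum_comm]
          refine sum_congr rfl fun x' _ => ?_
          rw [sum_comm]
      _ = ∑ x ∈ S, ∑ z ∈ S, ∑ x' ∈ S, ∑ z' ∈ S,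
          (if (N : ℤ) ∣ x + z' - x' - z then (1 : ℝ) else 0) := by simp only [h4]
      _ = ∑ x ∈ S, ∑ z ∈ S, ∑ z' ∈ S, ∑ x' ∈ S,
          (if (N : ℤ) ∣ x + z' - x' - z then (1 : ℝ) else 0) :=
          sum_congr rfl fun x _ => sum_congr rfl fun z _ => sum_comm
      _ = ∑ x ∈ S, ∑ z' ∈ S, ∑ z ∈ S, ∑ x' ∈ S,
          (if (N : ℤ) ∣ x + z' - x' - z then (1 : ℝ) else 0) :=
          sum_congr rfl fun x _ => sum_comm
      _ = ∑ x ∈ S, ∑ z' ∈ S, ∑ x' ∈ S, ∑ z ∈ S,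
          (if (N : ℤ) ∣ x + z' - x' - z then (1 : ℝ) else 0) :=
          sum_congr rfl fun x _ => sum_congr rfl fun z _ => sum_comm
      _ = _ := by simp [energy]
  have h3 : ∑ j ∈ range N, f j ^ 2 = N * energy N S := by
    rw [← sum_range_norm_pow_four_zero hN]
    refine sum_congr rfl fun j _ => ?_
    simp only [hf]
    push_cast
    ring
  rw [h1]
  refine (sum_mul_sq_le_sq_mul_sq _ _ _).trans (le_of_eq ?_)
  rw [h2, h3]
  ring

end ExponentialSums

end OpenBaker

namespace OpenBaker

open Finset

/-! ### Discrete Cantor sets: submultiplicativity and strict gaps at level two. -/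

section Cantor

/-- The integers with `k` base-`M` digits, all in `D`. -/
def cantor (M : ℕ) (D : Finset ℤ) : ℕ → Finset ℤ
  | 0 => {0}
  | k + 1 => image₂ (fun a c => a + M * c) D (cantor M D k)

variable {M : ℕ} {D : Finset ℤ}

theorem eq_of_add_mul_eq (hD : ∀ a ∈ D, 0 ≤ a ∧ a < M) {a b c d : ℤ} (ha : a ∈ D) (hb : b ∈ D)
    (h : a + M * c = b + M * d) : a = b ∧ c = d := by
  obtain ⟨ha0, ha1⟩ := hD a ha
  obtain ⟨hb0, hb1⟩ := hD b hb
  have h1 : a = b := by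
    have := congrArg (· % (M : ℤ)) h
    simpa [Int.emod_eq_of_lt, ha0, ha1, hb0, hb1] using this
  refine ⟨h1, ?_⟩
  have hM : (M : ℤ) ≠ 0 := by omega
  exact mul_left_cancel₀ hM (by linarith)

theorem sum_cantor_succ (hD : ∀ a ∈ D, 0 ≤ a ∧ a < M) {R : Type*} [AddCommMonoid R] (k : ℕ)
    (f : ℤ → R) :
    ∑ x ∈ cantor M D (k + 1), f x = ∑ a ∈ D, ∑ c ∈ cantor M D k, f (a + M * c) := by
  rw [cantor, ← sum_product', image₂, sum_image]
  · rfl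
  · rintro ⟨a, c⟩ h ⟨b, d⟩ h' heq
    simp only [coe_product, Set.mem_prod, mem_coe] at h h'
    obtain ⟨rfl, rfl⟩ := eq_of_add_mul_eq hD h.1 h'.1 heq
    rfl

theorem sum_cantor_add (hD : ∀ a ∈ D, 0 ≤ a ∧ a < M) {R : Type*} [AddCommMonoid R] (j k : ℕ)
    (f : ℤ → R) :
    ∑ x ∈ cantor M D (j + k), f x =
      ∑ p ∈ cantor M D j, ∑ q ∈ cantor M D k, f (p + (M : ℤ) ^ j * q) := by
  induction j generalizing f with
  | zero => simp [cantor]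
  | succ j ih =>
    rw [show j + 1 + k = j + k + 1 by ring, sum_cantor_succ hD, sum_cantor_succ hD]
    refine sum_congr rfl fun a _ => ?_
    rw [ih]
    refine sum_congr rfl fun p _ => sum_congr rfl fun q _ => ?_
    congr 1
    ring

theorem add_mem_cantor {j k : ℕ} {p q : ℤ} (hp : p ∈ cantor M D j) (hq : q ∈ cantor M D k) :
    p + (M : ℤ) ^ j * q ∈ cantor M D (j + k) := by
  induction j generalizing p with
  | zero =>
    have : p = 0 := by simpa [cantor] using hp
    simpa [this] using hq
  | succ j ih =>
    obtain ⟨a, ha, c, hc, rfl⟩ := mem_image₂.mp hp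
    rw [show j + 1 + k = j + k + 1 by ring]
    exact mem_image₂.mpr ⟨a, ha, _, ih hc, by ring⟩

theorem mem_cantor_one {a : ℤ} (ha : a ∈ D) : a ∈ cantor M D 1 :=
  mem_image₂.mpr ⟨a, ha, 0, by simp [cantor], by simp⟩

theorem mem_cantor_two {a b : ℤ} (ha : a ∈ D) (hb : b ∈ D) : a + M * b ∈ cantor M D 2 :=
  mem_image₂.mpr ⟨a, ha, b, mem_cantor_one hb, rfl⟩

theorem exists_of_mem_cantor_two {x : ℤ} (hx : x ∈ cantor M D 2) :
    ∃ a ∈ D, ∃ b ∈ D, x = a + M * b := by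
  obtain ⟨a, ha, c, hc, rfl⟩ := mem_image₂.mp hx
  obtain ⟨b, hb, d, hd, rfl⟩ := mem_image₂.mp hc
  have : d = 0 := by simpa [cantor] using hd
  exact ⟨a, ha, b, hb, by simp [this]⟩

theorem cantor_bounds (hD : ∀ a ∈ D, 0 ≤ a ∧ a < M) {k : ℕ} {x : ℤ} (hx : x ∈ cantor M D k) :
    0 ≤ x ∧ x < (M : ℤ) ^ k := by
  induction k generalizing x with
  | zero =>
    have : x = 0 := by simpa [cantor] using hx
    simp [this]
  | succ k ih =>
    obtain ⟨a, ha, c, hc, rfl⟩ := mem_image₂.mp hx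
    obtain ⟨h0, h1⟩ := hD a ha
    obtain ⟨h2, h3⟩ := ih hc
    refine ⟨by positivity, ?_⟩
    have : (M : ℤ) * (c + 1) ≤ M * (M : ℤ) ^ k := by gcongr; omega
    rw [pow_succ]
    linarith

theorem card_cantor (hD : ∀ a ∈ D, 0 ≤ a ∧ a < M) (k : ℕ) : #(cantor M D k) = #D ^ k := by
  induction k with
  | zero => simp [cantor]
  | succ k ih =>
    rw [card_eq_sum_ones, sum_cantor_succ hD]
    simp [ih, pow_succ, mul_comm]

/-- With `x = b + M ^ j a` and `y = d + M ^ k c`, the phase `y (x - x') / M ^ (j + k)` is, modulo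
the integer `c (a - a')`, a phase in `c` at scale `M ^ j` plus a phase in `d` at scale `M ^ k`. The
inner sum factors; the second factor carries the shift `(b - b') / M ^ j`, which `crossSum_le`
removes. -/
theorem crossSum_cantor_add (hD : ∀ a ∈ D, 0 ≤ a ∧ a < M) (hM : 0 < M) (j k : ℕ) :
    crossSum ((M : ℝ) ^ (j + k)) (cantor M D (j + k)) (cantor M D (j + k)) 0 ≤
      crossSum ((M : ℝ) ^ j) (cantor M D j) (cantor M D j) 0 *
        crossSum ((M : ℝ) ^ k) (cantor M D k) (cantor M D k) 0 := by
  have hM' : (M : ℝ) ≠ 0 := by positivity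
  have key : ∀ b a b' a' : ℤ, ‖∑ y ∈ cantor M D (j + k),
      ex (y * ((((b + (M : ℤ) ^ j * a : ℤ) : ℝ) - ((b' + (M : ℤ) ^ j * a' : ℤ) : ℝ) + 0) /
        (M : ℝ) ^ (j + k)))‖ ^ 2 =
      ‖∑ c ∈ cantor M D j, ex (c * (((b : ℝ) - b' + 0) / (M : ℝ) ^ j))‖ ^ 2 *
      ‖∑ d ∈ cantor M D k, ex (d * (((a : ℝ) - a' + ((b : ℝ) - b') / (M : ℝ) ^ j) /
        (M : ℝ) ^ k))‖ ^ 2 := by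
    intro b a b' a'
    rw [← mul_pow, ← norm_mul, mul_comm (Finset.sum (cantor M D j) _), sum_mul_sum, show j + k = k + j by ring,
      sum_cantor_add hD]
    congr 2
    refine sum_congr rfl fun d _ => sum_congr rfl fun c _ => ?_
    rw [← ex_add]
    rw [← ex_add_int (_ + _) (c * (a - a'))]
    congr 1
    push_cast
    field_simp
    ring
  conv_lhs => unfold crossSum
  rw [sum_cantor_add hD]
  simp only [sum_cantor_add hD j k (fun x' => ‖∑ y ∈ cantor M D (j + k), ex (y * ((_ - (x' : ℝ)
    + 0) / (M : ℝ) ^ (j + k)))‖ ^ 2), key]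
  calc _ = ∑ b ∈ cantor M D j, ∑ b' ∈ cantor M D j,
        ‖∑ c ∈ cantor M D j, ex (c * (((b : ℝ) - b' + 0) / (M : ℝ) ^ j))‖ ^ 2 *
        crossSum ((M : ℝ) ^ k) (cantor M D k) (cantor M D k) (((b : ℝ) - b') / (M : ℝ) ^ j) := by
        refine sum_congr rfl fun b _ => ?_
        rw [sum_comm]
        refine sum_congr rfl fun b' _ => ?_
        simp only [crossSum, mul_sum]
    _ ≤ ∑ b ∈ cantor M D j, ∑ b' ∈ cantor M D j,
        ‖∑ c ∈ cantor M D j, ex (c * (((b : ℝ) - b' + 0) / (M : ℝ) ^ j))‖ ^ 2 *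
        crossSum ((M : ℝ) ^ k) (cantor M D k) (cantor M D k) 0 := by
        refine sum_le_sum fun b _ => sum_le_sum fun b' _ => ?_
        gcongr
        exact crossSum_le _ _ _ _
    _ = _ := by
        conv_rhs => rw [crossSum]
        simp only [sum_mul]

theorem sum_range_mul_eq {R : Type*} [AddCommMonoid R] (m n : ℕ) (f : ℕ → R) :
    ∑ j ∈ range (m * n), f j = ∑ a ∈ range m, ∑ b ∈ range n, f (b + n * a) := by
  rw [sum_range, ← finProdFinEquiv.sum_comp, Fintype.sum_prod_type, sum_range]
  refine sum_congr rfl fun a _ => ?_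
  rw [sum_range]
  rfl

/-- Fourth powers of exponential sums over frequencies modulo `M ^ (j + k)` count the energy.
Splitting the frequency as `b + M ^ k a` factors each sum, and the leftover shift `b / M ^ k` is
harmless by `sum_range_norm_pow_four_le`. -/
theorem energy_cantor_add (hD : ∀ a ∈ D, 0 ≤ a ∧ a < M) (hM : 0 < M) (j k : ℕ) :
    energy (M ^ (j + k)) (cantor M D (j + k)) ≤
      energy (M ^ j) (cantor M D j) * energy (M ^ k) (cantor M D k) := by
  have hM' : (M : ℝ) ≠ 0 := by positivity
  have hpos : ∀ i, 0 < M ^ i := fun i => by positivity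
  have h1 := sum_range_norm_pow_four_zero (hpos (j + k)) (cantor M D (j + k))
  have h2 := sum_range_norm_pow_four_zero (hpos k) (cantor M D k)
  have h3 := fun t => sum_range_norm_pow_four_le (hpos j) (cantor M D j) t
  have key : ∀ a b : ℕ, ‖∑ y ∈ cantor M D (j + k), ex (y * (((b + M ^ k * a : ℕ) : ℝ) /
      ((M ^ (j + k) : ℕ) : ℝ)))‖ ^ 4 =
      ‖∑ p ∈ cantor M D j, ex (p * ((a + (b : ℝ) / (M : ℝ) ^ k) / ((M ^ j : ℕ) : ℝ)))‖ ^ 4 *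
      ‖∑ q ∈ cantor M D k, ex (q * ((b : ℝ) / ((M ^ k : ℕ) : ℝ)))‖ ^ 4 := by
    intro a b
    rw [← mul_pow, ← norm_mul, sum_mul_sum, sum_cantor_add hD]
    congr 2
    refine sum_congr rfl fun p _ => sum_congr rfl fun q _ => ?_
    rw [← ex_add]
    rw [← ex_add_int (_ + _) (q * a)]
    congr 1
    push_cast
    field_simp
    ring
  have h4 : ((M ^ (j + k) : ℕ) : ℝ) * energy (M ^ (j + k)) (cantor M D (j + k)) ≤
      ((M ^ j : ℕ) * energy (M ^ j) (cantor M D j)) *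
        ((M ^ k : ℕ) * energy (M ^ k) (cantor M D k)) := by
    rw [← h1, ← h2, pow_add, sum_range_mul_eq, sum_comm, mul_sum]
    refine sum_le_sum fun b _ => ?_
    rw [← pow_add]
    simp only [key]
    rw [← sum_mul]
    gcongr
    exact h3 _
  have h5 : (0 : ℝ) < (M : ℝ) ^ (j + k) := by positivity
  have h6 : ((energy (M ^ (j + k)) (cantor M D (j + k)) : ℕ) : ℝ) ≤
      energy (M ^ j) (cantor M D j) * energy (M ^ k) (cantor M D k) := by
    refine le_of_mul_le_mul_left ?_ h5
    push_cast at h4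
    calc _ ≤ _ := h4
      _ = _ := by ring
  exact_mod_cast h6

theorem exists_lt_mem (hD₁ : 1 < #D) : ∃ a ∈ D, ∃ b ∈ D, a < b := by
  obtain ⟨a, ha, b, hb, hne⟩ := one_lt_card.mp hD₁
  rcases lt_or_gt_of_ne hne with h | h
  · exact ⟨a, ha, b, hb, h⟩
  · exact ⟨b, hb, a, ha, h⟩

theorem norm_sum_ex_sq_le (T : Finset ℤ) (u : ℝ) : ‖∑ y ∈ T, ex (y * u)‖ ^ 2 ≤ (#T : ℝ) ^ 2 := by
  gcongr
  exact (norm_sum_le _ _).trans (by simp)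

theorem norm_sum_ex_sq_lt {T : Finset ℤ} {u : ℝ} {y y' : ℤ} (hy : y ∈ T) (hy' : y' ∈ T)
    (h : ∀ n : ℤ, ((y : ℝ) - y') * u ≠ n) : ‖∑ y ∈ T, ex (y * u)‖ ^ 2 < (#T : ℝ) ^ 2 := by
  have h1 := congrArg Complex.re (norm_sum_ex_sq T u)
  rw [Complex.ofReal_re, ← sum_product' T T fun y y' : ℤ => ex (((y : ℝ) - y') * u),
    Complex.re_sum] at h1
  rw [h1]
  calc ∑ i ∈ T ×ˢ T, (ex (((i.1 : ℝ) - i.2) * u)).re < ∑ _p ∈ T ×ˢ T, (1 : ℝ) :=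
        sum_lt_sum (fun _ _ => re_ex_le_one _) ⟨(y, y'), mk_mem_product hy hy', re_ex_lt_one h⟩
    _ = _ := by simp [sq]

/-- Level two contains two elements whose difference `b - a` is smaller than `M`. Taken in both
variables it produces the phase `(b - a) ^ 2 / M ^ 2`, which lies strictly between `0` and `1`, so
some cancellation occurs. At level one `(b - a) ^ 2 / M` could be an integer. -/
theorem crossSum_cantor_two_lt (hD : ∀ a ∈ D, 0 ≤ a ∧ a < M) (hD₁ : 1 < #D) :
    crossSum ((M : ℝ) ^ 2) (cantor M D 2) (cantor M D 2) 0 < (#D : ℝ) ^ 8 := by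
  obtain ⟨a, ha, b, hb, hab⟩ := exists_lt_mem hD₁
  have ha' := hD a ha
  have hb' := hD b hb
  have hx := mem_cantor_two (M := M) hb ha
  have hx' := mem_cantor_two (M := M) ha ha
  unfold crossSum
  rw [← sum_product' (cantor M D 2) (cantor M D 2) fun x x' : ℤ =>
    ‖∑ y ∈ cantor M D 2, ex (y * (((x : ℝ) - x' + 0) / (M : ℝ) ^ 2))‖ ^ 2]
  calc _ < ∑ _p ∈ cantor M D 2 ×ˢ cantor M D 2, (#(cantor M D 2) : ℝ) ^ 2 := by
        refine sum_lt_sum (fun _ _ => norm_sum_ex_sq_le _ _)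
          ⟨(b + M * a, a + M * a), mk_mem_product hx hx', ?_⟩
        refine norm_sum_ex_sq_lt hx hx' fun n hn => ?_
        have hM : (0 : ℝ) < M := by exact_mod_cast (lt_of_le_of_lt ha'.1 ha'.2)
        push_cast at hn
        have h1 : ((b : ℝ) - a) ^ 2 = n * (M : ℝ) ^ 2 := by
          field_simp at hn
          linarith
        have h2 : (b - a) ^ 2 = n * (M : ℤ) ^ 2 := by exact_mod_cast h1
        have h3 : 0 < b - a := by omega
        have h4 : b - a < M := by omega
        have h5 : 0 < n := by
          by_contra hcon
          push Not at hcon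
          nlinarith [sq_nonneg (M : ℤ)]
        nlinarith [sq_nonneg (M : ℤ)]
    _ = _ := by
        rw [sum_const, card_product, card_cantor hD]
        simp
        ring

/-- Otherwise the set modulo `M ^ 2` would be stable under adding `b - a`, where `0 < b - a < M`. A
progression with step below `M` cannot jump over the `M` consecutive residues whose leading digit is
a missing digit `j`. -/
theorem exists_not_dvd_of_cantor_two (hD : ∀ a ∈ D, 0 ≤ a ∧ a < M) (hD₁ : 1 < #D)
    (hD₂ : #D < M) : ∃ a ∈ cantor M D 2, ∃ b ∈ cantor M D 2, ∃ c ∈ cantor M D 2,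
      ∀ d ∈ cantor M D 2, ¬ ((M ^ 2 : ℕ) : ℤ) ∣ a + b - c - d := by
  by_contra hcon
  push Not at hcon
  obtain ⟨a, ha, b, hb, hab⟩ := exists_lt_mem hD₁
  have ha' := hD a ha
  have hb' := hD b hb
  obtain ⟨j, hj, hjD⟩ : ∃ j ∈ Ico (0 : ℤ) M, j ∉ D := by
    by_contra hall
    push Not at hall
    have := card_le_card (show Ico (0 : ℤ) M ⊆ D from hall)
    simp at this
    omega
  rw [mem_Ico] at hj
  have hx0 := mem_cantor_two (M := M) ha ha
  have hx0b := cantor_bounds hD hx0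
  set x₀ := a + M * a with hx₀
  have hstep : ∀ n : ℕ, ∃ y ∈ cantor M D 2, ((M ^ 2 : ℕ) : ℤ) ∣ x₀ + n * (b - a) - y := by
    intro n
    induction n with
    | zero => exact ⟨x₀, hx0, by simp⟩
    | succ n ih =>
      obtain ⟨y, hy, hdy⟩ := ih
      obtain ⟨d, hd, hdd⟩ := hcon y hy _ (mem_cantor_two (M := M) hb ha) _ hx0
      refine ⟨d, hd, ?_⟩
      have := dvd_add hdy hdd
      rwa [show x₀ + n * (b - a) - y + (y + (b + M * a) - x₀ - d) =
        x₀ + ((n + 1 : ℕ) : ℤ) * (b - a) - d by push_cast; rw [hx₀]; ring] at this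
  -- `z` is the distance from `x₀` to the start of the gap, one period later so that it is positive.
  -- The first term of the progression strictly beyond it overshoots by `s`, with `0 < s ≤ b - a <
  -- M`, and so lies in the gap.
  set z : ℤ := (M : ℤ) ^ 2 + j * M - x₀ with hz
  have hMpos : (0 : ℤ) < M := by omega
  have hzpos : 0 < z := by nlinarith [mul_nonneg hj.1 hMpos.le]
  have hh : 0 < b - a := by omega
  have hq0 : 0 ≤ z / (b - a) := Int.ediv_nonneg hzpos.le hh.le
  have hq1 := Int.emod_add_mul_ediv z (b - a)
  have hq2 := Int.emod_nonneg z hh.ne'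
  have hq3 := Int.emod_lt_of_pos z hh
  obtain ⟨y, hy, hdy⟩ := hstep ((z / (b - a)) + 1).toNat
  rw [Int.toNat_of_nonneg (by omega)] at hdy
  obtain ⟨p, hp, q, hq, rfl⟩ := exists_of_mem_cantor_two hy
  have hp' := hD p hp
  have hq' := hD q hq
  set s : ℤ := (b - a) - z % (b - a) with hs
  have heq : x₀ + (z / (b - a) + 1) * (b - a) = (M : ℤ) ^ 2 + j * M + s := by
    rw [hs]; nlinarith
  rw [heq] at hdy
  have hs0 : 0 < s := by omega
  have hs1 : s < M := by omega
  have hd2 : ((M ^ 2 : ℕ) : ℤ) ∣ (s + M * j) - (p + M * q) := by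
    have := dvd_sub hdy (dvd_refl ((M ^ 2 : ℕ) : ℤ))
    rwa [show (M : ℤ) ^ 2 + j * M + s - (p + M * q) - ((M ^ 2 : ℕ) : ℤ) =
      (s + M * j) - (p + M * q) by push_cast; ring] at this
  have hb1 : ∀ u v : ℤ, 0 ≤ u → u < M → 0 ≤ v → v < M → 0 ≤ u + M * v ∧
      u + M * v < (M : ℤ) ^ 2 := by
    intro u v hu hu' hv hv'
    refine ⟨by positivity, ?_⟩
    have : (M : ℤ) * (v + 1) ≤ M * M := by gcongr; omega
    nlinarith
  obtain ⟨h1, h2⟩ := hb1 s j hs0.le hs1 hj.1 hj.2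
  obtain ⟨h3, h4⟩ := hb1 p q hp'.1 hp'.2 hq'.1 hq'.2
  have h5 : (s + M * j) - (p + M * q) = 0 := by
    refine Int.eq_zero_of_abs_lt_dvd hd2 ?_
    push_cast
    rw [abs_lt]
    constructor <;> linarith
  have h6 : j = q := by
    have := congrArg (· / (M : ℤ)) (sub_eq_zero.mp h5)
    simp only [Int.add_mul_ediv_left _ _ hMpos.ne'] at this
    rwa [Int.ediv_eq_zero_of_lt hs0.le hs1, Int.ediv_eq_zero_of_lt hp'.1 hp'.2, zero_add,
      zero_add] at this
  exact hjD (h6 ▸ hq)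

/-- Three entries of a quadruple determine the fourth, which gives the trivial bound `(#D ^ 2) ^ 3`;
the preceding lemma provides a triple with no fourth entry. -/
theorem energy_cantor_two_lt (hD : ∀ a ∈ D, 0 ≤ a ∧ a < M) (hD₁ : 1 < #D) (hD₂ : #D < M) :
    energy (M ^ 2) (cantor M D 2) < #D ^ 6 := by
  obtain ⟨a, ha, b, hb, c, hc, hd⟩ := exists_not_dvd_of_cantor_two hD hD₁ hD₂
  set S := cantor M D 2 with hS
  have hle : ∀ m : ℤ, (∑ d ∈ S, if ((M ^ 2 : ℕ) : ℤ) ∣ m - d then 1 else 0) ≤ 1 := by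
    intro m
    rw [← card_filter, card_le_one]
    intro d hd d' hd'
    rw [mem_filter] at hd hd'
    have h1 := cantor_bounds hD hd.1
    have h2 := cantor_bounds hD hd'.1
    have h3 := dvd_sub hd.2 hd'.2
    have h4 : d' - d = 0 := by
      refine Int.eq_zero_of_abs_lt_dvd (m := ((M ^ 2 : ℕ) : ℤ)) ?_ ?_
      · rwa [show m - d - (m - d') = d' - d by ring] at h3
      · push_cast
        rw [abs_lt]
        constructor <;> linarith
    omega
  unfold energy
  calc _ = ∑ p ∈ S ×ˢ S ×ˢ S, ∑ d ∈ S,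
        (if ((M ^ 2 : ℕ) : ℤ) ∣ p.1 + p.2.1 - p.2.2 - d then 1 else 0) := by
        simp only [sum_product]
    _ < ∑ _p ∈ S ×ˢ S ×ˢ S, 1 := by
        refine sum_lt_sum (fun p _ => hle _) ⟨(a, b, c), ?_, ?_⟩
        · simp [ha, hb, hc]
        · rw [sum_eq_zero]
          · exact one_pos
          · intro d hdS
            rw [if_neg (hd d hdS)]
    _ = _ := by
        simp [card_product, hS, card_cantor hD]
        ring

end Cantor

/-- Induction in steps of two; `K` absorbs the cases `k = 0` and `k = 1`. -/
theorem exists_growth_bound {u : ℕ → ℝ} (h2 : 0 < u 2)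
    (hsub : ∀ k, u (2 + k) ≤ u 2 * u k) : ∃ K, 0 < K ∧ ∀ k, u k ≤ K * Real.sqrt (u 2) ^ k := by
  have hs : 0 < Real.sqrt (u 2) := Real.sqrt_pos.mpr h2
  refine ⟨max 1 (max (u 0) (u 1 / Real.sqrt (u 2))), by positivity, fun k => ?_⟩
  set K := max 1 (max (u 0) (u 1 / Real.sqrt (u 2))) with hK
  induction k using Nat.twoStepInduction with
  | zero => simp [hK]
  | one =>
    rw [pow_one, ← div_le_iff₀ hs]
    exact (le_max_right _ _).trans (le_max_right _ _)
  | more k ih _ =>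
    rw [add_comm k 2]
    calc _ ≤ u 2 * u k := hsub k
      _ ≤ u 2 * (K * Real.sqrt (u 2) ^ k) := by gcongr
      _ = _ := by rw [pow_add, Real.sq_sqrt h2.le]; ring

end OpenBaker

namespace OpenBaker

open Finset

/-! ### From digit sets to the exponents `β` and `γ_A`. -/

section Exponents

variable {M : ℕ}

/-- The alphabet as a set of integers. -/
def digits (A : Finset (Fin M)) : Finset ℤ := A.image fun a : Fin M => ((a : ℕ) : ℤ)

theorem digits_bounds (A : Finset (Fin M)) : ∀ a ∈ digits A, 0 ≤ a ∧ a < M := by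
  intro a ha
  obtain ⟨b, -, rfl⟩ := mem_image.mp ha
  exact ⟨by positivity, by exact_mod_cast b.2⟩

theorem card_digits (A : Finset (Fin M)) : #(digits A) = #A :=
  card_image_of_injective _ fun a b h => Fin.ext (by exact_mod_cast h)

theorem mem_cantor_digits_iff (A : Finset (Fin M)) (k : ℕ) (x : ℤ) :
    x ∈ cantor M (digits A) k ↔
      ∃ a : Fin k → Fin M, (∀ i, a i ∈ A) ∧ ((∑ i, (a i : ℕ) * M ^ (i : ℕ) : ℕ) : ℤ) = x := by
  induction k generalizing x with
  | zero => simp [cantor, eq_comm]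
  | succ k ih =>
    have hs : ∀ (b : Fin M) (a : Fin k → Fin M),
        ((∑ i, ((Fin.cons b a : Fin (k + 1) → Fin M) i : ℕ) * M ^ (i : ℕ) : ℕ) : ℤ) =
        ((b : ℕ) : ℤ) + M * ((∑ i, (a i : ℕ) * M ^ (i : ℕ) : ℕ) : ℤ) := by
      intro b a
      rw [Fin.sum_univ_succ]
      push_cast
      rw [mul_sum]
      simp only [Fin.cons_zero, Fin.cons_succ, Fin.val_zero, pow_zero, mul_one, Fin.val_succ]
      congr 1
      exact sum_congr rfl fun i _ => by ring
    rw [cantor, mem_image₂]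
    constructor
    · rintro ⟨b, hb, c, hc, rfl⟩
      obtain ⟨b, hbA, rfl⟩ := mem_image.mp hb
      obtain ⟨a, ha, rfl⟩ := (ih c).mp hc
      refine ⟨Fin.cons b a, fun i => ?_, hs b a⟩
      refine Fin.cases ?_ (fun i => ?_) i
      · simpa using hbA
      · simpa using ha i
    · rintro ⟨a, ha, rfl⟩
      refine ⟨((a 0 : ℕ) : ℤ), mem_image_of_mem _ (ha 0), _,
        (ih _).mpr ⟨Fin.tail a, fun i => ha i.succ, rfl⟩, ?_⟩
      rw [← hs, Fin.cons_self_tail]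

theorem cantorSet_eq (A : Finset (Fin M)) (k : ℕ) :
    cantorSet M A k = (cantor M (digits A) k).image fun x : ℤ => (x : ZMod (M ^ k)) := by
  ext z
  simp only [cantorSet, mem_image, Fintype.mem_piFinset, mem_cantor_digits_iff]
  constructor
  · rintro ⟨a, ha, rfl⟩
    exact ⟨_, ⟨a, ha, rfl⟩, by push_cast; rfl⟩
  · rintro ⟨x, ⟨a, ha, rfl⟩, rfl⟩
    exact ⟨a, ha, by push_cast; rfl⟩

theorem addEnergy_cantorSet (A : Finset (Fin M)) (k : ℕ) :
    (cantorSet M A k).addEnergy (cantorSet M A k) = energy (M ^ k) (cantor M (digits A) k) := by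
  have hinj : ∀ x ∈ cantor M (digits A) k, ∀ y ∈ cantor M (digits A) k,
      (x : ZMod (M ^ k)) = y → x = y := by
    intro x hx y hy h
    rw [ZMod.intCast_eq_intCast_iff_dvd_sub] at h
    have h1 := cantor_bounds (digits_bounds A) hx
    have h2 := cantor_bounds (digits_bounds A) hy
    have h3 : y - x = 0 := by
      refine Int.eq_zero_of_abs_lt_dvd h ?_
      push_cast
      rw [abs_lt]
      constructor <;> linarith
    omega
  rw [addEnergy_eq_card_filter, card_filter]
  simp only [sum_product]
  rw [cantorSet_eq]
  unfold energy
  rw [sum_image hinj]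
  refine sum_congr rfl fun a _ => ?_
  rw [sum_image hinj]
  refine sum_congr rfl fun b _ => ?_
  rw [sum_image hinj]
  refine sum_congr rfl fun c _ => ?_
  rw [sum_image hinj]
  refine sum_congr rfl fun d _ => ?_
  refine if_congr ?_ rfl rfl
  have h := ZMod.intCast_eq_intCast_iff_dvd_sub (c + d) (a + b) (M ^ k)
  rw [show a + b - c - d = a + b - (c + d) by ring, ← h, eq_comm]
  push_cast
  rfl

variable {A : Finset (Fin M)}

theorem rpow_dim (hA₁ : 1 < #A) (hA₂ : #A < M) : (M : ℝ) ^ dim M A = #A := by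
  have h1 : (1 : ℝ) < M := by exact_mod_cast hA₁.trans hA₂
  rw [dim, Real.rpow_def_of_pos (by linarith), mul_div_cancel₀ _ (Real.log_pos h1).ne',
    Real.exp_log (by exact_mod_cast (by omega : 0 < #A))]

theorem pow_rpow_dim (hA₁ : 1 < #A) (hA₂ : #A < M) (k : ℕ) :
    ((M : ℝ) ^ k) ^ dim M A = (#A : ℝ) ^ k := by
  rw [← Real.rpow_pow_comm (by positivity), rpow_dim hA₁ hA₂]

theorem dim_pos (hA₁ : 1 < #A) (hA₂ : #A < M) : 0 < dim M A := by
  have h1 : (1 : ℝ) < M := by exact_mod_cast hA₁.trans hA₂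
  exact div_pos (Real.log_pos (by exact_mod_cast hA₁)) (Real.log_pos h1)

/-- A submultiplicative sequence with `u 2 < #A ^ (2 r)` has exponent smaller than `r δ`. -/
theorem exists_exponent_lt (hA₁ : 1 < #A) (hA₂ : #A < M) {u : ℕ → ℝ} (h2 : 0 < u 2)
    (hsub : ∀ k, u (2 + k) ≤ u 2 * u k) {r : ℕ} (hlt : u 2 < (#A : ℝ) ^ (2 * r)) :
    ∃ σ < r * dim M A, ∃ K, 0 < K ∧ ∀ k, u k ≤ K * ((M : ℝ) ^ k) ^ σ := by
  have h1 : (1 : ℝ) < M := by exact_mod_cast hA₁.trans hA₂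
  have hlog := Real.log_pos h1
  have hs : 0 < Real.sqrt (u 2) := Real.sqrt_pos.mpr h2
  have hA0 : (0 : ℝ) < #A := by exact_mod_cast (by omega : 0 < #A)
  obtain ⟨K, hK, hu⟩ := exists_growth_bound h2 hsub
  refine ⟨Real.log (Real.sqrt (u 2)) / Real.log M, ?_, K, hK, fun k => ?_⟩
  · rw [dim, ← mul_div_assoc]
    gcongr
    rw [← Real.log_pow]
    refine Real.log_lt_log hs ?_
    rw [Real.sqrt_lt' (by positivity), ← pow_mul]
    rwa [mul_comm r 2]
  · rw [← Real.rpow_pow_comm (by positivity), Real.rpow_def_of_pos (by linarith : (0 : ℝ) < M),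
      mul_div_cancel₀ _ hlog.ne', Real.exp_log hs]
    exact hu k

theorem crossSum_cantor_pos (hA₁ : 1 < #A) (k : ℕ) :
    0 < crossSum ((M : ℝ) ^ k) (cantor M (digits A) k) (cantor M (digits A) k) 0 := by
  have hne : (cantor M (digits A) k).Nonempty := by
    rw [← card_pos, card_cantor (digits_bounds A), card_digits]
    positivity
  obtain ⟨x, hx⟩ := hne
  unfold crossSum
  refine sum_pos' (fun _ _ => by positivity) ⟨x, hx, sum_pos' (fun _ _ => by positivity)
    ⟨x, hx, ?_⟩⟩
  have : (0 : ℝ) < #(cantor M (digits A) k) := by exact_mod_cast card_pos.mpr ⟨x, hx⟩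
  simp only [sub_self, add_zero, zero_div, mul_zero, ex_zero, sum_const, nsmul_eq_mul, mul_one,
    Complex.norm_natCast]
  positivity

theorem exists_crossSum_exponent (hA₁ : 1 < #A) (hA₂ : #A < M) :
    ∃ β, 1 / 2 - dim M A < β ∧ ∃ K, 0 < K ∧ ∀ k : ℕ,
      crossSum ((M : ℝ) ^ k) (cantor M (digits A) k) (cantor M (digits A) k) 0 ≤
        K * ((M : ℝ) ^ k) ^ (2 - 4 * β) := by
  have hD := digits_bounds A
  have hlt := crossSum_cantor_two_lt hD (by rwa [card_digits])
  rw [card_digits] at hlt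
  obtain ⟨σ, hσ, K, hK, h⟩ := exists_exponent_lt hA₁ hA₂ (r := 4)
    (u := fun k => crossSum ((M : ℝ) ^ k) (cantor M (digits A) k) (cantor M (digits A) k) 0)
    (crossSum_cantor_pos hA₁ 2) (fun k => crossSum_cantor_add hD (by omega) 2 k) hlt
  refine ⟨(2 - σ) / 4, by push_cast at hσ; linarith, K, hK, fun k => ?_⟩
  rw [show 2 - 4 * ((2 - σ) / 4) = σ by ring]
  exact h k

theorem addEnergy_cantorSet_pos (hA₁ : 1 < #A) (k : ℕ) :
    0 < (cantorSet M A k).addEnergy (cantorSet M A k) := by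
  have hne : A.Nonempty := card_pos.mp (by omega)
  refine addEnergy_self_pos ?_
  exact (Fintype.piFinset_nonempty.mpr fun _ => hne).image _

/-- The energy is at least `1`, so the exponent at `ε = 1` cannot be negative. Boundedness matters
because the supremum of an unbounded set of reals is `0` by default. -/
theorem bddAbove_gamma (hA₁ : 1 < #A) (hA₂ : #A < M) :
    BddAbove {γ : ℝ | ∀ ε : ℝ, 0 < ε → ∃ C : ℝ, 0 < C ∧ ∀ k : ℕ,
      ((cantorSet M A k).addEnergy (cantorSet M A k) : ℝ) ≤
        C * ((M : ℝ) ^ k) ^ (3 * dim M A - γ + ε)} := by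
  have h1 : (1 : ℝ) < M := by exact_mod_cast hA₁.trans hA₂
  refine ⟨3 * dim M A + 1, fun γ hγ => ?_⟩
  by_contra hcon
  push Not at hcon
  obtain ⟨C, hC, h⟩ := hγ 1 one_pos
  set y : ℝ := (M : ℝ) ^ (3 * dim M A - γ + 1) with hy
  have hy0 : 0 < y := by positivity
  have hy1 : y < 1 := Real.rpow_lt_one_of_one_lt_of_neg h1 (by linarith)
  obtain ⟨k, hk⟩ := exists_pow_lt_of_lt_one (inv_pos.mpr hC) hy1
  have h2 := h k
  rw [← Real.rpow_pow_comm (by positivity), ← hy] at h2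
  have h3 : (1 : ℝ) ≤ ((cantorSet M A k).addEnergy (cantorSet M A k) : ℝ) := by
    exact_mod_cast addEnergy_cantorSet_pos hA₁ k
  have h4 : C * y ^ k < C * C⁻¹ := by gcongr
  rw [mul_inv_cancel₀ hC.ne'] at h4
  linarith

theorem gammaA_pos (hA₁ : 1 < #A) (hA₂ : #A < M) : 0 < gammaA M A := by
  have h1 : (1 : ℝ) < M := by exact_mod_cast hA₁.trans hA₂
  have hD := digits_bounds A
  have hlt := energy_cantor_two_lt hD (by rwa [card_digits]) (by rwa [card_digits])
  rw [card_digits] at hlt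
  obtain ⟨σ, hσ, K, hK, h⟩ := exists_exponent_lt hA₁ hA₂ (r := 3)
    (u := fun k => (energy (M ^ k) (cantor M (digits A) k) : ℝ))
    (by rw [← addEnergy_cantorSet]; exact_mod_cast addEnergy_cantorSet_pos hA₁ 2)
    (fun k => by exact_mod_cast energy_cantor_add hD (by omega) 2 k) (by exact_mod_cast hlt)
  push_cast at hσ
  refine lt_of_lt_of_le (sub_pos.mpr hσ) (le_csSup (bddAbove_gamma hA₁ hA₂) fun ε hε => ?_)
  refine ⟨K, hK, fun k => ?_⟩
  rw [addEnergy_cantorSet]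
  refine (h k).trans ?_
  gcongr
  · exact one_le_pow₀ h1.le
  · linarith

/-- The fourth Schatten moment of the Cantor set is bounded through `β_E`. -/
theorem exists_crossSum_le_betaE (hA₁ : 1 < #A) (hA₂ : #A < M) {ε : ℝ} (hε : 0 < ε) :
    ∃ K, 0 < K ∧ ∀ k : ℕ,
      crossSum ((M : ℝ) ^ k) (cantor M (digits A) k) (cantor M (digits A) k) 0 ≤
        K * ((M : ℝ) ^ k) ^ (2 - 4 * betaE M A + ε) := by
  have h1 : (1 : ℝ) < M := by exact_mod_cast hA₁.trans hA₂
  have hγ := gammaA_pos hA₁ hA₂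
  -- Cauchy-Schwarz yields the exponent `1/2 + 3 δ - γ`, while `2 - 4 β_E = 1/2 + 3 δ - γ_A / 2`.
  -- Hence any admissible `γ` above `γ_A / 2` suffices, and the supremum need not be approached.
  have hlt : gammaA M A / 2 < gammaA M A := by linarith
  obtain ⟨γ, hγS, hγlt⟩ := exists_lt_of_lt_csSup
    (by
      by_contra hcon
      rw [Set.not_nonempty_iff_eq_empty] at hcon
      rw [gammaA, hcon, Real.sSup_empty] at hγ
      exact lt_irrefl _ hγ) hlt
  obtain ⟨K, hK, h⟩ := hγS ε hε
  refine ⟨K, hK, fun k => ?_⟩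
  have hN : 0 < M ^ k := Nat.pow_pos (by omega)
  have h2 := crossSum_sq_le_energy hN (cantor M (digits A) k)
  have h3 : crossSum ((M ^ k : ℕ) : ℝ) (cantor M (digits A) k) (cantor M (digits A) k) 0 ≤
      Real.sqrt ((M ^ k : ℕ) : ℝ) * energy (M ^ k) (cantor M (digits A) k) := by
    refine le_of_sq_le_sq ?_ (by positivity)
    rw [mul_pow, Real.sq_sqrt (by positivity)]
    exact h2
  have h4 := h k
  rw [addEnergy_cantorSet] at h4
  push_cast at h3
  have hNr : (1 : ℝ) ≤ (M : ℝ) ^ k := one_le_pow₀ h1.le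
  calc _ ≤ _ := h3
    _ ≤ Real.sqrt ((M : ℝ) ^ k) * (K * ((M : ℝ) ^ k) ^ (3 * dim M A - γ + ε)) := by gcongr
    _ = K * ((M : ℝ) ^ k) ^ (1 / 2 + (3 * dim M A - γ + ε)) := by
        rw [Real.rpow_add (by positivity) (1 / 2), Real.sqrt_eq_rpow]; ring
    _ ≤ _ := by
        refine mul_le_mul_of_nonneg_left (Real.rpow_le_rpow_of_exponent_le hNr ?_) hK.le
        rw [betaE]
        linarith

end Exponents

end OpenBaker

namespace OpenBaker

open Finset

/-! ### Rapid decay of smoothly cut-off exponential sums. -/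

section Cutoff

/-- The backward difference operator with step `h`. -/
def bdiff (h : ℝ) (g : ℝ → ℝ) : ℝ → ℝ := fun x => g (x - h) - g x

theorem contDiff_bdiff {h : ℝ} {g : ℝ → ℝ} (hg : ContDiff ℝ (⊤ : ℕ∞) g) :
    ContDiff ℝ (⊤ : ℕ∞) (bdiff h g) :=
  (hg.comp (contDiff_id.sub contDiff_const)).sub hg

theorem contDiff_bdiff_iterate {h : ℝ} {g : ℝ → ℝ} (hg : ContDiff ℝ (⊤ : ℕ∞) g) (L : ℕ) :
    ContDiff ℝ (⊤ : ℕ∞) ((bdiff h)^[L] g) := by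
  induction L with
  | zero => exact hg
  | succ L ih => rw [Function.iterate_succ_apply']; exact contDiff_bdiff ih

theorem deriv_bdiff {h : ℝ} {g : ℝ → ℝ} (hg : ContDiff ℝ (⊤ : ℕ∞) g) :
    deriv (bdiff h g) = bdiff h (deriv g) := by
  have hd : Differentiable ℝ g := hg.differentiable (by simp)
  funext x
  have h1 : HasDerivAt (fun x => g (x - h)) (deriv g (x - h)) x := by
    simpa using (hd (x - h)).hasDerivAt.comp_sub_const x h
  exact (h1.sub (hd x).hasDerivAt).deriv

theorem deriv_bdiff_iterate {h : ℝ} {g : ℝ → ℝ} (hg : ContDiff ℝ (⊤ : ℕ∞) g) (L : ℕ) :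
    deriv ((bdiff h)^[L] g) = (bdiff h)^[L] (deriv g) := by
  induction L with
  | zero => rfl
  | succ L ih =>
    rw [Function.iterate_succ_apply', Function.iterate_succ_apply',
      deriv_bdiff (contDiff_bdiff_iterate hg L), ih]

/-- Differences commute with the derivative, so the mean value inequality trades one derivative for
each factor `h`. -/
theorem exists_bdiff_iterate_bound (L : ℕ) : ∀ g : ℝ → ℝ, ContDiff ℝ (⊤ : ℕ∞) g →
    HasCompactSupport g → ∃ C, 0 ≤ C ∧ ∀ h : ℝ, 0 ≤ h → ∀ x, |(bdiff h)^[L] g x| ≤ C * h ^ L := by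
  induction L with
  | zero =>
    intro g hg hc
    obtain ⟨C, hC⟩ := hc.exists_bound_of_continuous hg.continuous
    refine ⟨C, (norm_nonneg _).trans (hC 0), fun h _ x => ?_⟩
    simpa using hC x
  | succ L ih =>
    intro g hg hc
    obtain ⟨C, hC0, hC⟩ := ih (deriv g) (contDiff_infty_iff_deriv.mp hg).2 hc.deriv
    refine ⟨C, hC0, fun h hh x => ?_⟩
    rw [Function.iterate_succ_apply']
    have hd : Differentiable ℝ ((bdiff h)^[L] g) :=
      (contDiff_bdiff_iterate hg L).differentiable (by simp)
    have := Convex.norm_image_sub_le_of_norm_deriv_le (f := (bdiff h)^[L] g) (s := Set.univ)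
      (C := C * h ^ L) (x := x) (y := x - h) (fun y _ => hd y)
      (fun y _ => by rw [deriv_bdiff_iterate hg]; exact hC h hh y) convex_univ
      (Set.mem_univ _) (Set.mem_univ _)
    calc _ ≤ C * h ^ L * ‖x - h - x‖ := this
      _ = _ := by simp [abs_of_nonneg hh, pow_succ]; ring

theorem bdiff_iterate_eq_zero {h : ℝ} (hh : 0 ≤ h) {g : ℝ → ℝ} (h0 : ∀ x, x ≤ 0 → g x = 0)
    (h1 : ∀ x, 1 ≤ x → g x = 0) (L : ℕ) :
    (∀ x, x ≤ 0 → (bdiff h)^[L] g x = 0) ∧ ∀ x, 1 + L * h ≤ x → (bdiff h)^[L] g x = 0 := by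
  induction L with
  | zero => exact ⟨h0, fun x hx => h1 x (by simpa using hx)⟩
  | succ L ih =>
    rw [Function.iterate_succ_apply']
    refine ⟨fun x hx => ?_, fun x hx => ?_⟩
    · simp only [bdiff]
      rw [ih.1 x hx, ih.1 _ (by linarith), sub_zero]
    · simp only [bdiff]
      push_cast at hx
      rw [ih.2 x (by linarith), ih.2 _ (by linarith), sub_zero]

theorem sum_bdiff (ω : ℂ) (h : ℝ) (g : ℝ → ℝ) (K : ℕ) (h0 : g (-h) = 0) (h1 : g (K * h) = 0) :
    (ω - 1) * ∑ m ∈ range (K + 1), (g (m * h) : ℂ) * ω ^ m =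
      ∑ m ∈ range (K + 1), (bdiff h g (m * h) : ℂ) * ω ^ m := by
  have h2 : ∑ m ∈ range (K + 1), (g (m * h - h) : ℂ) * ω ^ m =
      ω * ∑ m ∈ range (K + 1), (g (m * h) : ℂ) * ω ^ m := by
    rw [sum_range_succ', sum_range_succ, h1, mul_add, mul_sum]
    simp only [Nat.cast_zero, zero_mul, zero_sub, h0, Complex.ofReal_zero, zero_mul, mul_zero]
    congr 1
    refine sum_congr rfl fun m _ => ?_
    rw [show ((m + 1 : ℕ) : ℝ) * h - h = m * h by push_cast; ring]
    ring
  simp only [bdiff, Complex.ofReal_sub, sub_mul, sum_sub_distrib, h2]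
  ring

theorem sum_bdiff_iterate (ω : ℂ) {h : ℝ} (hh : 0 ≤ h) {g : ℝ → ℝ} (h0 : ∀ x, x ≤ 0 → g x = 0)
    (h1 : ∀ x, 1 ≤ x → g x = 0) (K L : ℕ) (hK : 1 + L * h ≤ K * h) :
    (ω - 1) ^ L * ∑ m ∈ range (K + 1), (g (m * h) : ℂ) * ω ^ m =
      ∑ m ∈ range (K + 1), ((bdiff h)^[L] g (m * h) : ℂ) * ω ^ m := by
  induction L with
  | zero => simp
  | succ L ih =>
    push_cast at hK
    obtain ⟨h2, h3⟩ := bdiff_iterate_eq_zero hh h0 h1 L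
    rw [pow_succ', mul_assoc, ih (by linarith), sum_bdiff ω h _ K (h2 _ (by linarith))
      (h3 _ (by linarith))]
    simp only [Function.iterate_succ_apply']

/-- Rapid decay of the exponential sums of a smooth cutoff. -/
theorem exists_cutoff_sum_bound {χ : ℝ → ℝ} (hχ : ContDiff ℝ (⊤ : ℕ∞) χ)
    (hc : HasCompactSupport χ) (hsupp : tsupport χ ⊆ Set.Ioo 0 1) (L : ℕ) :
    ∃ C, 0 < C ∧ ∀ n : ℕ, 0 < n → ∀ θ : ℝ,
      (n * ‖ex θ - 1‖) ^ L * ‖∑ m ∈ range n, (χ (m / n) : ℂ) * ex (m * θ)‖ ≤ C * n := by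
  obtain ⟨C, hC0, hC⟩ := exists_bdiff_iterate_bound L χ hχ hc
  have hz : ∀ x, x ∉ Set.Ioo (0 : ℝ) 1 → χ x = 0 := fun x hx =>
    image_eq_zero_of_notMem_tsupport fun h => hx (hsupp h)
  have h0 : ∀ x, x ≤ 0 → χ x = 0 := fun x hx => hz x fun h => absurd h.1 (not_lt.mpr hx)
  have h1 : ∀ x, 1 ≤ x → χ x = 0 := fun x hx => hz x fun h => absurd h.2 (not_lt.mpr hx)
  refine ⟨(C + 1) * (L + 2), by positivity, fun n hn θ => ?_⟩
  have hn' : (0 : ℝ) < n := by exact_mod_cast hn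
  have hn1 : (1 : ℝ) ≤ n := by exact_mod_cast hn
  set h : ℝ := 1 / n with hh
  have hh0 : 0 ≤ h := by positivity
  -- Summation by parts `L` times moves the factor `(ex θ - 1) ^ L` onto the differences of `χ`.
  -- Each backward difference extends the support to the right by `1 / n`, hence the range up to `n
  -- + L`.
  have hs := sum_bdiff_iterate (ex θ) hh0 h0 h1 (n + L) L (by
    rw [hh]; push_cast; field_simp; exact le_rfl)
  have hsum : ∑ m ∈ range n, (χ (m / n) : ℂ) * ex (m * θ) =
      ∑ m ∈ range (n + L + 1), (χ (m * h) : ℂ) * ex θ ^ m := by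
    rw [add_assoc, sum_range_add]
    rw [sum_eq_zero (s := range (L + 1)), add_zero]
    · refine sum_congr rfl fun m _ => ?_
      rw [ex_nat_mul, hh]
      ring_nf
    · intro m _
      rw [h1, Complex.ofReal_zero, zero_mul]
      rw [hh]
      push_cast
      rw [mul_one_div, le_div_iff₀ hn']
      linarith [(Nat.cast_nonneg m : (0 : ℝ) ≤ m)]
  rw [hsum]
  calc _ = (n : ℝ) ^ L * ‖(ex θ - 1) ^ L *
        ∑ m ∈ range (n + L + 1), (χ (m * h) : ℂ) * ex θ ^ m‖ := by
        rw [norm_mul, norm_pow]; ring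
    _ ≤ (n : ℝ) ^ L * ∑ m ∈ range (n + L + 1), C * h ^ L := by
        rw [hs]
        gcongr
        refine (norm_sum_le _ _).trans (sum_le_sum fun m _ => ?_)
        rw [norm_mul, norm_pow, norm_ex, one_pow, mul_one, Complex.norm_real]
        exact hC h hh0 _
    _ = C * (n + L + 1) := by
        rw [sum_const, card_range, nsmul_eq_mul, hh, one_div, inv_pow]
        push_cast
        field_simp
    _ ≤ (C + 1) * (L + 2) * n := by
        have hL : (0 : ℝ) ≤ L := by positivity
        have : (n : ℝ) + L + 1 ≤ (L + 2) * n := by nlinarith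
        calc _ ≤ (C + 1) * ((L + 2) * n) := by gcongr; linarith
          _ = _ := by ring

/-- With `x` the signed distance to the nearest integer, the norm is `2 |sin (π x)|`, and `sin u ≥ 2
u / π` on `[0, π / 2]`. -/
theorem le_norm_ex_sub_one {θ r : ℝ} (h : ∀ w : ℤ, r ≤ |θ - w|) :
    4 * r ≤ ‖ex θ - 1‖ := by
  set x := θ - round θ with hx
  have h1 : ex θ = ex x := by
    rw [show θ = x + (round θ : ℤ) by rw [hx]; ring, ex_add_int]
  have h2 := abs_sub_round θ
  have h3 := h (round θ)
  rw [← hx] at h2 h3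
  have h4 : ‖ex x - 1‖ = 2 * |Real.sin (Real.pi * x)| := by
    rw [ex_eq, mul_comm ((2 * Real.pi * x : ℝ) : ℂ) Complex.I, Complex.norm_exp_I_mul_ofReal_sub_one]
    rw [norm_mul, Real.norm_eq_abs, Real.norm_eq_abs, abs_two]
    ring_nf
  rw [h1, h4]
  have h5 : |Real.sin (Real.pi * x)| = Real.sin (Real.pi * |x|) := by
    have hp := Real.pi_pos
    have hnn : 0 ≤ Real.sin (Real.pi * |x|) :=
      Real.sin_nonneg_of_nonneg_of_le_pi (by positivity) (by nlinarith)
    rcases abs_cases x with ⟨hx', _⟩ | ⟨hx', _⟩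
    · rw [hx'] at hnn ⊢
      exact abs_of_nonneg hnn
    · rw [hx'] at hnn ⊢
      rw [← abs_neg, ← Real.sin_neg, ← mul_neg]
      exact abs_of_nonneg hnn
  rw [h5]
  have h6 := Real.mul_le_sin (x := Real.pi * |x|) (by positivity)
    (by nlinarith [Real.pi_pos])
  have h7 : 2 / Real.pi * (Real.pi * |x|) = 2 * |x| := by field_simp
  rw [h7] at h6
  linarith

end Cutoff

end OpenBaker

namespace OpenBaker

open Finset Matrix
open scoped Matrix.Norms.L2Operator

/-! ### Matrix structure of the baker's map. -/

section Baker

theorem fourierEntry_eq (N j l : ℕ) :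
    fourierEntry N j l = ex (-((j : ℝ) * l / N)) / (Real.sqrt N : ℂ) := by
  unfold fourierEntry ex
  congr 2
  push_cast
  ring

theorem fourierEntry_comm (N j l : ℕ) : fourierEntry N j l = fourierEntry N l j := by
  rw [fourierEntry_eq, fourierEntry_eq, mul_comm (j : ℝ)]

theorem conj_fourierEntry (N j l : ℕ) :
    (starRingEnd ℂ) (fourierEntry N j l) = ex ((j : ℝ) * l / N) / (Real.sqrt N : ℂ) := by
  rw [fourierEntry_eq, map_div₀, conj_ex, neg_neg, Complex.conj_ofReal]

theorem sum_conj_fourierEntry_mul {N : ℕ} (hN : 0 < N) {j l : ℕ} (hj : j < N) (hl : l < N) :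
    ∑ p ∈ range N, (starRingEnd ℂ) (fourierEntry N p j) * fourierEntry N p l =
      if j = l then 1 else 0 := by
  have hN' : (N : ℂ) ≠ 0 := by exact_mod_cast hN.ne'
  have hsq : (Real.sqrt N : ℂ) * (Real.sqrt N : ℂ) = N := by
    rw [← Complex.ofReal_mul, Real.mul_self_sqrt (by positivity)]; simp
  have h1 : ∀ p : ℕ, (starRingEnd ℂ) (fourierEntry N p j) * fourierEntry N p l =
      ex (p * ((((j : ℤ) - l : ℤ) : ℝ) / N)) / N := by
    intro p
    rw [conj_fourierEntry, fourierEntry_eq, div_mul_div_comm, hsq, ← ex_add]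
    congr 2
    push_cast
    ring
  simp only [h1]
  rw [← sum_div, sum_range_ex hN]
  have h2 : ((N : ℤ) ∣ (j : ℤ) - l) ↔ j = l := by
    constructor
    · intro h
      have := Int.eq_zero_of_abs_lt_dvd h (by rw [abs_lt]; constructor <;> omega)
      omega
    · rintro rfl; simp
  simp only [h2]
  split_ifs
  · rw [div_self hN']
  · simp

theorem fourierMatrix_conjTranspose_mul {N : ℕ} (hN : 0 < N) :
    (fourierMatrix N)ᴴ * fourierMatrix N = 1 := by
  ext j l
  rw [Matrix.mul_apply, Matrix.one_apply]
  have := sum_conj_fourierEntry_mul hN j.2 l.2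
  rw [sum_range] at this
  simp only [fourierMatrix, conjTranspose_apply, Matrix.of_apply]
  simpa [Fin.ext_iff] using this

variable {M n N : ℕ} {A : Finset (Fin M)} {χ : ℝ → ℝ}

theorem blockMatrix_transpose (M : ℕ) (χ : ℝ → ℝ) (N : ℕ) :
    (blockMatrix M χ N)ᵀ = blockMatrix M χ N := by
  ext j l
  simp only [blockMatrix, transpose_apply, Matrix.of_apply, cutoffFourierEntry]
  by_cases h : (j : ℕ) / (N / M) = (l : ℕ) / (N / M)
  · rw [if_pos h, if_pos h.symm, fourierEntry_comm]; ring
  · rw [if_neg h, if_neg (Ne.symm h)]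

theorem mul_div_eq (hM : 0 < M) (hN : N = M * n) (l : ℕ) : M * l / N = l / n := by
  rw [hN, Nat.mul_div_mul_left _ _ hM]

theorem div_eq (hM : 0 < M) (hN : N = M * n) : N / M = n := by
  rw [hN, Nat.mul_div_cancel_left _ hM]

theorem blockMatrix_comm_alphabetProjection (hM : 0 < M) (hN : N = M * n) :
    blockMatrix M χ N * alphabetProjection M A N = alphabetProjection M A N * blockMatrix M χ N := by
  ext j l
  rw [alphabetProjection, mul_diagonal, diagonal_mul]
  simp only [mul_div_eq hM hN, blockMatrix, div_eq hM hN, Matrix.of_apply]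
  by_cases h : (j : ℕ) / n = (l : ℕ) / n
  · rw [h, mul_comm]
  · rw [if_neg h, zero_mul, mul_zero]

/-- Conjugation by the Fourier transform transposes the baker's map. -/
theorem fourier_conj_bakerMap (hM : 0 < M) (hn : 0 < n) (hN : N = M * n) :
    fourierMatrix N * bakerMap M A χ N * (fourierMatrix N)ᴴ = (bakerMap M A χ N)ᵀ := by
  have hN0 : 0 < N := by rw [hN]; positivity
  have hU := mul_eq_one_comm.mp (fourierMatrix_conjTranspose_mul hN0)
  -- The Fourier and block matrices are symmetric, so transposition reverses the product to
  -- projection, blocks, inverse Fourier transform. This is the conjugated map because the alphabet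
  -- projection, constant on blocks, commutes with the block matrix.
  have h1 : ((fourierMatrix N)ᴴ)ᵀ = (fourierMatrix N)ᴴ := by
    ext j l
    exact congrArg star (fourierEntry_comm _ _ _)
  unfold bakerMap
  rw [transpose_mul, transpose_mul, blockMatrix_transpose, h1, alphabetProjection,
    diagonal_transpose, ← alphabetProjection]
  calc _ = fourierMatrix N * (fourierMatrix N)ᴴ * (blockMatrix M χ N * alphabetProjection M A N) *
        (fourierMatrix N)ᴴ := by simp only [Matrix.mul_assoc]
    _ = _ := by
        rw [hU, Matrix.one_mul, blockMatrix_comm_alphabetProjection hM hN, Matrix.mul_assoc]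

/-- The block-diagonal Fourier matrix without cutoffs. -/
noncomputable def blockFourier (n N : ℕ) : Matrix (Fin N) (Fin N) ℂ :=
  Matrix.of fun j l => if (j : ℕ) / n = (l : ℕ) / n then
    fourierEntry n ((j : ℕ) % n) ((l : ℕ) % n) else 0

theorem sum_fin_mul_eq (hN : N = M * n) {R : Type*} [AddCommMonoid R] (f : ℕ → R) :
    ∑ p : Fin N, f p = ∑ a ∈ range M, ∑ m ∈ range n, f (m + n * a) := by
  rw [← sum_range, hN, sum_range_mul_eq]

theorem blockFourier_conjTranspose_mul (hn : 0 < n) (hN : N = M * n) :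
    (blockFourier n N)ᴴ * blockFourier n N = 1 := by
  ext j l
  rw [Matrix.mul_apply, Matrix.one_apply]
  have h := sum_fin_mul_eq hN (fun p => (starRingEnd ℂ) (if p / n = (j : ℕ) / n then
    fourierEntry n (p % n) ((j : ℕ) % n) else 0) * (if p / n = (l : ℕ) / n then
    fourierEntry n (p % n) ((l : ℕ) % n) else 0))
  have hja : (j : ℕ) / n ∈ range M := by
    rw [mem_range, Nat.div_lt_iff_lt_mul hn, ← hN]; exact j.2
  calc _ = _ := h
    _ = ∑ a ∈ range M, if a = (j : ℕ) / n then (if (j : ℕ) / n = (l : ℕ) / n then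
        (if (j : ℕ) % n = (l : ℕ) % n then (1 : ℂ) else 0) else 0) else 0 := by
        refine sum_congr rfl fun a _ => ?_
        rw [← sum_conj_fourierEntry_mul hn (Nat.mod_lt _ hn) (Nat.mod_lt _ hn)]
        have hd : ∀ m ∈ range n, (m + n * a) / n = a ∧ (m + n * a) % n = m := by
          intro m hm
          rw [mem_range] at hm
          rw [Nat.add_mul_div_left _ _ hn, Nat.div_eq_of_lt hm, Nat.add_mul_mod_self_left,
            Nat.mod_eq_of_lt hm]
          simp
        by_cases h1 : a = (j : ℕ) / n
        · rw [if_pos h1]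
          by_cases h2 : (j : ℕ) / n = (l : ℕ) / n
          · rw [if_pos h2]
            refine sum_congr rfl fun m hm => ?_
            rw [(hd m hm).1, (hd m hm).2, if_pos h1, if_pos (h1.trans h2)]
          · rw [if_neg h2]
            refine sum_eq_zero fun m hm => ?_
            rw [(hd m hm).1, if_neg (fun h3 => h2 (h1.symm.trans h3)), mul_zero]
        · rw [if_neg h1]
          refine sum_eq_zero fun m hm => ?_
          rw [(hd m hm).1, if_neg h1, map_zero, zero_mul]
    _ = _ := by
        rw [sum_ite_eq' (range M), if_pos hja]
        by_cases h1 : j = l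
        · simp [h1]
        · rw [if_neg h1]
          split_ifs with h2 h3
          · exfalso
            apply h1
            rw [Fin.ext_iff, ← Nat.div_add_mod (j : ℕ) n, h2, h3, Nat.div_add_mod]
          · rfl
          · rfl

theorem norm_diagonal_le_one {ι : Type*} [Fintype ι] [DecidableEq ι] {v : ι → ℂ}
    (h : ∀ i, ‖v i‖ ≤ 1) : ‖(diagonal v : Matrix ι ι ℂ)‖ ≤ 1 := by
  rw [l2_opNorm_diagonal, pi_norm_le_iff_of_nonneg zero_le_one]
  exact h

theorem norm_fourierMatrix_le_one (hN : 0 < N) : ‖fourierMatrix N‖ ≤ 1 :=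
  norm_le_one_of_conjTranspose_mul_self (fourierMatrix_conjTranspose_mul hN)

theorem norm_mul_le_one {ι : Type*} [Fintype ι] [DecidableEq ι] {X Y : Matrix ι ι ℂ}
    (hX : ‖X‖ ≤ 1) (hY : ‖Y‖ ≤ 1) : ‖X * Y‖ ≤ 1 :=
  (l2_opNorm_mul X Y).trans (mul_le_one₀ hX (norm_nonneg _) hY)

theorem norm_pow_le_one {ι : Type*} [Fintype ι] [DecidableEq ι] {T : Matrix ι ι ℂ}
    (hT : ‖T‖ ≤ 1) (k : ℕ) : ‖T ^ k‖ ≤ 1 := by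
  induction k with
  | zero =>
    rw [pow_zero, ← diagonal_one]
    exact norm_diagonal_le_one fun _ => by simp
  | succ k ih => rw [pow_succ]; exact norm_mul_le_one ih hT

theorem norm_bakerMap_le_one (hM : 0 < M) (hn : 0 < n) (hN : N = M * n)
    (hχ : ∀ x, χ x ∈ Set.Icc (0 : ℝ) 1) : ‖bakerMap M A χ N‖ ≤ 1 := by
  have hN0 : 0 < N := by rw [hN]; positivity
  have hb : blockMatrix M χ N =
      diagonal (fun j : Fin N => (χ ((((j : ℕ) % n : ℕ) : ℝ) / n) : ℂ)) * blockFourier n N *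
        diagonal (fun j : Fin N => (χ ((((j : ℕ) % n : ℕ) : ℝ) / n) : ℂ)) := by
    ext j l
    rw [mul_diagonal, diagonal_mul]
    simp only [blockMatrix, blockFourier, div_eq hM hN, Matrix.of_apply, cutoffFourierEntry]
    split_ifs <;> simp
  have hd : ‖diagonal (fun j : Fin N => (χ ((((j : ℕ) % n : ℕ) : ℝ) / n) : ℂ))‖ ≤ 1 := by
    refine norm_diagonal_le_one fun j => ?_
    rw [Complex.norm_real, Real.norm_of_nonneg (hχ _).1]
    exact (hχ _).2
  unfold bakerMap
  refine norm_mul_le_one (norm_mul_le_one ?_ ?_) ?_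
  · rw [l2_opNorm_conjTranspose]; exact norm_fourierMatrix_le_one hN0
  · rw [hb]
    exact norm_mul_le_one (norm_mul_le_one hd (norm_le_one_of_conjTranspose_mul_self
      (blockFourier_conjTranspose_mul hn hN))) hd
  · refine norm_diagonal_le_one fun j => ?_
    split_ifs <;> simp

theorem bakerMap_apply_eq_zero (hM : 0 < M) (hN : N = M * n) (j l : Fin N)
    (h : ¬ ∃ a ∈ A, (a : ℕ) = (l : ℕ) / n) : bakerMap M A χ N j l = 0 := by
  rw [bakerMap, alphabetProjection, mul_diagonal, mul_div_eq hM hN, if_neg h, mul_zero]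

/-- Only the block containing `l` contributes to the entry. Up to a unimodular factor it is the
right side, with a cutoff in place of its norm bars, divided by `√N √n ≥ 1`; that gain is not
needed. -/
theorem norm_bakerMap_apply_le (hM : 0 < M) (hn : 0 < n) (hN : N = M * n)
    (hχ : ∀ x, χ x ∈ Set.Icc (0 : ℝ) 1) (j l : Fin N) :
    ‖bakerMap M A χ N j l‖ ≤ χ ((((l : ℕ) % n : ℕ) : ℝ) / n) *
      ‖∑ m ∈ range n, (χ (m / n) : ℂ) *
        ex (m * (((j : ℝ) - M * (((l : ℕ) % n : ℕ) : ℝ)) / N))‖ := by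
  have hN0 : 0 < N := by rw [hN]; positivity
  have hn' : (n : ℝ) ≠ 0 := by positivity
  have hM' : (M : ℝ) ≠ 0 := by positivity
  have hNr : (N : ℝ) = M * n := by rw [hN]; push_cast; ring
  set l' := (l : ℕ) % n with hl'
  set a := (l : ℕ) / n with ha
  have haM : a ∈ range M := by
    rw [mem_range, ha, Nat.div_lt_iff_lt_mul hn, ← hN]; exact l.2
  have h1 : ((fourierMatrix N)ᴴ * blockMatrix M χ N) j l =
      (ex ((a : ℝ) * j / M) / ((Real.sqrt N : ℂ) * (Real.sqrt n : ℂ))) * (χ ((l' : ℝ) / n) *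
        ∑ m ∈ range n, (χ (m / n) : ℂ) * ex (m * (((j : ℝ) - M * (l' : ℝ)) / N))) := by
    rw [Matrix.mul_apply]
    simp only [conjTranspose_apply, fourierMatrix, blockMatrix, Matrix.of_apply, div_eq hM hN]
    have h := sum_fin_mul_eq hN (fun p => star (fourierEntry N p j) *
      (if p / n = a then cutoffFourierEntry χ n (p % n) l' else 0))
    refine h.trans ?_
    have hd : ∀ b, ∀ m ∈ range n, (m + n * b) / n = b ∧ (m + n * b) % n = m := by
      intro b m hm
      rw [mem_range] at hm
      rw [Nat.add_mul_div_left _ _ hn, Nat.div_eq_of_lt hm, Nat.add_mul_mod_self_left,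
        Nat.mod_eq_of_lt hm]
      simp
    rw [sum_eq_single_of_mem a haM]
    · rw [mul_sum, mul_sum]
      refine sum_congr rfl fun m hm => ?_
      rw [(hd a m hm).1, (hd a m hm).2, if_pos rfl]
      have hs : star (fourierEntry N (m + n * a) j) = _ := conj_fourierEntry N (m + n * a) j
      rw [hs, cutoffFourierEntry, fourierEntry_eq]
      have he : ex (((m + n * a : ℕ) : ℝ) * j / N) * ex (-((m : ℝ) * l' / n)) =
          ex ((a : ℝ) * j / M) * ex (m * (((j : ℝ) - M * (l' : ℝ)) / N)) := by
        rw [← ex_add, ← ex_add]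
        congr 1
        rw [hNr]
        push_cast
        field_simp
        ring
      calc _ = (ex (((m + n * a : ℕ) : ℝ) * j / N) * ex (-((m : ℝ) * l' / n))) *
            ((χ (m / n) : ℂ) * (χ (l' / n) : ℂ)) / ((Real.sqrt N : ℂ) * (Real.sqrt n : ℂ)) := by
            field_simp
        _ = _ := by rw [he]; ring
    · intro b _ hb
      refine sum_eq_zero fun m hm => ?_
      rw [(hd b m hm).1, if_neg hb, mul_zero]
  have h2 : ‖bakerMap M A χ N j l‖ ≤ ‖((fourierMatrix N)ᴴ * blockMatrix M χ N) j l‖ := by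
    rw [bakerMap, alphabetProjection, mul_diagonal, norm_mul]
    refine mul_le_of_le_one_right (norm_nonneg _) ?_
    split_ifs <;> simp
  refine h2.trans ?_
  rw [h1, norm_mul, norm_mul, Complex.norm_real, Real.norm_of_nonneg (hχ _).1]
  refine mul_le_of_le_one_left (mul_nonneg (hχ _).1 (norm_nonneg _)) ?_
  rw [norm_div, norm_ex, norm_mul, Complex.norm_real, Complex.norm_real,
    Real.norm_of_nonneg (Real.sqrt_nonneg _), Real.norm_of_nonneg (Real.sqrt_nonneg _)]
  have h3 : 1 ≤ Real.sqrt N := Real.one_le_sqrt.mpr (by exact_mod_cast hN0)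
  have h4 : 1 ≤ Real.sqrt n := Real.one_le_sqrt.mpr (by exact_mod_cast hn)
  rw [div_le_one (by positivity)]
  nlinarith

end Baker

end OpenBaker

namespace OpenBaker

open Finset Matrix
open scoped Matrix.Norms.L2Operator

/-! ### Propagation of the kernel bound to time `k`. -/

section Localization

variable {M n N : ℕ} {A : Finset (Fin M)} {χ : ℝ → ℝ}

theorem exists_support_margin (hc : HasCompactSupport χ) (hsupp : tsupport χ ⊆ Set.Ioo 0 1) :
    ∃ c, 0 < c ∧ c ≤ 1 ∧ ∀ x, χ x ≠ 0 → c ≤ x ∧ c ≤ 1 - x := by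
  rcases (tsupport χ).eq_empty_or_nonempty with he | hne
  · refine ⟨1, one_pos, le_rfl, fun x hx => ?_⟩
    have := subset_tsupport χ hx
    rw [he] at this
    exact this.elim
  · obtain ⟨x₀, hx₀, hmin⟩ := hc.exists_isMinOn hne
      (f := fun x : ℝ => min x (1 - x)) (by fun_prop)
    obtain ⟨h1, h2⟩ := hsupp hx₀
    refine ⟨min x₀ (1 - x₀), lt_min h1 (by linarith), (min_le_left _ _).trans h2.le,
      fun x hx => ?_⟩
    have := hmin (subset_tsupport χ hx)
    exact ⟨le_trans this (min_le_left _ _), le_trans this (min_le_right _ _)⟩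

/-- Away from the graph of the expanding map the kernel of the baker's map is negligible. -/
theorem exists_offGraph_bound (hM : 0 < M) (hχ : ContDiff ℝ (⊤ : ℕ∞) χ)
    (hc : HasCompactSupport χ) (hsupp : tsupport χ ⊆ Set.Ioo 0 1)
    (hχ01 : ∀ x, χ x ∈ Set.Icc (0 : ℝ) 1) {ε : ℝ} (hε : 0 < ε) (hε1 : ε ≤ 1) (K : ℝ) :
    ∃ C, 0 < C ∧ ∀ n N : ℕ, 0 < n → N = M * n → ∀ (A : Finset (Fin M)) (j l : Fin N),
      (N : ℝ) ^ ε < |(j : ℝ) - M * (((l : ℕ) % n : ℕ) : ℝ)| →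
        ‖bakerMap M A χ N j l‖ ≤ C * (N : ℝ) ^ (-K) := by
  obtain ⟨c, hc0, hc1, hcs⟩ := exists_support_margin hc hsupp
  -- The decay is `N * N ^ (-ε L)`, which this `L` brings below `N ^ (-K)`.
  obtain ⟨L, hL⟩ := exists_nat_ge ((1 + K) / ε)
  obtain ⟨C, hC, hsum⟩ := exists_cutoff_sum_bound hχ hc hsupp L
  have hMr : (0 : ℝ) < M := by exact_mod_cast hM
  refine ⟨C * (M / (4 * c)) ^ L, by positivity, fun n N hn hN A j l hjl => ?_⟩
  have hN0 : 0 < N := by rw [hN]; positivity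
  have hnr : (0 : ℝ) < n := by exact_mod_cast hn
  have hNr : (0 : ℝ) < N := by exact_mod_cast hN0
  have hN1 : (1 : ℝ) ≤ N := by exact_mod_cast hN0
  have hNeq : (N : ℝ) = M * n := by rw [hN]; push_cast; ring
  set l' : ℝ := (((l : ℕ) % n : ℕ) : ℝ) with hl'
  set E : ℝ := (N : ℝ) ^ ε with hE
  have hE0 : 0 < E := by positivity
  have hEN : E ≤ N := by
    calc E ≤ (N : ℝ) ^ (1 : ℝ) := Real.rpow_le_rpow_of_exponent_le hN1 hε1
      _ = N := Real.rpow_one _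
  by_cases hz : χ (l' / n) = 0
  · have := norm_bakerMap_apply_le (A := A) hM hn hN hχ01 j l
    rw [← hl', hz, zero_mul] at this
    exact this.trans (by positivity)
  obtain ⟨hs1, hs2⟩ := hcs _ hz
  have hs1' : c * N ≤ M * l' := by
    rw [le_div_iff₀ hnr] at hs1
    rw [hNeq]; nlinarith
  have hs2' : c * N ≤ N - M * l' := by
    have : c * n ≤ n - l' := by
      have := mul_le_mul_of_nonneg_right hs2 hnr.le
      rwa [sub_mul, one_mul, div_mul_cancel₀ _ hnr.ne'] at this
    rw [hNeq]; nlinarith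
  have hj0 : (0 : ℝ) ≤ j := by positivity
  have hjN : (j : ℝ) ≤ N := by exact_mod_cast j.2.le
  have hcE : c * E ≤ c * N := by gcongr
  have hcE' : c * E ≤ E := by nlinarith
  -- The margin `c` of the support of `χ` keeps `(j - M l') / N` at distance at least `c` from every
  -- nonzero integer, so there is no wrap-around modulo `N`; only `w = 0` uses the off-graph
  -- hypothesis.
  have hdist : ∀ w : ℤ, c * E / N ≤ |((j : ℝ) - M * l') / N - w| := by
    intro w
    rw [show ((j : ℝ) - M * l') / N - w = ((j : ℝ) - M * l' - w * N) / N by field_simp,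
      abs_div, abs_of_pos hNr]
    gcongr
    rcases lt_trichotomy w 0 with hw | hw | hw
    · have : (w : ℝ) ≤ -1 := by exact_mod_cast (by omega : w ≤ -1)
      refine le_trans ?_ (le_abs_self _)
      nlinarith
    · rw [hw]
      simp only [Int.cast_zero, zero_mul, sub_zero]
      linarith
    · have : (1 : ℝ) ≤ w := by exact_mod_cast hw
      refine le_trans ?_ (neg_le_abs _)
      nlinarith
  have hlow := le_norm_ex_sub_one hdist
  have hS := hsum n hn (((j : ℝ) - M * l') / N)
  set S := ‖∑ m ∈ range n, (χ (m / n) : ℂ) * ex (m * (((j : ℝ) - M * l') / N))‖ with hSdef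
  have hB : ‖bakerMap M A χ N j l‖ ≤ S :=
    (norm_bakerMap_apply_le (A := A) hM hn hN hχ01 j l).trans
      (mul_le_of_le_one_left (norm_nonneg _) (hχ01 _).2)
  refine hB.trans ?_
  have h1 : (4 * c / M * E) ^ L * S ≤ C * N := by
    calc _ ≤ (n * ‖ex (((j : ℝ) - M * l') / N) - 1‖) ^ L * S := by
          have : 4 * c / M * E ≤ n * ‖ex (((j : ℝ) - M * l') / N) - 1‖ := by
            calc _ = n * (4 * (c * E / N)) := by rw [hNeq]; field_simp
              _ ≤ _ := by gcongr
          gcongr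
      _ ≤ C * n := hS
      _ ≤ C * N := by
          gcongr
          rw [hN]
          exact Nat.le_mul_of_pos_left _ hM
  have h2 : S ≤ C * (M / (4 * c)) ^ L * (N * (E ^ L)⁻¹) := by
    rw [mul_pow, ← le_div_iff₀' (by positivity)] at h1
    refine h1.trans (le_of_eq ?_)
    rw [div_pow, div_pow]
    field_simp
  refine h2.trans ?_
  gcongr
  rw [hE, ← Real.rpow_natCast, ← Real.rpow_mul hNr.le, ← Real.rpow_neg hNr.le]
  calc (N : ℝ) * (N : ℝ) ^ (-(ε * L)) = (N : ℝ) ^ (1 + -(ε * L)) := by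
        rw [Real.rpow_add hNr, Real.rpow_one]
    _ ≤ _ := by
        refine Real.rpow_le_rpow_of_exponent_le hN1 ?_
        rw [div_le_iff₀ hε] at hL
        linarith

/-- The coordinate projection onto a set of indices. -/
noncomputable def proj (X : Finset (Fin N)) : Matrix (Fin N) (Fin N) ℂ :=
  diagonal fun l => if l ∈ X then 1 else 0

theorem norm_proj_le_one (X : Finset (Fin N)) : ‖proj X‖ ≤ 1 :=
  norm_diagonal_le_one fun l => by split_ifs <;> simp

theorem proj_add_proj_compl (X : Finset (Fin N)) : proj X + proj Xᶜ = 1 := by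
  rw [proj, proj, diagonal_add, ← diagonal_one]
  congr 1
  funext l
  by_cases h : l ∈ X <;> simp [h]

open Classical in
/-- Indices close to the left endpoints of the level-`i` intervals of the Cantor set. -/
noncomputable def nearCantor (A : Finset (Fin M)) (N k : ℕ) (E : ℝ) (i : ℕ) : Finset (Fin N) :=
  univ.filter fun l => ∃ c ∈ cantor M (digits A) i,
    |(l : ℝ) - (M : ℝ) ^ (k - i) * c| ≤ (M : ℝ) ^ (k - i) + 2 * E

theorem mem_nearCantor_succ (hM : 2 ≤ M) {k : ℕ} {E : ℝ} (hE : 0 ≤ E) {i : ℕ} (hi : i ≤ k) {j l : Fin N} (hj : j ∈ nearCantor A N (k + 1) E i)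
    (hl : ∃ a ∈ A, (a : ℕ) = (l : ℕ) / M ^ k)
    (hjl : |(j : ℝ) - M * (((l : ℕ) % M ^ k : ℕ) : ℝ)| ≤ E) :
    l ∈ nearCantor A N (k + 1) E (i + 1) := by
  classical
  obtain ⟨c, hc, hjc⟩ := (mem_filter.mp hj).2
  obtain ⟨a, ha, hal⟩ := hl
  refine mem_filter.mpr ⟨mem_univ _, c + (M : ℤ) ^ i * ((a : ℕ) : ℤ),
    add_mem_cantor hc (mem_cantor_one (mem_image_of_mem _ ha)), ?_⟩
  have hM' : (2 : ℝ) ≤ M := by exact_mod_cast hM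
  have h1 : (M : ℝ) ^ (k + 1 - i) = M * (M : ℝ) ^ (k - i) := by
    rw [show k + 1 - i = (k - i) + 1 by omega, pow_succ]; ring
  have h2 : (M : ℝ) ^ k = (M : ℝ) ^ (k - i) * (M : ℝ) ^ i := by
    rw [← pow_add, Nat.sub_add_cancel hi]
  have h3 : k + 1 - (i + 1) = k - i := by omega
  have h4 : (l : ℝ) = (M : ℝ) ^ k * (a : ℕ) + (((l : ℕ) % M ^ k : ℕ) : ℝ) := by
    rw [hal]
    have := Nat.div_add_mod (l : ℕ) (M ^ k)
    exact_mod_cast this.symm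
  rw [h1] at hjc
  rw [h3]
  set l' : ℝ := (((l : ℕ) % M ^ k : ℕ) : ℝ)
  set P : ℝ := (M : ℝ) ^ (k - i)
  rw [h4, h2]
  push_cast
  have h5 : P * (M : ℝ) ^ i * (a : ℕ) + l' - P * (c + (M : ℝ) ^ i * (a : ℕ)) = l' - P * c := by ring
  rw [h5]
  -- Division by `M` turns the error `2 E + E` into at most `3 E / 2`, so the tolerance `2 E` is
  -- stable along the iteration.
  rw [abs_le] at hjc hjl ⊢
  constructor <;> nlinarith

theorem nearCantor_zero {k : ℕ} (hN : N = M ^ k) {E : ℝ} (hE : 0 ≤ E) :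
    nearCantor A N k E 0 = univ := by
  classical
  refine filter_true_of_mem fun l _ => ⟨0, by simp [cantor], ?_⟩
  have : (l : ℝ) ≤ (M : ℝ) ^ k := by
    have h : (l : ℕ) ≤ M ^ k := l.2.le.trans hN.le
    exact_mod_cast h
  simp only [Int.cast_zero, mul_zero, sub_zero, Nat.sub_zero]
  rw [abs_of_nonneg (by positivity)]
  linarith

/-- The iterates of the baker's map are concentrated near the Cantor set. -/
theorem hs_pow_mul_proj_compl_le (hM : 2 ≤ M) {k : ℕ} (hN : N = M * M ^ k) {E s : ℝ} (hE : 0 ≤ E)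
    (hχ01 : ∀ x, χ x ∈ Set.Icc (0 : ℝ) 1)
    (hB : ∀ j l : Fin N, E < |(j : ℝ) - M * (((l : ℕ) % M ^ k : ℕ) : ℝ)| →
      ‖bakerMap M A χ N j l‖ ≤ s) (hs0 : 0 ≤ s) {i : ℕ} (hi : i ≤ k + 1) :
    hs (bakerMap M A χ N ^ i * proj (nearCantor A N (k + 1) E i)ᶜ) ≤
      4 ^ i * ((N : ℝ) ^ 2 * s ^ 2) := by
  have hM0 : 0 < M := by omega
  have hn : 0 < M ^ k := by positivity
  have hnorm := norm_bakerMap_le_one (A := A) hM0 hn hN hχ01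
  induction i with
  | zero =>
    rw [nearCantor_zero (by rw [hN, pow_succ, mul_comm]) hE]
    have : hs (bakerMap M A χ N ^ 0 * proj (univ : Finset (Fin N))ᶜ) = 0 := by
      simp [hs, proj]
    rw [this]
    positivity
  | succ i ih =>
    set B := bakerMap M A χ N with hBdef
    set X := nearCantor A N (k + 1) E i with hX
    set Y := nearCantor A N (k + 1) E (i + 1) with hY
    -- Either the last factor `B` leads from outside `Y` into `X`, which is off the graph or outside
    -- the alphabet, or the intermediate index lies outside `X`, where the previous level applies.
    -- Each splitting at most quadruples the constant.
    have hsplit : B ^ (i + 1) * proj Yᶜ =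
        B ^ i * (proj X * B * proj Yᶜ) + (B ^ i * proj Xᶜ) * (B * proj Yᶜ) := by
      calc _ = B ^ i * ((proj X + proj Xᶜ) * (B * proj Yᶜ)) := by
            rw [proj_add_proj_compl, Matrix.one_mul, pow_succ, Matrix.mul_assoc]
        _ = _ := by rw [Matrix.add_mul, Matrix.mul_add]; simp only [Matrix.mul_assoc]
    have hent : ∀ j l, ‖(proj X * B * proj Yᶜ) j l‖ ^ 2 ≤ s ^ 2 := by
      intro j l
      gcongr
      rw [proj, proj, mul_diagonal, diagonal_mul]
      by_cases hj : j ∈ X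
      · by_cases hl : l ∈ Y
        · simpa [hl] using hs0
        · simp only [hj, if_true, one_mul, mem_compl, hl, not_false_eq_true, mul_one]
          by_cases ha : ∃ a ∈ A, (a : ℕ) = (l : ℕ) / M ^ k
          · refine hB j l ?_
            by_contra hcon
            push Not at hcon
            exact hl (mem_nearCantor_succ hM hE (by omega) hj ha hcon)
          · rw [hBdef, bakerMap_apply_eq_zero hM0 hN j l ha]
            simpa using hs0
      · simpa [hj] using hs0
    have h1 : hs (B ^ i * (proj X * B * proj Yᶜ)) ≤ (N : ℝ) ^ 2 * s ^ 2 := by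
      refine (hs_mul_le_of_norm_le_one_left (norm_pow_le_one hnorm i) _).trans ?_
      calc _ ≤ ∑ _j : Fin N, ∑ _l : Fin N, s ^ 2 :=
            sum_le_sum fun j _ => sum_le_sum fun l _ => hent j l
        _ = _ := by simp; ring
    have h2 : hs ((B ^ i * proj Xᶜ) * (B * proj Yᶜ)) ≤ 4 ^ i * ((N : ℝ) ^ 2 * s ^ 2) :=
      (hs_mul_le_of_norm_le_one_right (norm_mul_le_one hnorm (norm_proj_le_one _)) _).trans
        (ih (by omega))
    rw [hsplit]
    have h3 := hs_add_le (B ^ i * (proj X * B * proj Yᶜ)) ((B ^ i * proj Xᶜ) * (B * proj Yᶜ))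
    have h4 : (0 : ℝ) ≤ (N : ℝ) ^ 2 * s ^ 2 := by positivity
    have h5 : (1 : ℝ) ≤ 4 ^ i := one_le_pow₀ (by norm_num)
    rw [pow_succ]
    nlinarith

end Localization

end OpenBaker

namespace OpenBaker

open Finset Matrix
open scoped Matrix.Norms.L2Operator

/-! ### Spectral moments of a contraction localized on both sides. -/

section Moments

variable {ι : Type*} [Fintype ι] [DecidableEq ι] {T P Q : Matrix ι ι ℂ} {η t : ℝ} {l : ι → ℂ}

theorem hs_le_card (hT : ‖T‖ ≤ 1) : hs T ≤ Fintype.card ι := by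
  have h := hs_mul_le_of_norm_le_one_left hT (1 : Matrix ι ι ℂ)
  rw [Matrix.mul_one] at h
  refine h.trans (le_of_eq ?_)
  simp only [hs, Matrix.one_apply]
  rw [Finset.sum_congr rfl fun i _ => Finset.sum_eq_single i (fun j _ hj => by simp [hj.symm])
    (by simp)]
  simp

theorem hs_mul_le_of_localized (hT : ‖T‖ ≤ 1) (hQ : ‖Q‖ ≤ 1) (h1 : hs (T - T * P) ≤ η) :
    hs (T * Q) ≤ 2 * hs (P * Q) + 2 * η := by
  have hsplit : T * Q = T * (P * Q) + (T - T * P) * Q := by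
    rw [Matrix.sub_mul, Matrix.mul_assoc]; abel
  have h2 := hs_add_le (T * (P * Q)) ((T - T * P) * Q)
  have h3 := hs_mul_le_of_norm_le_one_left hT (P * Q)
  have h4 := hs_mul_le_of_norm_le_one_right hQ (T - T * P)
  rw [hsplit]
  linarith

/-- Second moment of the eigenvalues of a doubly localized contraction. -/
theorem sum_sq_le_of_localized (hT : ‖T‖ ≤ 1) (hQ : ‖Q‖ ≤ 1) (h1 : hs (T - T * P) ≤ η)
    (h2 : hs (T - Q * T) ≤ η) (hl : T.charpoly = ∏ i, (Polynomial.X - Polynomial.C (l i)))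
    (ht : 0 < t) :
    ∑ i, ‖l i‖ ^ 2 ≤ 2 * hs (P * Q) + (t ^ 2 * Fintype.card ι + (t⁻¹ ^ 2 + 15) * η) := by
  have h3 := sum_sq_le_of_approx hQ hl ht
  have h4 := hs_mul_le_of_localized hT hQ h1
  have h5 := mul_le_mul_of_nonneg_left (hs_le_card hT) (sq_nonneg t)
  have h6 : (t⁻¹ ^ 2 + 1) * hs (T - Q * T) ≤ (t⁻¹ ^ 2 + 1) * η := by gcongr
  have h7 := (hs_nonneg _).trans h1
  linarith

/-- Fourth moment of the eigenvalues of a doubly localized contraction. -/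
theorem sum_pow_four_le_of_localized (hT : ‖T‖ ≤ 1) (hP : ‖P‖ ≤ 1) (hQ : ‖Q‖ ≤ 1)
    (h1 : hs (T - T * P) ≤ η) (h2 : hs (T - Q * T) ≤ η)
    (hl : (T * T).charpoly = ∏ i, (Polynomial.X - Polynomial.C (l i))) (ht : 0 < t) :
    ∑ i, ‖l i‖ ^ 2 ≤
      8 * hs (P * Q * (P * Q)ᴴ) + (t ^ 2 * Fintype.card ι + (t⁻¹ ^ 2 + 15) * η) := by
  have h3 := sum_sq_le_of_approx hQ hl ht
  have hTT := norm_mul_le_one hT hT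
  have h5 := mul_le_mul_of_nonneg_left (hs_le_card hTT) (sq_nonneg t)
  have h6 : hs (T * T - Q * (T * T)) ≤ η := by
    rw [← Matrix.mul_assoc, ← Matrix.sub_mul]
    exact (hs_mul_le_of_norm_le_one_right hT _).trans h2
  have h6' : (t⁻¹ ^ 2 + 1) * hs (T * T - Q * (T * T)) ≤ (t⁻¹ ^ 2 + 1) * η := by gcongr
  have hPQ := norm_mul_le_one hP hQ
  -- `T T Q` is replaced successively by `T Q T Q`, `T P Q T Q` and `T P Q T P Q`. Each replacement
  -- doubles the main term, giving `8`, and the errors add up to `2 + 4 + 8 = 14` times `η`.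
  have h7 : hs (T * T * Q) ≤ 2 * hs (T * Q * (T * Q)) + 2 * η := by
    have hsplit : T * T * Q = T * Q * (T * Q) + T * ((T - Q * T) * Q) := by
      simp only [Matrix.sub_mul, Matrix.mul_sub, Matrix.mul_assoc]; abel
    have a1 := hs_add_le (T * Q * (T * Q)) (T * ((T - Q * T) * Q))
    have a2 := hs_mul_le_of_norm_le_one_left hT ((T - Q * T) * Q)
    have a3 := hs_mul_le_of_norm_le_one_right hQ (T - Q * T)
    rw [hsplit]
    linarith
  have h8 : hs (T * Q * (T * Q)) ≤ 2 * hs (P * Q * (T * Q)) + 2 * η := by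
    have hsplit : T * Q * (T * Q) = T * (P * Q * (T * Q)) + (T - T * P) * (Q * (T * Q)) := by
      simp only [Matrix.sub_mul, Matrix.mul_assoc]; abel
    have a1 := hs_add_le (T * (P * Q * (T * Q))) ((T - T * P) * (Q * (T * Q)))
    have a2 := hs_mul_le_of_norm_le_one_left hT (P * Q * (T * Q))
    have a3 := hs_mul_le_of_norm_le_one_right (norm_mul_le_one hQ (norm_mul_le_one hT hQ))
      (T - T * P)
    rw [hsplit]
    linarith
  have h9 : hs (P * Q * (T * Q)) ≤ 2 * hs (P * Q * T * (P * Q)) + 2 * η := by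
    have hsplit : P * Q * (T * Q) = P * Q * T * (P * Q) + P * Q * ((T - T * P) * Q) := by
      simp only [Matrix.sub_mul, Matrix.mul_sub, Matrix.mul_assoc]; abel
    have a1 := hs_add_le (P * Q * T * (P * Q)) (P * Q * ((T - T * P) * Q))
    have a2 := hs_mul_le_of_norm_le_one_left hPQ ((T - T * P) * Q)
    have a3 := hs_mul_le_of_norm_le_one_right hQ (T - T * P)
    rw [hsplit]
    linarith
  have h10 := hs_mul_mul_le hT (P * Q)
  linarith

end Moments

/-! ### Position and frequency projections onto the neighbourhood of the Cantor set. -/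

section Localized

variable {M N : ℕ} {A : Finset (Fin M)} {χ : ℝ → ℝ}

theorem proj_mul_self (X : Finset (Fin N)) : proj X * proj X = proj X := by
  rw [proj, diagonal_mul_diagonal]
  congr 1
  funext l
  split_ifs <;> simp

theorem proj_conjTranspose (X : Finset (Fin N)) : (proj X)ᴴ = proj X := by
  rw [proj, diagonal_conjTranspose]
  congr 1
  funext l
  by_cases h : l ∈ X <;> simp [h]

/-- The projection onto a set of frequencies. -/
noncomputable def freqProj (X : Finset (Fin N)) : Matrix (Fin N) (Fin N) ℂ :=
  (fourierMatrix N)ᴴ * proj X * fourierMatrix N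

theorem norm_freqProj_le_one (hN : 0 < N) (X : Finset (Fin N)) : ‖freqProj X‖ ≤ 1 := by
  have := norm_fourierMatrix_le_one hN
  exact norm_mul_le_one (norm_mul_le_one (by rwa [l2_opNorm_conjTranspose])
    (norm_proj_le_one X)) this

theorem sum_sum_ite_mem {R : Type*} [AddCommMonoid R] (X : Finset (Fin N))
    (f : Fin N → Fin N → R) :
    ∑ j, ∑ l, (if j ∈ X then (if l ∈ X then f j l else 0) else 0) = ∑ j ∈ X, ∑ l ∈ X, f j l := by
  have h : ∀ j : Fin N, ∑ l, (if j ∈ X then (if l ∈ X then f j l else 0) else 0) =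
      if j ∈ X then ∑ l ∈ X, f j l else 0 := by
    intro j
    split_ifs
    · rw [← sum_filter, filter_mem_eq_inter, univ_inter]
    · simp
  simp only [h]
  rw [← sum_filter, filter_mem_eq_inter, univ_inter]

/-- The outer Fourier factor is a contraction, and what remains is the inverse Fourier matrix
restricted to `X × X`, all of whose entries have modulus `N ^ (-1/2)`. -/
theorem hs_proj_mul_freqProj_le (hN : 0 < N) (X : Finset (Fin N)) :
    hs (proj X * freqProj X) ≤ (#X : ℝ) ^ 2 / N := by
  have h1 : proj X * freqProj X = proj X * (fourierMatrix N)ᴴ * proj X * fourierMatrix N := by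
    simp only [freqProj, Matrix.mul_assoc]
  rw [h1]
  refine (hs_mul_le_of_norm_le_one_right (norm_fourierMatrix_le_one hN) _).trans (le_of_eq ?_)
  have h2 : ∀ j l : Fin N, ‖(proj X * (fourierMatrix N)ᴴ * proj X) j l‖ ^ 2 =
      if j ∈ X then (if l ∈ X then (1 : ℝ) / N else 0) else 0 := by
    intro j l
    rw [proj, mul_diagonal, diagonal_mul]
    by_cases hj : j ∈ X
    · by_cases hl : l ∈ X
      · simp only [hj, hl, if_true, one_mul, mul_one, conjTranspose_apply, fourierMatrix,
          Matrix.of_apply, norm_star]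
        rw [fourierEntry_eq, norm_div, norm_ex, Complex.norm_real,
          Real.norm_of_nonneg (Real.sqrt_nonneg _), div_pow, Real.sq_sqrt (by positivity), one_pow]
      · simp [hl]
    · simp [hj]
  simp only [hs, h2]
  rw [sum_sum_ite_mem]
  simp only [sum_const, nsmul_eq_mul]
  ring

/-- The integers underlying a set of indices. -/
def toInt (X : Finset (Fin N)) : Finset ℤ := X.image fun l : Fin N => ((l : ℕ) : ℤ)

theorem sum_toInt {R : Type*} [AddCommMonoid R] (X : Finset (Fin N)) (f : ℤ → R) :
    ∑ x ∈ toInt X, f x = ∑ l ∈ X, f ((l : ℕ) : ℤ) :=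
  sum_image fun a _ b _ h => Fin.ext (by exact_mod_cast h)

/-- `freqProj X` is a self-adjoint projection, so the product is its compression to `X`, with
entries `N⁻¹ ∑ ex (y (j - l) / N)` over `y ∈ X`. -/
theorem hs_proj_mul_freqProj_conj (hN : 0 < N) (X : Finset (Fin N)) :
    hs (proj X * freqProj X * (proj X * freqProj X)ᴴ) =
      crossSum N (toInt X) (toInt X) 0 / (N : ℝ) ^ 2 := by
  have hU := mul_eq_one_comm.mp (fourierMatrix_conjTranspose_mul hN)
  have h1 : proj X * freqProj X * (proj X * freqProj X)ᴴ =
      proj X * ((fourierMatrix N)ᴴ * proj X * fourierMatrix N) * proj X := by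
    simp only [freqProj, conjTranspose_mul, conjTranspose_conjTranspose, proj_conjTranspose]
    calc _ = proj X * ((fourierMatrix N)ᴴ * (proj X * (fourierMatrix N * (fourierMatrix N)ᴴ) *
          proj X) * fourierMatrix N) * proj X := by simp only [Matrix.mul_assoc]
      _ = _ := by rw [hU, Matrix.mul_one, proj_mul_self]
  have h2 : ∀ j l : Fin N, ‖(proj X * ((fourierMatrix N)ᴴ * proj X * fourierMatrix N) *
      proj X) j l‖ ^ 2 = if j ∈ X then (if l ∈ X then ‖∑ y ∈ toInt X,
        ex (y * (((((j : ℕ) : ℤ) : ℝ) - (((l : ℕ) : ℤ) : ℝ) + 0) / N))‖ ^ 2 / (N : ℝ) ^ 2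
          else 0) else 0 := by
    intro j l
    rw [proj, mul_diagonal, diagonal_mul]
    by_cases hj : j ∈ X
    · by_cases hl : l ∈ X
      · simp only [hj, hl, if_true, one_mul, mul_one]
        rw [← div_pow]
        congr 1
        rw [Matrix.mul_apply]
        simp only [mul_diagonal, conjTranspose_apply, mul_ite, mul_one, mul_zero, ite_mul, zero_mul]
        rw [← sum_filter, filter_mem_eq_inter, univ_inter, sum_toInt]
        have h3 : ∀ y : Fin N, star (fourierMatrix N y j) * fourierMatrix N y l =
            ex ((((y : ℕ) : ℤ) : ℝ) * (((((j : ℕ) : ℤ) : ℝ) - (((l : ℕ) : ℤ) : ℝ) + 0) / N)) /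
              (N : ℂ) := by
          intro y
          have hs : star (fourierMatrix N y j) = _ := conj_fourierEntry N y j
          rw [hs, fourierMatrix, Matrix.of_apply, fourierEntry_eq, div_mul_div_comm, ← ex_add]
          congr 1
          · congr 1
            push_cast
            ring
          · rw [← Complex.ofReal_mul, Real.mul_self_sqrt (by positivity)]; simp
        simp only [h3]
        rw [← sum_div, norm_div, Complex.norm_natCast]
      · simp [hl]
    · simp [hj]
  rw [h1]
  simp only [hs, h2]
  rw [sum_sum_ite_mem, crossSum, sum_toInt, sum_div]
  refine sum_congr rfl fun j _ => ?_
  rw [sum_toInt, sum_div]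

/-- Fourier conjugation transposes `B ^ k`, so localization in position on the right is the same as
localization in frequency on the left. -/
theorem hs_sub_freqProj_mul_le (hM : 0 < M) {n : ℕ} (hn : 0 < n) (hN : N = M * n) (k : ℕ)
    (X : Finset (Fin N)) :
    hs (bakerMap M A χ N ^ k - freqProj X * bakerMap M A χ N ^ k) ≤
      hs (bakerMap M A χ N ^ k * proj Xᶜ) := by
  have hN0 : 0 < N := by rw [hN]; positivity
  have hU' := fourierMatrix_conjTranspose_mul hN0
  have hU := mul_eq_one_comm.mp hU'
  have hFn := norm_fourierMatrix_le_one hN0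
  set B := bakerMap M A χ N with hB
  set F := fourierMatrix N with hF
  have hpow : F * B ^ k * Fᴴ = (B ^ k)ᵀ := by
    induction k with
    | zero => simp [hU]
    | succ k ih =>
      calc F * B ^ (k + 1) * Fᴴ = F * B ^ k * 1 * B * Fᴴ := by
            rw [pow_succ, Matrix.mul_one]; simp only [Matrix.mul_assoc]
        _ = (F * B ^ k * Fᴴ) * (F * B * Fᴴ) := by rw [← hU']; simp only [Matrix.mul_assoc]
        _ = _ := by
            rw [ih, hB, hF, fourier_conj_bakerMap hM hn hN, ← transpose_mul, ← pow_succ']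
  have h1 : B ^ k = Fᴴ * (B ^ k)ᵀ * F := by
    rw [← hpow]
    calc B ^ k = 1 * B ^ k * 1 := by simp
      _ = _ := by rw [← hU']; simp only [Matrix.mul_assoc]
  have h2 : (B ^ k)ᵀ - proj X * (B ^ k)ᵀ = (B ^ k * proj Xᶜ)ᵀ := by
    have : (proj Xᶜ)ᵀ = proj Xᶜ := by rw [proj, diagonal_transpose]
    rw [transpose_mul, this, eq_sub_of_add_eq' (proj_add_proj_compl X), Matrix.sub_mul,
      Matrix.one_mul]
  have h3 : B ^ k - freqProj X * B ^ k = Fᴴ * (B ^ k * proj Xᶜ)ᵀ * F := by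
    rw [← h2, Matrix.mul_sub, Matrix.sub_mul, ← h1]
    congr 1
    rw [freqProj, ← hF, ← hpow]
    calc _ = Fᴴ * proj X * F * B ^ k * 1 := by rw [Matrix.mul_one]
      _ = _ := by rw [← hU']; simp only [Matrix.mul_assoc]
  rw [h3]
  refine (hs_mul_le_of_norm_le_one_right hFn _).trans ?_
  refine (hs_mul_le_of_norm_le_one_left (by rwa [l2_opNorm_conjTranspose]) _).trans ?_
  rw [hs_transpose]

theorem exists_localization (hM : 2 ≤ M) (A : Finset (Fin M)) (hχ : ContDiff ℝ (⊤ : ℕ∞) χ)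
    (hc : HasCompactSupport χ) (hsupp : tsupport χ ⊆ Set.Ioo 0 1)
    (hχ01 : ∀ x, χ x ∈ Set.Icc (0 : ℝ) 1) {ε : ℝ} (hε : 0 < ε) (hε1 : ε ≤ 1) (K : ℝ) :
    ∃ C, 0 < C ∧ ∀ k : ℕ,
      hs (bakerMap M A χ (M ^ (k + 1)) ^ (k + 1) * proj (nearCantor A (M ^ (k + 1)) (k + 1)
        (((M : ℝ) ^ (k + 1)) ^ ε) (k + 1))ᶜ) ≤ C * ((M : ℝ) ^ (k + 1)) ^ (-K) := by
  -- The squared kernel bound is of order `N ^ (-K - 4)`: one factor `N ^ 2` pays for the number of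
  -- entries, the other for the iteration constant `4 ^ (k + 1) ≤ N ^ 2`.
  obtain ⟨C, hC, h⟩ := exists_offGraph_bound (by omega : 0 < M) hχ hc hsupp hχ01 hε hε1 (K / 2 + 2)
  refine ⟨C ^ 2, by positivity, fun k => ?_⟩
  have hM' : (2 : ℝ) ≤ M := by exact_mod_cast hM
  have hN : M ^ (k + 1) = M * M ^ k := by rw [pow_succ']
  have h1 := hs_pow_mul_proj_compl_le (A := A) (χ := χ) hM hN (E := ((M : ℝ) ^ (k + 1)) ^ ε)
    (s := C * ((M : ℝ) ^ (k + 1)) ^ (-(K / 2 + 2))) (by positivity) hχ01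
    (fun j l hjl => by
      have := h (M ^ k) (M ^ (k + 1)) (by positivity) hN A j l (by push_cast; exact hjl)
      push_cast at this
      exact this) (by positivity) le_rfl
  refine h1.trans ?_
  set x : ℝ := (M : ℝ) ^ (k + 1) with hx
  have hx0 : 0 < x := by positivity
  have h4 : (4 : ℝ) ^ (k + 1) ≤ x ^ 2 := by
    rw [hx, ← pow_mul, mul_comm, pow_mul]
    gcongr
    nlinarith
  have h5 : (((M ^ (k + 1) : ℕ) : ℝ)) = x := by rw [hx]; push_cast; rfl
  rw [h5]
  calc _ ≤ x ^ 2 * (x ^ 2 * (C * x ^ (-(K / 2 + 2))) ^ 2) := by gcongr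
    _ = C ^ 2 * (x ^ (4 : ℝ) * (x ^ (-(K / 2 + 2)) * x ^ (-(K / 2 + 2)))) := by
        rw [show (4 : ℝ) = ((4 : ℕ) : ℝ) by norm_num, Real.rpow_natCast]; ring
    _ = _ := by
        rw [← Real.rpow_add hx0, ← Real.rpow_add hx0]
        ring_nf

theorem exists_shift_of_mem_nearCantor {k : ℕ} {E : ℝ} {l : Fin N}
    (h : l ∈ nearCantor A N k E k) : ∃ s ∈ cantor M (digits A) k,
      ∃ j ∈ Icc (-⌊1 + 2 * E⌋) ⌊1 + 2 * E⌋, ((l : ℕ) : ℤ) = s + j := by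
  classical
  obtain ⟨c, hc, hl⟩ := (mem_filter.mp h).2
  simp only [Nat.sub_self, pow_zero, one_mul] at hl
  refine ⟨c, hc, (l : ℕ) - c, ?_, by ring⟩
  rw [abs_le] at hl
  have h1 : ((l : ℕ) : ℤ) - c ≤ ⌊1 + 2 * E⌋ := by
    rw [Int.le_floor]; push_cast; exact hl.2
  have h2 : -(((l : ℕ) : ℤ) - c) ≤ ⌊1 + 2 * E⌋ := by
    rw [Int.le_floor]; push_cast; linarith [hl.1]
  rw [mem_Icc]
  constructor <;> omega

theorem card_shifts_le {E : ℝ} (hE : 1 ≤ E) :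
    (#(Icc (-⌊1 + 2 * E⌋) ⌊1 + 2 * E⌋) : ℝ) ≤ 7 * E := by
  have h0 : 0 ≤ ⌊1 + 2 * E⌋ := Int.floor_nonneg.mpr (by linarith)
  have h1 := Int.floor_le (1 + 2 * E)
  rw [Int.card_Icc]
  have h2 : (((⌊1 + 2 * E⌋ + 1 - -⌊1 + 2 * E⌋).toNat : ℤ) : ℝ) =
      2 * (⌊1 + 2 * E⌋ : ℝ) + 1 := by
    rw [Int.toNat_of_nonneg (by omega)]; push_cast; ring
  have h3 : (((⌊1 + 2 * E⌋ + 1 - -⌊1 + 2 * E⌋).toNat : ℕ) : ℝ) =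
      2 * (⌊1 + 2 * E⌋ : ℝ) + 1 := by exact_mod_cast h2
  rw [h3]
  linarith

theorem card_nearCantor_le {k : ℕ} {E : ℝ} (hE : 1 ≤ E) :
    (#(nearCantor A N k E k) : ℝ) ≤ 7 * E * (#A : ℝ) ^ k := by
  classical
  set J := Icc (-⌊1 + 2 * E⌋) ⌊1 + 2 * E⌋ with hJ
  have h1 : toInt (nearCantor A N k E k) ⊆
      (J ×ˢ cantor M (digits A) k).image fun p => p.2 + p.1 := by
    intro x hx
    obtain ⟨l, hl, rfl⟩ := mem_image.mp hx
    obtain ⟨s, hs, j, hj, heq⟩ := exists_shift_of_mem_nearCantor hl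
    exact mem_image.mpr ⟨(j, s), mem_product.mpr ⟨hj, hs⟩, heq.symm⟩
  have h2 := (card_le_card h1).trans card_image_le
  rw [card_product, card_cantor (digits_bounds A), card_digits, toInt,
    card_image_of_injective _ fun a b h => Fin.ext (by exact_mod_cast h)] at h2
  have h3 : (#(nearCantor A N k E k) : ℝ) ≤ #J * (#A : ℝ) ^ k := by exact_mod_cast h2
  refine h3.trans ?_
  gcongr
  exact card_shifts_le hE

/-- The covering bound is applied once in each variable, with `crossSum_comm` exchanging them. -/
theorem crossSum_nearCantor_le {k : ℕ} {E : ℝ} (hE : 1 ≤ E) (x : ℝ) :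
    crossSum x (toInt (nearCantor A N k E k)) (toInt (nearCantor A N k E k)) 0 ≤
      (7 * E) ^ 4 * crossSum x (cantor M (digits A) k) (cantor M (digits A) k) 0 := by
  set J := Icc (-⌊1 + 2 * E⌋) ⌊1 + 2 * E⌋ with hJ
  set X := toInt (nearCantor A N k E k) with hX
  set S := cantor M (digits A) k with hS
  have hcov : ∀ x ∈ X, ∃ s ∈ S, ∃ j ∈ J, x = s + j := by
    intro x hx
    obtain ⟨l, hl, rfl⟩ := mem_image.mp hx
    exact exists_shift_of_mem_nearCantor hl
  have h1 := crossSum_le_of_cover x X hcov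
  have h2 := crossSum_le_of_cover x S hcov
  rw [crossSum_comm x S X] at h1
  have h3 : (#J : ℝ) ≤ 7 * E := card_shifts_le hE
  have h4 := crossSum_nonneg x S S 0
  calc _ ≤ _ := h1
    _ ≤ (#J : ℝ) ^ 2 * ((#J : ℝ) ^ 2 * crossSum x S S 0) := by gcongr
    _ = (#J : ℝ) ^ 4 * crossSum x S S 0 := by ring
    _ ≤ _ := by gcongr

end Localized

end OpenBaker

namespace OpenBaker

open Finset Matrix
open scoped Matrix.Norms.L2Operator

/-! ### Counting eigenvalues: the four exponents. -/

section Weyl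

variable {M : ℕ} {A : Finset (Fin M)} {χ : ℝ → ℝ}

open Classical in
theorem eigenvalueCount_eq {k : ℕ} {l : Fin (M ^ k) → ℂ}
    (hl : IsSpectrum (bakerMap M A χ (M ^ k)) l) (ν : ℝ) :
    eigenvalueCount M A χ k ν = #(univ.filter fun i => (M : ℝ) ^ (-ν) ≤ ‖l i‖) := by
  have h := (hl 1).1
  simp only [pow_one] at h
  rw [eigenvalueCount, h, roots_prod_X_sub_C_eq, Multiset.filter_map, Multiset.card_map]
  rfl

/-- Chebyshev's inequality: since `N = M ^ k`, an eigenvalue above the threshold has `(k r)`-th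
power of modulus at least `N ^ (-r ν)`. -/
theorem eigenvalueCount_le_moment (hM : 0 < M) {k : ℕ} {l : Fin (M ^ k) → ℂ}
    (hl : IsSpectrum (bakerMap M A χ (M ^ k)) l) (ν : ℝ) (r : ℕ) :
    (eigenvalueCount M A χ k ν : ℝ) ≤
      ((M : ℝ) ^ k) ^ (2 * r * ν) * ∑ i, ‖l i ^ (k * r)‖ ^ 2 := by
  classical
  have hMr : (0 : ℝ) < M := by exact_mod_cast hM
  have h1 : ∀ i ∈ univ.filter (fun i => (M : ℝ) ^ (-ν) ≤ ‖l i‖),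
      (1 : ℝ) ≤ ((M : ℝ) ^ k) ^ (2 * r * ν) * ‖l i ^ (k * r)‖ ^ 2 := by
    intro i hi
    have hi' := (mem_filter.mp hi).2
    have h2 : (((M : ℝ) ^ (-ν)) ^ (k * r)) ^ 2 ≤ ‖l i ^ (k * r)‖ ^ 2 := by
      rw [norm_pow]; gcongr
    have h3 : ((M : ℝ) ^ k) ^ (2 * r * ν) * (((M : ℝ) ^ (-ν)) ^ (k * r)) ^ 2 = 1 := by
      rw [← pow_mul, ← Real.rpow_natCast, ← Real.rpow_natCast, ← Real.rpow_mul hMr.le,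
        ← Real.rpow_mul hMr.le, ← Real.rpow_add hMr]
      push_cast
      rw [show (k : ℝ) * (2 * r * ν) + -ν * (k * r * 2) = 0 by ring, Real.rpow_zero]
    rw [← h3]
    gcongr
  rw [eigenvalueCount_eq hl, mul_sum]
  calc ((#(univ.filter fun i => (M : ℝ) ^ (-ν) ≤ ‖l i‖) : ℕ) : ℝ)
      = ∑ _i ∈ univ.filter (fun i => (M : ℝ) ^ (-ν) ≤ ‖l i‖), (1 : ℝ) := by simp
    _ ≤ ∑ i ∈ univ.filter (fun i => (M : ℝ) ^ (-ν) ≤ ‖l i‖),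
        ((M : ℝ) ^ k) ^ (2 * r * ν) * ‖l i ^ (k * r)‖ ^ 2 := sum_le_sum h1
    _ ≤ _ := sum_le_sum_of_subset_of_nonneg (filter_subset _ _) fun _ _ _ => by positivity

/-- Both moments of the spectrum of the baker's map, in terms of the discrete Cantor set. -/
theorem exists_moment_bounds (hA₁ : 1 < #A) (hA₂ : #A < M) (hχ : ContDiff ℝ (⊤ : ℕ∞) χ)
    (hc : HasCompactSupport χ) (hsupp : tsupport χ ⊆ Set.Ioo 0 1)
    (hχ01 : ∀ x, χ x ∈ Set.Icc (0 : ℝ) 1) {ε : ℝ} (hε : 0 < ε) (hε1 : ε ≤ 1) {K : ℝ}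
    (hK : 0 ≤ K) :
    ∃ C, 0 < C ∧ ∀ k : ℕ, ∀ l, IsSpectrum (bakerMap M A χ (M ^ (k + 1))) l →
      ∑ i, ‖l i ^ ((k + 1) * 1)‖ ^ 2 ≤ C * (((M : ℝ) ^ (k + 1)) ^ (2 * ε + 2 * dim M A - 1) +
        ((M : ℝ) ^ (k + 1)) ^ (1 - K)) ∧
      ∑ i, ‖l i ^ ((k + 1) * 2)‖ ^ 2 ≤ C * (((M : ℝ) ^ (k + 1)) ^ (4 * ε - 2) *
        crossSum ((M : ℝ) ^ (k + 1)) (cantor M (digits A) (k + 1)) (cantor M (digits A) (k + 1)) 0 +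
        ((M : ℝ) ^ (k + 1)) ^ (1 - K)) := by
  have hM2 : 2 ≤ M := by omega
  obtain ⟨C₀, hC₀, hloc⟩ := exists_localization hM2 A hχ hc hsupp hχ01 hε hε1 (2 * K)
  -- The fourth moment needs `8 * 7 ^ 4 + 1 = 19209`; the localization error contributes `16 C₀`.
  refine ⟨20000 + 16 * C₀, by positivity, fun k l hl => ?_⟩
  have hM1 : (1 : ℝ) ≤ M := by exact_mod_cast (by omega : 1 ≤ M)
  have hη := hloc k
  have hNcast : ((M ^ (k + 1) : ℕ) : ℝ) = (M : ℝ) ^ (k + 1) := by push_cast; rfl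
  have hcard : ((Fintype.card (Fin (M ^ (k + 1))) : ℕ) : ℝ) = (M : ℝ) ^ (k + 1) := by
    rw [Fintype.card_fin, hNcast]
  have hdim := pow_rpow_dim hA₁ hA₂ (k + 1)
  set x : ℝ := (M : ℝ) ^ (k + 1) with hx
  have hx1 : 1 ≤ x := one_le_pow₀ hM1
  have hx0 : 0 < x := by linarith
  set X := nearCantor A (M ^ (k + 1)) (k + 1) (x ^ ε) (k + 1) with hX
  set B := bakerMap M A χ (M ^ (k + 1)) with hB
  have hN0 : 0 < M ^ (k + 1) := by positivity
  have hN : M ^ (k + 1) = M * M ^ k := by rw [pow_succ']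
  have hM0 : 0 < M := by omega
  have hn0 : 0 < M ^ k := by positivity
  have hBn : ‖B‖ ≤ 1 := norm_bakerMap_le_one hM0 hn0 hN hχ01
  have hT := norm_pow_le_one hBn (k + 1)
  have hP := norm_proj_le_one X
  have hQ := norm_freqProj_le_one hN0 X
  have hE1 : 1 ≤ x ^ ε := Real.one_le_rpow hx1 hε.le
  have h1 : hs (B ^ (k + 1) - B ^ (k + 1) * proj X) ≤ C₀ * x ^ (-(2 * K)) := by
    have : B ^ (k + 1) - B ^ (k + 1) * proj X = B ^ (k + 1) * proj Xᶜ := by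
      rw [eq_sub_of_add_eq' (proj_add_proj_compl X), Matrix.mul_sub, Matrix.mul_one]
    rw [this]
    exact hη
  have h2 : hs (B ^ (k + 1) - freqProj X * B ^ (k + 1)) ≤ C₀ * x ^ (-(2 * K)) :=
    (hs_sub_freqProj_mul_le hM0 hn0 hN (k + 1) X).trans hη
  -- With localization error `x ^ (-2 K)`, this `t` gives `t ^ 2 x = x ^ (1 - K)` and `t⁻¹ ^ 2 x ^
  -- (-2 K) = x ^ (-K)`.
  set t : ℝ := x ^ (-(K / 2)) with ht
  have ht0 : 0 < t := by positivity
  have ht2 : t ^ 2 = x ^ (-K) := by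
    rw [ht, ← Real.rpow_natCast, ← Real.rpow_mul hx0.le]; congr 1; push_cast; ring
  have herr : t ^ 2 * x + (t⁻¹ ^ 2 + 15) * (C₀ * x ^ (-(2 * K))) ≤
      (1 + 16 * C₀) * x ^ (1 - K) := by
    have e1 : x ^ (-K) * x = x ^ (1 - K) := by
      rw [← Real.rpow_add_one hx0.ne']; congr 1; ring
    have e2 : t⁻¹ ^ 2 = x ^ K := by rw [inv_pow, ht2, Real.rpow_neg hx0.le, inv_inv]
    have e3 : (1 : ℝ) ≤ x ^ K := Real.one_le_rpow hx1 hK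
    have e4 : x ^ K * x ^ (-(2 * K)) = x ^ (-K) := by
      rw [← Real.rpow_add hx0]; congr 1; ring
    have e5 : x ^ (-K) ≤ x ^ (1 - K) :=
      Real.rpow_le_rpow_of_exponent_le hx1 (by linarith)
    rw [ht2, e1, e2]
    have e6 : (x ^ K + 15) * (C₀ * x ^ (-(2 * K))) ≤ (16 * x ^ K) * (C₀ * x ^ (-(2 * K))) := by
      gcongr; linarith
    have e7 : (16 * x ^ K) * (C₀ * x ^ (-(2 * K))) = 16 * C₀ * x ^ (-K) := by
      rw [← e4]; ring
    have e8 : 16 * C₀ * x ^ (-K) ≤ 16 * C₀ * x ^ (1 - K) := by gcongr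
    linarith
  have hpos1 : 0 < x ^ (1 - K) := by positivity
  constructor
  · have h3 := sum_sq_le_of_localized hT hQ h1 h2 (hl (k + 1)).1 ht0
    rw [hcard] at h3
    have h4 := hs_proj_mul_freqProj_le hN0 X
    rw [hNcast] at h4
    have h5 : (#X : ℝ) ≤ 7 * x ^ ε * x ^ dim M A := by
      rw [hdim]; exact card_nearCantor_le hE1
    have h6 : (#X : ℝ) ^ 2 / x ≤ 49 * x ^ (2 * ε + 2 * dim M A - 1) := by
      calc (#X : ℝ) ^ 2 / x ≤ (7 * x ^ ε * x ^ dim M A) ^ 2 / x := by gcongr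
        _ = 49 * (x ^ ε * x ^ ε * (x ^ dim M A * x ^ dim M A) * x⁻¹) := by
            rw [div_eq_mul_inv]; ring
        _ = _ := by
            rw [← Real.rpow_neg_one x, ← Real.rpow_add hx0, ← Real.rpow_add hx0,
              ← Real.rpow_add hx0, ← Real.rpow_add hx0]
            ring_nf
    have hpos2 : 0 < x ^ (2 * ε + 2 * dim M A - 1) := by positivity
    rw [mul_one]
    nlinarith
  · have h3 := sum_pow_four_le_of_localized (l := fun i => l i ^ ((k + 1) * 2)) hT hP hQ h1 h2
      (by rw [← (hl ((k + 1) * 2)).1, pow_mul, sq]) ht0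
    rw [hcard, hs_proj_mul_freqProj_conj hN0, hNcast] at h3
    have h4 := crossSum_nearCantor_le (A := A) (N := M ^ (k + 1)) (k := k + 1) hE1 x
    rw [← hX] at h4
    set q := crossSum x (cantor M (digits A) (k + 1)) (cantor M (digits A) (k + 1)) 0 with hq
    have hq0 : 0 ≤ q := crossSum_nonneg _ _ _ _
    have h6 : crossSum x (toInt X) (toInt X) 0 / x ^ 2 ≤ 2401 * (x ^ (4 * ε - 2) * q) := by
      calc _ ≤ (7 * x ^ ε) ^ 4 * q / x ^ 2 := by gcongr
        _ = 2401 * ((x ^ ε) ^ 4 / x ^ 2 * q) := by ring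
        _ = _ := by
            rw [Real.rpow_sub hx0, mul_comm 4 ε, Real.rpow_mul hx0.le]
            norm_cast
    have hpos2 : 0 ≤ x ^ (4 * ε - 2) * q := by positivity
    nlinarith

/-- The bound `N_k(ν) ≤ C N ^ (e + ε)`, for every `ε > 0`. -/
def HasWeylExponent (M : ℕ) (A : Finset (Fin M)) (χ : ℝ → ℝ) (ν e : ℝ) : Prop :=
  ∀ ε : ℝ, 0 < ε → ∃ C : ℝ, 0 < C ∧ ∀ k : ℕ, 1 ≤ k →
    (eigenvalueCount M A χ k ν : ℝ) ≤ C * ((M : ℝ) ^ k) ^ (e + ε)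

theorem hasWeylExponent_two (hA₁ : 1 < #A) (hA₂ : #A < M) (hχ : ContDiff ℝ (⊤ : ℕ∞) χ)
    (hc : HasCompactSupport χ) (hsupp : tsupport χ ⊆ Set.Ioo 0 1)
    (hχ01 : ∀ x, χ x ∈ Set.Icc (0 : ℝ) 1) (ν : ℝ) :
    HasWeylExponent M A χ ν (2 * (ν - (1 / 2 - dim M A))) := by
  intro ε hε
  have hδ := dim_pos hA₁ hA₂
  obtain ⟨C, hC, h⟩ := exists_moment_bounds hA₁ hA₂ hχ hc hsupp hχ01
    (ε := min (ε / 2) 1) (by positivity) (min_le_right _ _) (K := 2) (by norm_num)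
  refine ⟨2 * C, by positivity, fun k hk => ?_⟩
  obtain ⟨k, rfl⟩ : ∃ k', k = k' + 1 := ⟨k - 1, by omega⟩
  obtain ⟨l, hl⟩ := exists_isSpectrum (bakerMap M A χ (M ^ (k + 1)))
  have h1 := (h k l hl).1
  have h2 := eigenvalueCount_le_moment (by omega) hl ν 1
  have hx1 : (1 : ℝ) ≤ (M : ℝ) ^ (k + 1) :=
    one_le_pow₀ (by exact_mod_cast (by omega : 1 ≤ M))
  set x : ℝ := (M : ℝ) ^ (k + 1)
  have hx0 : 0 < x := by linarith
  have hmin := min_le_left (ε / 2) 1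
  have h3 : x ^ (2 * min (ε / 2) 1 + 2 * dim M A - 1) ≤ x ^ (ε + 2 * dim M A - 1) :=
    Real.rpow_le_rpow_of_exponent_le hx1 (by linarith)
  have h4 : x ^ ((1 : ℝ) - 2) ≤ x ^ (ε + 2 * dim M A - 1) :=
    Real.rpow_le_rpow_of_exponent_le hx1 (by linarith)
  calc _ ≤ _ := h2
    _ ≤ x ^ (2 * ((1 : ℕ) : ℝ) * ν) * (C * (x ^ (ε + 2 * dim M A - 1) +
        x ^ (ε + 2 * dim M A - 1))) := by
        gcongr
        exact h1.trans (by gcongr)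
    _ = 2 * C * (x ^ (2 * ((1 : ℕ) : ℝ) * ν) * x ^ (ε + 2 * dim M A - 1)) := by ring
    _ = _ := by
        rw [← Real.rpow_add hx0]
        congr 2
        push_cast
        ring

theorem hasWeylExponent_four (hA₁ : 1 < #A) (hA₂ : #A < M) (hχ : ContDiff ℝ (⊤ : ℕ∞) χ)
    (hc : HasCompactSupport χ) (hsupp : tsupport χ ⊆ Set.Ioo 0 1)
    (hχ01 : ∀ x, χ x ∈ Set.Icc (0 : ℝ) 1) (ν : ℝ) {β : ℝ}
    (hβ : ∀ ε : ℝ, 0 < ε → ∃ K, 0 < K ∧ ∀ k : ℕ,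
      crossSum ((M : ℝ) ^ k) (cantor M (digits A) k) (cantor M (digits A) k) 0 ≤
        K * ((M : ℝ) ^ k) ^ (2 - 4 * β + ε)) :
    HasWeylExponent M A χ ν (4 * (ν - β)) := by
  intro ε hε
  obtain ⟨C₁, hC₁, hcr⟩ := hβ (ε / 2) (by positivity)
  -- This `K` makes the remainder `N ^ (-|4 β|)`, at most `N ^ (-4 β)` whatever the sign of `β`.
  obtain ⟨C, hC, h⟩ := exists_moment_bounds hA₁ hA₂ hχ hc hsupp hχ01
    (ε := min (ε / 8) 1) (by positivity) (min_le_right _ _) (K := 1 + |4 * β|) (by positivity)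
  refine ⟨C * (C₁ + 1), by positivity, fun k hk => ?_⟩
  obtain ⟨k, rfl⟩ : ∃ k', k = k' + 1 := ⟨k - 1, by omega⟩
  obtain ⟨l, hl⟩ := exists_isSpectrum (bakerMap M A χ (M ^ (k + 1)))
  have h1 := (h k l hl).2
  have h2 := eigenvalueCount_le_moment (by omega) hl ν 2
  have h5 := hcr (k + 1)
  have hx1 : (1 : ℝ) ≤ (M : ℝ) ^ (k + 1) :=
    one_le_pow₀ (by exact_mod_cast (by omega : 1 ≤ M))
  set x : ℝ := (M : ℝ) ^ (k + 1)
  have hx0 : 0 < x := by linarith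
  have hmin := min_le_left (ε / 8) 1
  have h3 : x ^ (4 * min (ε / 8) 1 - 2) ≤ x ^ (ε / 2 - 2) :=
    Real.rpow_le_rpow_of_exponent_le hx1 (by linarith)
  have h4 : x ^ (1 - (1 + |4 * β|)) ≤ x ^ (ε - 4 * β) :=
    Real.rpow_le_rpow_of_exponent_le hx1 (by linarith [le_abs_self (4 * β)])
  have h6 : x ^ (ε / 2 - 2) * (C₁ * x ^ (2 - 4 * β + ε / 2)) = C₁ * x ^ (ε - 4 * β) := by
    rw [mul_left_comm, ← Real.rpow_add hx0]; ring_nf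
  have h7 := crossSum_nonneg x (cantor M (digits A) (k + 1)) (cantor M (digits A) (k + 1)) 0
  calc _ ≤ _ := h2
    _ ≤ x ^ (2 * ((2 : ℕ) : ℝ) * ν) * (C * (C₁ * x ^ (ε - 4 * β) + x ^ (ε - 4 * β))) := by
        gcongr
        rw [← h6]
        exact h1.trans (by gcongr)
    _ = C * (C₁ + 1) * (x ^ (2 * ((2 : ℕ) : ℝ) * ν) * x ^ (ε - 4 * β)) := by ring
    _ = _ := by
        rw [← Real.rpow_add hx0]
        congr 2
        push_cast
        ring

theorem one_add_div_pow_le_exp {a : ℝ} (ha : 0 ≤ a) {n : ℕ} (hn : 0 < n) :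
    (1 + a / n) ^ n ≤ Real.exp a := by
  have h : 1 + a / n ≤ Real.exp (a / n) := by linarith [Real.add_one_le_exp (a / n)]
  calc _ ≤ Real.exp (a / n) ^ n := by gcongr
    _ = _ := by
        rw [← Real.exp_nat_mul]
        congr 1
        field_simp

/-- If all columns of `T` outside `X` are negligible, then `T` has at most `O(#X)` eigenvalues
of polynomially bounded inverse. -/
theorem card_mul_log_le_of_small_columns {ι : Type*} [Fintype ι] [DecidableEq ι]
    {T : Matrix ι ι ℂ} {l : ι → ℂ}
    (hl : T.charpoly = ∏ i, (Polynomial.X - Polynomial.C (l i))) {x ν a : ℝ}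
    (hx : (Fintype.card ι : ℝ) = x) (hx2 : 2 ≤ x) (hν : 0 < ν) (ha : 0 ≤ a) (hT : hs T ≤ x)
    (X S : Finset ι) (hX : ∀ j ∉ X, ∀ i, ‖T i j‖ ≤ a * x ^ (-(2 + 2 * ν)))
    (hS : ∀ i ∈ S, x ^ (-ν) ≤ ‖l i‖) :
    #S * (ν * Real.log x) ≤ #X * ((3 + 2 * ν) * Real.log x) + a := by
  have hx0 : 0 < x := by linarith
  have hx1 : 1 ≤ x := by linarith
  have hcard0 : 0 < Fintype.card ι := by
    have : (0 : ℝ) < Fintype.card ι := by rw [hx]; exact hx0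
    exact_mod_cast this
  -- At this scale every eigenvalue counted in `S` contributes at least `x ^ ν` to the Jensen
  -- product, while a negligible column contributes at most `1 + a / x`, and all of these together
  -- at most `exp a`. Taking logarithms compares `#S` with `#X`.
  set s : ℝ := x ^ (-(2 * ν)) with hs
  have hs0 : 0 < s := by positivity
  have hmah := prod_max_one_le_prod_col_sum hl hs0
  have hsinv : s⁻¹ = x ^ (2 * ν) := by rw [hs, Real.rpow_neg hx0.le, inv_inv]
  have hlow : (x ^ ν) ^ #S ≤ ∏ i, max 1 (‖l i‖ / s) := by
    rw [← prod_const]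
    calc _ ≤ ∏ i ∈ S, max 1 (‖l i‖ / s) := by
          refine prod_le_prod (fun _ _ => by positivity) fun i hi => le_max_of_le_right ?_
          calc x ^ ν = x ^ (-ν) / s := by
                rw [div_eq_mul_inv, hsinv, ← Real.rpow_add hx0]; congr 1; ring
            _ ≤ _ := by gcongr; exact hS i hi
      _ ≤ _ := prod_le_prod_of_subset_of_one_le (subset_univ _)
          (fun i _ => by positivity) fun i _ _ => le_max_left _ _
  have hcolX : ∀ j, 1 + (∑ i, ‖T i j‖) / s ≤ x ^ (3 + 2 * ν) := by
    intro j
    have h1 : ∑ i, ‖T i j‖ ≤ x * x := by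
      calc _ ≤ ∑ _i : ι, x := by
            refine sum_le_sum fun i _ => ?_
            refine le_of_sq_le_sq ?_ hx0.le
            have := (norm_entry_sq_le_hs T i j).trans hT
            nlinarith
        _ = _ := by rw [sum_const, card_univ, nsmul_eq_mul, hx]
    have h2 : x ^ (3 + 2 * ν) = x * (x * x * x ^ (2 * ν)) := by
      rw [Real.rpow_add hx0, show (3 : ℝ) = ((3 : ℕ) : ℝ) by norm_num, Real.rpow_natCast]; ring
    have h3 : 1 ≤ x ^ (2 * ν) := Real.one_le_rpow hx1 (by positivity)
    have h4 : (∑ i, ‖T i j‖) / s ≤ x * x * x ^ (2 * ν) := by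
      rw [div_eq_mul_inv, hsinv]; gcongr
    have h5 : 1 ≤ x * x * x ^ (2 * ν) :=
      one_le_mul_of_one_le_of_one_le (one_le_mul_of_one_le_of_one_le hx1 hx1) h3
    have h6 := mul_le_mul_of_nonneg_right hx2 (zero_le_one.trans h5)
    rw [h2]
    linarith
  have hcolXc : ∀ j ∉ X, 1 + (∑ i, ‖T i j‖) / s ≤ 1 + a / (Fintype.card ι : ℝ) := by
    intro j hj
    have h4 : ∑ i, ‖T i j‖ ≤ x * (a * x ^ (-(2 + 2 * ν))) := by
      calc _ ≤ ∑ _i : ι, a * x ^ (-(2 + 2 * ν)) := sum_le_sum fun i _ => hX j hj i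
        _ = _ := by rw [sum_const, card_univ, nsmul_eq_mul, hx]
    rw [hx]
    gcongr 1 + ?_
    calc (∑ i, ‖T i j‖) / s ≤ x * (a * x ^ (-(2 + 2 * ν))) * x ^ (2 * ν) := by
          rw [div_eq_mul_inv, hsinv]; gcongr
      _ = a * (x * x ^ (-(2 + 2 * ν)) * x ^ (2 * ν)) := by ring
      _ = a * x⁻¹ := by
          congr 1
          rw [← Real.rpow_neg_one x]
          nth_rewrite 1 [← Real.rpow_one x]
          rw [← Real.rpow_add hx0, ← Real.rpow_add hx0]
          congr 1
          ring
      _ = _ := by rw [div_eq_mul_inv]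
  have hup : ∏ j, (1 + (∑ i, ‖T i j‖) / s) ≤ (x ^ (3 + 2 * ν)) ^ #X * Real.exp a := by
    have hnn : ∀ j, 0 ≤ 1 + (∑ i, ‖T i j‖) / s := fun j => by positivity
    rw [← prod_mul_prod_compl X]
    have h1 : ∏ j ∈ X, (1 + (∑ i, ‖T i j‖) / s) ≤ (x ^ (3 + 2 * ν)) ^ #X := by
      rw [← prod_const]
      exact prod_le_prod (fun j _ => hnn j) fun j _ => hcolX j
    have h2 : ∏ j ∈ Xᶜ, (1 + (∑ i, ‖T i j‖) / s) ≤ Real.exp a := by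
      calc _ ≤ ∏ _j ∈ Xᶜ, (1 + a / (Fintype.card ι : ℝ)) :=
            prod_le_prod (fun j _ => hnn j) fun j hj => hcolXc j (mem_compl.mp hj)
        _ = (1 + a / (Fintype.card ι : ℝ)) ^ #Xᶜ := by rw [prod_const]
        _ ≤ (1 + a / (Fintype.card ι : ℝ)) ^ (Fintype.card ι) := by
            refine pow_le_pow_right₀ ?_ (card_le_univ Xᶜ)
            have : 0 ≤ a / (Fintype.card ι : ℝ) := by positivity
            linarith
        _ ≤ _ := one_add_div_pow_le_exp ha hcard0
    have h3 : 0 ≤ ∏ j ∈ Xᶜ, (1 + (∑ i, ‖T i j‖) / s) := prod_nonneg fun j _ => hnn j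
    gcongr
  have hmain := Real.log_le_log (by positivity) (hlow.trans (hmah.trans hup))
  rwa [Real.log_mul (by positivity) (by positivity), Real.log_exp, Real.log_pow, Real.log_pow,
    Real.log_rpow hx0, Real.log_rpow hx0] at hmain

theorem hasWeylExponent_dim (hA₁ : 1 < #A) (hA₂ : #A < M) (hχ : ContDiff ℝ (⊤ : ℕ∞) χ)
    (hc : HasCompactSupport χ) (hsupp : tsupport χ ⊆ Set.Ioo 0 1)
    (hχ01 : ∀ x, χ x ∈ Set.Icc (0 : ℝ) 1) {ν : ℝ} (hν : 0 < ν) :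
    HasWeylExponent M A χ ν (dim M A) := by
  classical
  intro ε hε
  have hM2 : 2 ≤ M := by omega
  have hM0 : 0 < M := by omega
  have hδ := dim_pos hA₁ hA₂
  -- After a square root, the columns outside `X` have entries at most `√C₀ N ^ (-(2 + 2 ν))`, the
  -- smallness required by the Jensen bound.
  obtain ⟨C₀, hC₀, hloc⟩ := exists_localization hM2 A hχ hc hsupp hχ01
    (ε := min ε 1) (by positivity) (min_le_right _ _) (2 * (2 + 2 * ν))
  have hlog2 : 0 < Real.log 2 := Real.log_pos (by norm_num)
  refine ⟨(7 * (3 + 2 * ν) + Real.sqrt C₀ / Real.log 2) / ν, by positivity, fun k hk => ?_⟩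
  obtain ⟨k, rfl⟩ : ∃ k', k = k' + 1 := ⟨k - 1, by omega⟩
  obtain ⟨l, hl⟩ := exists_isSpectrum (bakerMap M A χ (M ^ (k + 1)))
  have hη := hloc k
  have hcnt := eigenvalueCount_eq hl ν
  have hMr : (2 : ℝ) ≤ M := by exact_mod_cast hM2
  have hdim := pow_rpow_dim hA₁ hA₂ (k + 1)
  have hx2 : 2 ≤ (M : ℝ) ^ (k + 1) := by
    calc (2 : ℝ) ≤ M := hMr
      _ = (M : ℝ) ^ 1 := (pow_one _).symm
      _ ≤ _ := pow_le_pow_right₀ (by linarith) (by omega)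
  have hBn : ‖bakerMap M A χ (M ^ (k + 1))‖ ≤ 1 :=
    norm_bakerMap_le_one hM0 (by positivity) (pow_succ' M k) hχ01
  have hTcard := hs_le_card (norm_pow_le_one hBn (k + 1))
  have hcard : ((Fintype.card (Fin (M ^ (k + 1))) : ℕ) : ℝ) = (M : ℝ) ^ (k + 1) := by
    rw [Fintype.card_fin]; push_cast; rfl
  have hthr : ((M : ℝ) ^ (-ν)) ^ (k + 1) = ((M : ℝ) ^ (k + 1)) ^ (-ν) :=
    Real.rpow_pow_comm (by positivity) _ _
  rw [hcard] at hTcard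
  set x : ℝ := (M : ℝ) ^ (k + 1) with hx
  have hx0 : 0 < x := by linarith
  have hx1 : 1 ≤ x := by linarith
  set X := nearCantor A (M ^ (k + 1)) (k + 1) (x ^ min ε 1) (k + 1) with hX
  have hcardX : (#X : ℝ) ≤ 7 * x ^ (dim M A + ε) := by
    have h1 : (#X : ℝ) ≤ 7 * x ^ min ε 1 * x ^ dim M A := by
      rw [hdim]; exact card_nearCantor_le (Real.one_le_rpow hx1 (by positivity))
    refine h1.trans ?_
    rw [mul_assoc, ← Real.rpow_add hx0]
    refine mul_le_mul_of_nonneg_left (Real.rpow_le_rpow_of_exponent_le hx1 ?_) (by norm_num)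
    linarith [min_le_left ε 1]
  have hmain := card_mul_log_le_of_small_columns (hl (k + 1)).1 hcard hx2 hν
    (Real.sqrt_nonneg C₀) hTcard X (univ.filter fun i => (M : ℝ) ^ (-ν) ≤ ‖l i‖)
    (fun j hj i => by
      refine le_of_sq_le_sq ?_ (by positivity)
      have h3 := (norm_entry_sq_le_hs _ i j).trans hη
      rw [proj, mul_diagonal] at h3
      simp only [mem_compl, hj, not_false_eq_true, if_true, mul_one] at h3
      refine h3.trans (le_of_eq ?_)
      rw [mul_pow, Real.sq_sqrt hC₀.le, sq (x ^ (-(2 + 2 * ν))), ← Real.rpow_add hx0]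
      congr 2
      ring)
    (fun i hi => by
      rw [← hthr, norm_pow]
      have := (mem_filter.mp hi).2
      gcongr)
  rw [← hcnt] at hmain
  have hlogx : Real.log 2 ≤ Real.log x := Real.log_le_log (by norm_num) hx2
  have hlogx0 : 0 < Real.log x := by linarith
  have hpow1 : 1 ≤ x ^ (dim M A + ε) := Real.one_le_rpow hx1 (by positivity)
  have hdiv : (eigenvalueCount M A χ (k + 1) ν : ℝ) * ν ≤
      #X * (3 + 2 * ν) + Real.sqrt C₀ / Real.log 2 := by
    refine le_of_mul_le_mul_right ?_ hlogx0
    have h1 : Real.sqrt C₀ ≤ Real.sqrt C₀ / Real.log 2 * Real.log x := by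
      rw [div_mul_eq_mul_div, le_div_iff₀ hlog2]
      gcongr
    linarith
  rw [div_mul_eq_mul_div, le_div_iff₀ hν]
  refine hdiv.trans ?_
  have h1 : (#X : ℝ) * (3 + 2 * ν) ≤ 7 * x ^ (dim M A + ε) * (3 + 2 * ν) := by gcongr
  have h2 : Real.sqrt C₀ / Real.log 2 ≤ Real.sqrt C₀ / Real.log 2 * x ^ (dim M A + ε) :=
    le_mul_of_one_le_right (by positivity) hpow1
  linarith

end Weyl

end OpenBaker

theorem theorem1p3 (M : ℕ) (A : Finset (Fin M)) (hA₁ : 1 < A.card) (hA₂ : A.card < M) :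
    0 < OpenBaker.gammaA M A ∧
    ∃ β : ℝ, 1 / 2 - OpenBaker.dim M A < β ∧
      ∀ χ : ℝ → ℝ, ContDiff ℝ (⊤ : ℕ∞) χ → HasCompactSupport χ →
        tsupport χ ⊆ Set.Ioo 0 1 → (∀ x, χ x ∈ Set.Icc (0 : ℝ) 1) →
        ∀ ν : ℝ, 0 < ν → ∀ ε : ℝ, 0 < ε →
          ∃ C : ℝ, 0 < C ∧ ∀ k : ℕ, 1 ≤ k →
            (OpenBaker.eigenvalueCount M A χ k ν : ℝ) ≤
              C * ((M : ℝ) ^ k) ^ (OpenBaker.weylExponent M A β ν + ε) := by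
  refine ⟨OpenBaker.gammaA_pos hA₁ hA₂, ?_⟩
  obtain ⟨β, hβ, K, hK, hcr⟩ := OpenBaker.exists_crossSum_exponent hA₁ hA₂
  refine ⟨β, hβ, fun χ hχ hc hsupp hχ01 ν hν => ?_⟩
  have h1 : OpenBaker.HasWeylExponent M A χ ν (4 * (ν - β)) := by
    refine OpenBaker.hasWeylExponent_four hA₁ hA₂ hχ hc hsupp hχ01 ν fun ε hε =>
      ⟨K, hK, fun k => (hcr k).trans ?_⟩
    refine mul_le_mul_of_nonneg_left (Real.rpow_le_rpow_of_exponent_le ?_ (by linarith)) hK.le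
    exact one_le_pow₀ (by exact_mod_cast (by omega : 1 ≤ M))
  have h2 : OpenBaker.HasWeylExponent M A χ ν (4 * (ν - OpenBaker.betaE M A)) :=
    OpenBaker.hasWeylExponent_four hA₁ hA₂ hχ hc hsupp hχ01 ν fun ε hε =>
      OpenBaker.exists_crossSum_le_betaE hA₁ hA₂ hε
  have h3 := OpenBaker.hasWeylExponent_two hA₁ hA₂ hχ hc hsupp hχ01 ν
  have h4 := OpenBaker.hasWeylExponent_dim hA₁ hA₂ hχ hc hsupp hχ01 hν
  have h5 : OpenBaker.HasWeylExponent M A χ ν (OpenBaker.weylExponent M A β ν) := by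
    have key : ∀ a b : ℝ, OpenBaker.HasWeylExponent M A χ ν a →
        OpenBaker.HasWeylExponent M A χ ν b → OpenBaker.HasWeylExponent M A χ ν (min a b) := by
      intro a b ha hb
      rcases min_choice a b with h | h <;> rw [h] <;> assumption
    exact key _ _ (key _ _ h1 h2) (key _ _ h3 h4)
  exact h5
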